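/- Let $k$ be a field and let $\mathscr C,\mathscr D$ be $k$-linear monoidal categories with $k$-bilinear tensor product. Let $F:\mathscr C\to\mathscr D$ be a $k$-linear (strong) monoidal functor with structure isomorphisms $\psi_{X,Y}:F(X)\otimes F(Y)\cong F(X\otimes Y)$ and $1\cong F(1)$. Its centralizer $\mathcal Z(F)$ is the monoidal category of pairs $(U,\rho^U)$, where $U\in\mathscr D$ and $\rho^U(X):U\otimes F(X)\cong F(X)\otimes U$ is a natural isomorphism such that $\rho^U(X\otimes Y)\circ(U\otimes\psi_{X,Y})=(\psi_{X,Y}\otimes U)\circ(F(X)\otimes\rho^U(Y))\circ(\rho^U(X)\otimes F(Y))$. The morphisms are the morphisms of $\mathscr D$ that commute with the half-braidings, and $\rho^{U\otimes V}(X)=(\rho^U(X)\otimes V)\circ(U\otimes\rho^V(X))$. Let $(U,\rho^U,\Delta,\epsilon)$ be a coalgebra object in $\mathcal Z(F)$. Associativity and unit isomorphisms, $\psi_{X,Y}$ and $1\cong F(1)$ are suppressed below. Let $F^{\otimes n}(X_1,\dots,X_n)=F(X_1)\otimes\cdots\otimes F(X_n)$, with $F^{\otimes 0}=1$, and let $\rho^U(X_1,\dots,X_n):U\otimes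 F^{\otimes n}(X_1,\dots,X_n)\to F^{\otimes n}(X_1,\dots,X_n)\otimes U$ be the composite of the maps $\rho^U(X_1),\dots,\rho^U(X_n)$ that moves $U$ past one factor at a time. For $n\ge 0$ let $C^n_{DY}(F,U)=\mathrm{Nat}(U\otimes F^{\otimes n},F^{\otimes n})$ (so $C^0_{DY}(F,U)=\mathrm{Hom}_{\mathscr D}(U,1)$), let $C^n_{DY}(F,U)=0$ for $n<0$, and put $$\delta(f)_{X_0,\dots,X_n}=(F(X_0)\otimes f_{X_1,\dots,X_n})\circ(\rho^U(X_0)\otimes F^{\otimes n}(X_1,\dots,X_n))+\sum_{i=1}^n(-1)^if_{X_0,\dots,X_{i-1}\otimes X_i,\dots,X_n}+(-1)^{n+1}f_{X_0,\dots,X_{n-1}}\otimes F(X_n).$$ Let $\tilde C^n_{DY}(F,U)$ be the space of those $f\in C^n_{DY}(F,U)$ such that, for all $X_1,\dots,X_n\in\mathscr C$ and with $T=F^{\otimes n}(X_1,\dots,X_n)$, $$(f_{X_1,\dots,X_n}\otimes U)\circ(U\otimes\rho^U(X_1,\dots,X_n))\circ(\Delta\otimes T)=\rho^U(X_1,\dots,X_n)\circ(U\otimes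 f_{X_1,\dots,X_n})\circ(\Delta\otimes T).$$ For $f\in C^m_{DY}(F,U)$ and $g\in C^n_{DY}(F,U)$ define $f\cup g\in C^{m+n}_{DY}(F,U)$ by $$(f\cup g)_{X_1,\dots,X_{m+n}}=(f_{X_1,\dots,X_m}\otimes g_{X_{m+1},\dots,X_{m+n}})\circ(U\otimes\rho^U(X_1,\dots,X_m)\otimes F(X_{m+1})\otimes\cdots\otimes F(X_{m+n}))\circ(\Delta\otimes F(X_1)\otimes\cdots\otimes F(X_{m+n})).$$ For $0\le i<m$ define $f\diamond_ig\in C^{m+n-1}_{DY}(F,U)$ by $$\begin{aligned}(f\diamond_ig)_{X_1,\dots,X_{m+n-1}}={}&f_{X_1,\dots,X_i,\,X_{i+1}\otimes\cdots\otimes X_{i+n},\dots,X_{m+n-1}}\\&\circ(U\otimes F(X_1)\otimes\cdots\otimes F(X_i)\otimes g_{X_{i+1},\dots,X_{i+n}}\otimes F(X_{i+n+1})\otimes\cdots\otimes F(X_{m+n-1}))\\&\circ(U\otimes\rho^U(X_1,\dots,X_i)\otimes F(X_{i+1})\otimes\cdots\otimes F(X_{m+n-1}))\circ(\Delta\otimes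 F(X_1)\otimes\cdots\otimes F(X_{m+n-1})),\end{aligned}$$ where the empty tensor product is the unit object; put $f\diamond_ig=0$ for $i\ge m$. Let $$f\diamond g=\sum_{i=0}^{m-1}(-1)^{i(n-1)}f\diamond_ig,\qquad [f,g]=f\diamond g-(-1)^{(m-1)(n-1)}g\diamond f .$$ Then the following hold. 1. $\delta$ maps $\tilde C^n_{DY}(F,U)$ to $\tilde C^{n+1}_{DY}(F,U)$ and $\delta\circ\delta=0$ there. The subspaces $\tilde C^n_{DY}(F,U)$ are closed under all $\diamond_i$ and under $\cup$. 2. $[-,-]$ is a graded Lie bracket on $\tilde C^\bullet_{DY}(F,U)$ with respect to the degree shifted by one: it is $k$-bilinear and, for $x,y,z$ of degrees $a,b,c$, $$[x,y]=-(-1)^{(a-1)(b-1)}[y,x],\qquad [x,[y,z]]=[[x,y],z]+(-1)^{(a-1)(b-1)}[y,[x,z]],$$ with $[x,x]=0$ for $a$ odd and $[x,[x,x]]=0$ for $a$ even (which adds something only in characteristic $2$, resp. $3$). 3. $[-,-]$ and $\cup$ descend to well-defined operations on the cohomology $\tilde H^\bullet_{DY}(F,U)$ of $(\tilde C^\bullet_{DY}(F,U),\delta)$,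 which becomes a Gerstenhaber algebra: $\cup$ is associative and graded commutative, $x\cup y=(-1)^{ab}\,y\cup x$, with unit the class of $\epsilon\in\tilde C^0_{DY}(F,U)$; the bracket is a graded Lie bracket as in part 2; and $$[x\cup y,z]=[x,z]\cup y+(-1)^{a(c-1)}\,x\cup[y,z].$$ -/

import Mathlib

open CategoryTheory MonoidalCategory
open scoped ComonObj

universe w v₁ v₂ u₁ u₂

noncomputable section

namespace DavydovYetter

/-! ## Graded Lie algebras and Gerstenhaber algebras

Graded vector spaces are families `V : ℤ → Type*`. To avoid transports, a graded operation takes the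
degree of its result as an argument, together with a proof that this degree is the right one. -/

section Graded

variable (k : Type w) [Field k] (V : ℤ → Type*) [∀ n, AddCommGroup (V n)] [∀ n, Module k (V n)]

/-- `br` is a graded Lie bracket for the shifted degree `|x| = n - 1`, `x ∈ V n`:
graded antisymmetry and the graded Jacobi identity. The last two fields follow from the first two
when `2`, resp. `3`, is invertible in `k`; they belong to the definition in general. -/
structure IsGradedLieAlgebra
    (br : ∀ a b c : ℤ, a + b = c + 1 → (V a →ₗ[k] V b →ₗ[k] V c)) : Prop where
  antisymm : ∀ (a b c : ℤ) (h : a + b = c + 1) (h' : b + a = c + 1) (x : V a) (y : V b),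
    br a b c h x y = -(((a - 1) * (b - 1)).negOnePow • br b a c h' y x)
  jacobi : ∀ (a b c ab bc ac d : ℤ)
    (hab : a + b = ab + 1) (hbc : b + c = bc + 1) (hac : a + c = ac + 1)
    (h₁ : a + bc = d + 1) (h₂ : ab + c = d + 1) (h₃ : b + ac = d + 1)
    (x : V a) (y : V b) (z : V c),
    br a bc d h₁ x (br b c bc hbc y z) =
      br ab c d h₂ (br a b ab hab x y) z +
        ((a - 1) * (b - 1)).negOnePow • br b ac d h₃ y (br a c ac hac x z)
  lie_self : ∀ (a c : ℤ) (h : a + a = c + 1) (x : V a), Odd a → br a a c h x x = 0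
  lie_lie_self : ∀ (a c d : ℤ) (h : a + a = c + 1) (h' : a + c = d + 1) (x : V a), Even a →
    br a c d h' x (br a a c h x x) = 0

/-- `V` with unit `one`, product `mul` (of degree `0`) and bracket `br` (of degree `-1`) is a
Gerstenhaber algebra: a unital associative graded commutative algebra and a graded Lie algebra for
the shifted degree, such that every `[-, z]` is a graded derivation of the product. -/
structure IsGerstenhaberAlgebra (one : V 0)
    (mul : ∀ a b c : ℤ, a + b = c → (V a →ₗ[k] V b →ₗ[k] V c))
    (br : ∀ a b c : ℤ, a + b = c + 1 → (V a →ₗ[k] V b →ₗ[k] V c)) : Prop where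
  one_mul : ∀ (a : ℤ) (h : 0 + a = a) (x : V a), mul 0 a a h one x = x
  mul_one : ∀ (a : ℤ) (h : a + 0 = a) (x : V a), mul a 0 a h x one = x
  mul_assoc : ∀ (a b c ab bc d : ℤ) (hab : a + b = ab) (hbc : b + c = bc)
    (h₁ : ab + c = d) (h₂ : a + bc = d) (x : V a) (y : V b) (z : V c),
    mul ab c d h₁ (mul a b ab hab x y) z = mul a bc d h₂ x (mul b c bc hbc y z)
  mul_comm : ∀ (a b c : ℤ) (h : a + b = c) (h' : b + a = c) (x : V a) (y : V b),
    mul a b c h x y = (a * b).negOnePow • mul b a c h' y x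
  isGradedLieAlgebra : IsGradedLieAlgebra k V br
  leibniz : ∀ (a b c ab ac bc d : ℤ)
    (hab : a + b = ab) (hac : a + c = ac + 1) (hbc : b + c = bc + 1)
    (h₁ : ab + c = d + 1) (h₂ : ac + b = d) (h₃ : a + bc = d)
    (x : V a) (y : V b) (z : V c),
    br ab c d h₁ (mul a b ab hab x y) z =
      mul ac b d h₂ (br a c ac hac x z) y +
        (a * (c - 1)).negOnePow • mul a bc d h₃ x (br b c bc hbc y z)

end Graded

/-! ## Half-braidings relative to a monoidal functor, and coalgebras among them -/

section Centralizer

variable {C : Type u₁} [Category.{v₁} C] [MonoidalCategory C]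
  {D : Type u₂} [Category.{v₂} D] [MonoidalCategory D]

/-- A half-braiding on `U : D` relative to `F`. -/
structure RelHalfBraiding (F : C ⥤ D) [F.Monoidal] (U : D) where
  β : ∀ X : C, U ⊗ F.obj X ≅ F.obj X ⊗ U
  naturality : ∀ {X Y : C} (f : X ⟶ Y), U ◁ F.map f ≫ (β Y).hom = (β X).hom ≫ F.map f ▷ U
  monoidal : ∀ X Y : C,
    U ◁ Functor.LaxMonoidal.μ F X Y ≫ (β (X ⊗ Y)).hom =
      (α_ U (F.obj X) (F.obj Y)).inv ≫ (β X).hom ▷ F.obj Y ≫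
        (α_ (F.obj X) U (F.obj Y)).hom ≫ F.obj X ◁ (β Y).hom ≫
          (α_ (F.obj X) (F.obj Y) U).inv ≫ Functor.LaxMonoidal.μ F X Y ▷ U

variable {F : C ⥤ D} [F.Monoidal]

/-- Morphisms of the centralizer `𝒵(F)`: those compatible with the half-braidings. -/
def IsCentralHom {U V : D} (ρ : RelHalfBraiding F U) (σ : RelHalfBraiding F V) (f : U ⟶ V) : Prop :=
  ∀ X : C, f ▷ F.obj X ≫ (σ.β X).hom = (ρ.β X).hom ≫ F.obj X ◁ f

namespace RelHalfBraiding

/-- The half-braiding of the unit object of `𝒵(F)`. -/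
def unit (F : C ⥤ D) [F.Monoidal] : RelHalfBraiding F (𝟙_ D) where
  β X := λ_ (F.obj X) ≪≫ (ρ_ (F.obj X)).symm
  naturality f := by simp
  monoidal X Y := by
    simp only [Iso.trans_hom, Iso.symm_hom]
    monoidal

/-- The half-braiding of the tensor product of two objects of `𝒵(F)`. -/
def tensor {U V : D} (ρ : RelHalfBraiding F U) (σ : RelHalfBraiding F V) :
    RelHalfBraiding F (U ⊗ V) where
  β X := α_ U V (F.obj X) ≪≫ whiskerLeftIso U (σ.β X) ≪≫ (α_ U (F.obj X) V).symm ≪≫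
    whiskerRightIso (ρ.β X) V ≪≫ α_ (F.obj X) U V
  naturality {X Y} f := by
    simp only [Iso.trans_hom, Iso.symm_hom, whiskerLeftIso_hom, whiskerRightIso_hom]
    calc
      _ = 𝟙 _ ⊗≫ U ◁ (V ◁ F.map f ≫ (σ.β Y).hom) ⊗≫ (ρ.β Y).hom ▷ V ⊗≫ 𝟙 _ := by monoidal
      _ = 𝟙 _ ⊗≫ U ◁ (σ.β X).hom ⊗≫ (U ◁ F.map f ≫ (ρ.β Y).hom) ▷ V ⊗≫ 𝟙 _ := by
        rw [σ.naturality]; monoidal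
      _ = _ := by rw [ρ.naturality]; monoidal
  monoidal X Y := by
    simp only [Iso.trans_hom, Iso.symm_hom, whiskerLeftIso_hom, whiskerRightIso_hom]
    calc
      _ = 𝟙 _ ⊗≫ U ◁ (V ◁ Functor.LaxMonoidal.μ F X Y ≫ (σ.β (X ⊗ Y)).hom) ⊗≫
          (ρ.β (X ⊗ Y)).hom ▷ V ⊗≫ 𝟙 _ := by monoidal
      _ = 𝟙 _ ⊗≫ U ◁ (σ.β X).hom ▷ F.obj Y ⊗≫ U ◁ F.obj X ◁ (σ.β Y).hom ⊗≫
          (U ◁ Functor.LaxMonoidal.μ F X Y ≫ (ρ.β (X ⊗ Y)).hom) ▷ V ⊗≫ 𝟙 _ := by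
        rw [σ.monoidal]; monoidal
      _ = 𝟙 _ ⊗≫ U ◁ (σ.β X).hom ▷ F.obj Y ⊗≫
          (U ◁ 𝟙 (F.obj X)) ▷ (V ⊗ F.obj Y) ⊗≫
          ((U ⊗ F.obj X) ◁ (σ.β Y).hom ≫ (ρ.β X).hom ▷ (F.obj Y ⊗ V)) ⊗≫
          F.obj X ◁ (ρ.β Y).hom ▷ V ⊗≫ Functor.LaxMonoidal.μ F X Y ▷ U ▷ V ⊗≫ 𝟙 _ := by
        rw [ρ.monoidal]; monoidal
      _ = _ := by rw [whisker_exchange]; monoidal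

end RelHalfBraiding

/-- A coalgebra object of the centralizer `𝒵(F)`: the forgetful functor `𝒵(F) ⥤ D` is faithful and
strict monoidal, so this is a comonoid `U` in `D` with a half-braiding for which comultiplication
`U ⟶ U ⊗ U` and counit `U ⟶ 𝟙_ D` are morphisms of `𝒵(F)`. -/
structure CentralCoalgebra (F : C ⥤ D) [F.Monoidal] where
  obj : D
  ρ : RelHalfBraiding F obj
  comon : ComonObj obj
  comul_central : IsCentralHom ρ (ρ.tensor ρ) Δ[obj]
  counit_central : IsCentralHom ρ (RelHalfBraiding.unit F) ε[obj]

attribute [instance] CentralCoalgebra.comon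

end Centralizer

/-! ## Tuples of objects and iterated tensor products

Tuples `(X₁, …, Xₙ)` of objects of `C` are lists. All suppressed structural isomorphisms are
written out. -/

section Tuples

variable {C : Type u₁} [Category.{v₁} C]

/-- Morphisms `(X₁, …, Xₙ) ⟶ (Y₁, …, Yₙ)` of tuples, i.e. in the product category `Cⁿ`. -/
inductive TupleHom : List C → List C → Type (max u₁ v₁)
  | nil : TupleHom [] []
  | cons {X Y : C} {xs ys : List C} (f : X ⟶ Y) (φ : TupleHom xs ys) :
      TupleHom (X :: xs) (Y :: ys)

variable [MonoidalCategory C]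

/-- `X₁ ⊗ (X₂ ⊗ (⋯ ⊗ (Xₙ ⊗ 𝟙)))` in `C`. -/
def prodObj : List C → C
  | [] => 𝟙_ C
  | X :: xs => X ⊗ prodObj xs

/-- `(…, Xⱼ, Xⱼ₊₁, …) ↦ (…, Xⱼ ⊗ Xⱼ₊₁, …)`, positions counted from `0`
(the tuple is unchanged if there is no position `j + 1`). -/
def contract : ℕ → List C → List C
  | 0, X :: Y :: xs => (X ⊗ Y) :: xs
  | 0, [X] => [X]
  | 0, [] => []
  | j + 1, X :: xs => X :: contract j xs
  | _ + 1, [] => []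

variable {D : Type u₂} [Category.{v₂} D] [MonoidalCategory D] (F : C ⥤ D)

/-- `F^{⊗ n}` on objects: `F X₁ ⊗ (F X₂ ⊗ (⋯ ⊗ (F Xₙ ⊗ 𝟙)))`. -/
@[reducible] def tens : List C → D
  | [] => 𝟙_ D
  | X :: xs => F.obj X ⊗ tens xs

/-- `F^{⊗ n}` on morphisms. -/
def tensMap : {xs ys : List C} → TupleHom xs ys → (tens F xs ⟶ tens F ys)
  | _, _, .nil => 𝟙 (𝟙_ D)
  | _, _, .cons f φ => F.map f ⊗ₘ tensMap φ

/-- `F^{⊗ p}(X) ⊗ F^{⊗ q}(Y) ≅ F^{⊗ (p + q)}(X, Y)`. -/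
def appendIso : (xs ys : List C) → (tens F xs ⊗ tens F ys ≅ tens F (xs ++ ys))
  | [], ys => λ_ (tens F ys)
  | X :: xs, ys => α_ (F.obj X) (tens F xs) (tens F ys) ≪≫
      whiskerLeftIso (F.obj X) (appendIso xs ys)

/-- `F^{⊗ n}(X₁, …, Xₙ) ≅ F^{⊗ p}(X₁, …, X_p) ⊗ F^{⊗ (n - p)}(X_{p+1}, …, Xₙ)`. -/
def splitIso : (p : ℕ) → (xs : List C) → (tens F xs ≅ tens F (xs.take p) ⊗ tens F (xs.drop p))
  | 0, xs => (λ_ (tens F xs)).symm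
  | _ + 1, [] => (λ_ (𝟙_ D)).symm
  | p + 1, X :: xs => whiskerLeftIso (F.obj X) (splitIso p xs) ≪≫
      (α_ (F.obj X) (tens F (xs.take p)) (tens F (xs.drop p))).symm

variable [F.Monoidal]

/-- `F X₁ ⊗ ⋯ ⊗ F Xₙ ≅ F (X₁ ⊗ ⋯ ⊗ Xₙ)`, from the monoidal structure of `F`. -/
def prodIso : (xs : List C) → (tens F xs ≅ F.obj (prodObj xs))
  | [] => Functor.Monoidal.εIso F
  | X :: xs => whiskerLeftIso (F.obj X) (prodIso xs) ≪≫ Functor.Monoidal.μIso F X (prodObj xs)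

/-- `⋯ ⊗ F Xⱼ ⊗ F Xⱼ₊₁ ⊗ ⋯ ≅ ⋯ ⊗ F (Xⱼ ⊗ Xⱼ₊₁) ⊗ ⋯`. -/
def contractIso : (j : ℕ) → (xs : List C) → (tens F xs ≅ tens F (contract j xs))
  | 0, X :: Y :: xs => (α_ (F.obj X) (F.obj Y) (tens F xs)).symm ≪≫
      whiskerRightIso (Functor.Monoidal.μIso F X Y) (tens F xs)
  | 0, [X] => Iso.refl (tens F [X])
  | 0, [] => Iso.refl (tens F [])
  | j + 1, X :: xs => whiskerLeftIso (F.obj X) (contractIso j xs)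
  | _ + 1, [] => Iso.refl (tens F [])

variable {F}

/-- `ρ^U(X₁, …, Xₙ) : U ⊗ F X₁ ⊗ ⋯ ⊗ F Xₙ ⟶ F X₁ ⊗ ⋯ ⊗ F Xₙ ⊗ U`. -/
def RelHalfBraiding.iter {U : D} (ρ : RelHalfBraiding F U) :
    (xs : List C) → (U ⊗ tens F xs ⟶ tens F xs ⊗ U)
  | [] => (ρ_ U).hom ≫ (λ_ U).inv
  | X :: xs => (α_ U (F.obj X) (tens F xs)).inv ≫ (ρ.β X).hom ▷ tens F xs ≫
      (α_ (F.obj X) U (tens F xs)).hom ≫ F.obj X ◁ ρ.iter xs ≫ (α_ (F.obj X) (tens F xs) U).inv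

end Tuples

/-! ## The Davydov–Yetter complex with coefficients and its equivariant subcomplex -/

section Complex

variable (k : Type w) [Field k] {C : Type u₁} [Category.{v₁} C] [MonoidalCategory C]
  {D : Type u₂} [Category.{v₂} D] [MonoidalCategory D] [Preadditive D] [Linear k D]
  {F : C ⥤ D} [F.Monoidal] (U : CentralCoalgebra F)

/-- Families of morphisms `U ⊗ F X₁ ⊗ ⋯ ⊗ F Xₙ ⟶ F X₁ ⊗ ⋯ ⊗ F Xₙ`, without naturality.
For `n < 0` there are no tuples of length `n`, and this is the zero space. -/
abbrev Family (n : ℤ) : Type (max u₁ v₂) :=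
  (xs : {xs : List C // (xs.length : ℤ) = n}) → (U.obj ⊗ tens F xs.1 ⟶ tens F xs.1)

variable {U} in
/-- The component of a family at a tuple (zero if the tuple does not have the right length). -/
def Family.at {n : ℤ} (f : Family U n) (xs : List C) : U.obj ⊗ tens F xs ⟶ tens F xs :=
  if h : (xs.length : ℤ) = n then f ⟨xs, h⟩ else 0

/-- `C^n_{DY}(F, U) = Nat(U ⊗ F^{⊗ n}, F^{⊗ n})`. -/
def cochains [MonoidalPreadditive D] [MonoidalLinear k D] (n : ℤ) : Submodule k (Family U n) where
  carrier := {f | ∀ (xs ys : List C) (hx : (xs.length : ℤ) = n) (hy : (ys.length : ℤ) = n)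
    (φ : TupleHom xs ys), U.obj ◁ tensMap F φ ≫ f ⟨ys, hy⟩ = f ⟨xs, hx⟩ ≫ tensMap F φ}
  add_mem' hf hg xs ys hx hy φ := by
    simp [hf xs ys hx hy φ, hg xs ys hx hy φ]
  zero_mem' xs ys hx hy φ := by simp
  smul_mem' r f hf xs ys hx hy φ := by simp [hf xs ys hx hy φ]

/-- `λ_L : U ⊗ F X₁ ⊗ ⋯ ⊗ F Xₙ ⟶ U ⊗ U ⊗ F X₁ ⊗ ⋯ ⊗ F Xₙ`. -/
def lamL (xs : List C) : U.obj ⊗ tens F xs ⟶ U.obj ⊗ (U.obj ⊗ tens F xs) :=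
  Δ[U.obj] ▷ tens F xs ≫ (α_ U.obj U.obj (tens F xs)).hom

/-- `λ_R : U ⊗ F X₁ ⊗ ⋯ ⊗ F Xₙ ⟶ U ⊗ F X₁ ⊗ ⋯ ⊗ F Xₙ ⊗ U`. -/
def lamR (xs : List C) : U.obj ⊗ tens F xs ⟶ (U.obj ⊗ tens F xs) ⊗ U.obj :=
  lamL U xs ≫ U.obj ◁ U.ρ.iter xs ≫ (α_ U.obj (tens F xs) U.obj).inv

/-- The equivariant cochains `C̃^n_{DY}(F, U)`. -/
def equivCochains [MonoidalPreadditive D] [MonoidalLinear k D] (n : ℤ) :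
    Submodule k (Family U n) where
  carrier := {f | f ∈ cochains k U n ∧ ∀ (xs : List C) (hx : (xs.length : ℤ) = n),
    lamR U xs ≫ f ⟨xs, hx⟩ ▷ U.obj = lamL U xs ≫ U.obj ◁ f ⟨xs, hx⟩ ≫ U.ρ.iter xs}
  add_mem' hf hg := ⟨add_mem hf.1 hg.1, fun xs hx => by
    simp [hf.2 xs hx, hg.2 xs hx]⟩
  zero_mem' := ⟨zero_mem _, fun xs hx => by simp⟩
  smul_mem' r f hf := ⟨Submodule.smul_mem _ r hf.1, fun xs hx => by simp [hf.2 xs hx]⟩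

variable {U}

/-- The first term of the differential:
`(F X₀ ⊗ f_{X₁, …, Xₙ}) ∘ (ρ^U(X₀) ⊗ F X₁ ⊗ ⋯ ⊗ F Xₙ)`. -/
def dFirst {n : ℤ} (f : Family U n) : (xs : List C) → (U.obj ⊗ tens F xs ⟶ tens F xs)
  | [] => 0
  | X :: xs => (α_ U.obj (F.obj X) (tens F xs)).inv ≫ (U.ρ.β X).hom ▷ tens F xs ≫
      (α_ (F.obj X) U.obj (tens F xs)).hom ≫ F.obj X ◁ f.at xs

/-- The middle terms of the differential: `f_{X₀, …, Xⱼ ⊗ Xⱼ₊₁, …, Xₙ}`. -/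
def dMiddle {n : ℤ} (f : Family U n) (j : ℕ) (xs : List C) : U.obj ⊗ tens F xs ⟶ tens F xs :=
  U.obj ◁ (contractIso F j xs).hom ≫ f.at (contract j xs) ≫ (contractIso F j xs).inv

/-- The last term of the differential: `f_{X₀, …, X_{n-1}} ⊗ F Xₙ`. -/
def dLast {n : ℤ} (f : Family U n) (xs : List C) : U.obj ⊗ tens F xs ⟶ tens F xs :=
  U.obj ◁ (splitIso F n.toNat xs).hom ≫
    (α_ U.obj (tens F (xs.take n.toNat)) (tens F (xs.drop n.toNat))).inv ≫
      f.at (xs.take n.toNat) ▷ tens F (xs.drop n.toNat) ≫ (splitIso F n.toNat xs).inv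

lemma Family.at_add {n : ℤ} (f g : Family U n) (xs : List C) :
    (f + g).at xs = f.at xs + g.at xs := by
  unfold Family.at; split <;> simp

lemma Family.at_smul {k : Type w} [Field k] [Linear k D] {n : ℤ} (r : k) (f : Family U n)
    (xs : List C) : (r • f).at xs = r • f.at xs := by
  unfold Family.at; split <;> simp

lemma dFirst_add [MonoidalPreadditive D] {n : ℤ} (f g : Family U n) (xs : List C) :
    dFirst (f + g) xs = dFirst f xs + dFirst g xs := by
  cases xs with
  | nil => exact (add_zero _).symm
  | cons X xs => simp [dFirst, Family.at_add]

lemma dFirst_smul {k : Type w} [Field k] [Linear k D] [MonoidalPreadditive D] [MonoidalLinear k D]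
    {n : ℤ} (r : k) (f : Family U n) (xs : List C) : dFirst (r • f) xs = r • dFirst f xs := by
  cases xs with
  | nil => exact (smul_zero _).symm
  | cons X xs => simp [dFirst, Family.at_smul]

lemma dMiddle_add {n : ℤ} (f g : Family U n) (j : ℕ) (xs : List C) :
    dMiddle (f + g) j xs = dMiddle f j xs + dMiddle g j xs := by
  simp [dMiddle, Family.at_add]

lemma dMiddle_smul {k : Type w} [Field k] [Linear k D] {n : ℤ} (r : k) (f : Family U n) (j : ℕ)
    (xs : List C) : dMiddle (r • f) j xs = r • dMiddle f j xs := by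
  simp [dMiddle, Family.at_smul]

lemma dLast_add [MonoidalPreadditive D] {n : ℤ} (f g : Family U n) (xs : List C) :
    dLast (f + g) xs = dLast f xs + dLast g xs := by
  simp [dLast, Family.at_add]

lemma dLast_smul {k : Type w} [Field k] [Linear k D] [MonoidalPreadditive D] [MonoidalLinear k D]
    {n : ℤ} (r : k) (f : Family U n) (xs : List C) : dLast (r • f) xs = r • dLast f xs := by
  simp [dLast, Family.at_smul]

/-- The differential `δⁿ`; the target degree `l` has to be `n + 1`. -/
def differential [MonoidalPreadditive D] [MonoidalLinear k D] (n l : ℤ) :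
    Family U n →ₗ[k] Family U l where
  toFun f xs := dFirst f xs.1 +
    ∑ j ∈ Finset.range n.toNat, ((j : ℤ) + 1).negOnePow • dMiddle f j xs.1 +
      (n + 1).negOnePow • dLast f xs.1
  map_add' f g := by
    ext xs
    simp only [dFirst_add, dMiddle_add, dLast_add, Pi.add_apply, smul_add, Finset.sum_add_distrib]
    abel
  map_smul' r f := by
    ext xs
    simp only [dFirst_smul, dMiddle_smul, dLast_smul, Pi.smul_apply, smul_add, Finset.smul_sum,
      RingHom.id_apply, smul_comm r]

/-- The cup product of `f ∈ C^m` and `g ∈ C^n`; the target degree `l` has to be `m + n`. -/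
def cup {m n : ℤ} (l : ℤ) (f : Family U m) (g : Family U n) : Family U l := fun xs =>
  let A := xs.1.take m.toNat
  let B := xs.1.drop m.toNat
  U.obj ◁ (splitIso F m.toNat xs.1).hom ≫
    Δ[U.obj] ▷ (tens F A ⊗ tens F B) ≫ (α_ U.obj U.obj (tens F A ⊗ tens F B)).hom ≫
      U.obj ◁ ((α_ U.obj (tens F A) (tens F B)).inv ≫ U.ρ.iter A ▷ tens F B ≫
        (α_ (tens F A) U.obj (tens F B)).hom) ≫
      (α_ U.obj (tens F A) (U.obj ⊗ tens F B)).inv ≫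
        (f.at A ⊗ₘ g.at B) ≫ (splitIso F m.toNat xs.1).inv

/-- The operation `f ◇ᵢ g` for `f ∈ C^m` and `g ∈ C^n`; the target degree `l` has to be
`m + n - 1`. The tuple is cut into blocks `A`, `B`, `E` of lengths `i`, `n`, `m - 1 - i`. -/
def diamondAt {m n : ℤ} (l : ℤ) (i : ℕ) (f : Family U m) (g : Family U n) : Family U l := fun xs =>
  let A := xs.1.take i
  let B := (xs.1.drop i).take n.toNat
  let E := (xs.1.drop i).drop n.toNat
  let blocks : tens F xs.1 ≅ tens F A ⊗ (tens F B ⊗ tens F E) :=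
    splitIso F i xs.1 ≪≫ whiskerLeftIso (tens F A) (splitIso F n.toNat (xs.1.drop i))
  let fuse : tens F A ⊗ (tens F B ⊗ tens F E) ≅ tens F (A ++ prodObj B :: E) :=
    whiskerLeftIso (tens F A) (whiskerRightIso (prodIso F B) (tens F E)) ≪≫
      appendIso F A (prodObj B :: E)
  if (i : ℤ) < m then
    U.obj ◁ blocks.hom ≫
      Δ[U.obj] ▷ (tens F A ⊗ (tens F B ⊗ tens F E)) ≫
        (α_ U.obj U.obj (tens F A ⊗ (tens F B ⊗ tens F E))).hom ≫
          U.obj ◁ ((α_ U.obj (tens F A) (tens F B ⊗ tens F E)).inv ≫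
            U.ρ.iter A ▷ (tens F B ⊗ tens F E) ≫
              (α_ (tens F A) U.obj (tens F B ⊗ tens F E)).hom ≫
                tens F A ◁ ((α_ U.obj (tens F B) (tens F E)).inv ≫ g.at B ▷ tens F E)) ≫
            U.obj ◁ fuse.hom ≫ f.at (A ++ prodObj B :: E) ≫ fuse.inv ≫ blocks.inv
  else 0

/-- `f ◇ g = ∑_{i=0}^{m-1} (-1)^{i(n-1)} f ◇ᵢ g`. -/
def diamond {m n : ℤ} (l : ℤ) (f : Family U m) (g : Family U n) : Family U l :=
  ∑ i ∈ Finset.range m.toNat, ((i : ℤ) * (n - 1)).negOnePow • diamondAt l i f g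

/-- `[f, g] = f ◇ g - (-1)^{(m-1)(n-1)} g ◇ f`; the target degree `l` has to be `m + n - 1`. -/
def bracket {m n : ℤ} (l : ℤ) (f : Family U m) (g : Family U n) : Family U l :=
  diamond l f g - ((m - 1) * (n - 1)).negOnePow • diamond l g f

variable (U)

/-- The cochain `U ⊗ 𝟙 ≅ U ⟶ 𝟙` of degree `0` given by the counit. -/
def unitCochain : Family U 0 := fun xs =>
  match xs with
  | ⟨[], _⟩ => (ρ_ U.obj).hom ≫ ε[U.obj]
  | ⟨_ :: _, _⟩ => 0

variable [MonoidalPreadditive D] [MonoidalLinear k D]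

/-- The cocycles of the equivariant complex. -/
def cocycles (n : ℤ) : Submodule k (Family U n) :=
  equivCochains k U n ⊓ LinearMap.ker (differential k n (n + 1))

/-- The coboundaries of the equivariant complex. -/
def coboundaries (n : ℤ) : Submodule k (Family U n) :=
  (equivCochains k U (n - 1)).map (differential k (n - 1) n)

/-- The cohomology `H̃^n_{DY}(F, U)` of the equivariant complex. -/
abbrev Cohomology (n : ℤ) : Type (max u₁ v₂) :=
  cocycles k U n ⧸ (coboundaries k U n).submoduleOf (cocycles k U n)

variable {U} in
/-- The cohomology class of a cocycle. -/
def cls {n : ℤ} (f : Family U n) (hf : f ∈ cocycles k U n) : Cohomology k U n :=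
  Submodule.Quotient.mk ⟨f, hf⟩

end Complex

end DavydovYetter

end

/-! Equivariance makes the coefficients disappear. A cochain component `U ⊗ A ⟶ A` is a co-Kleisli
endomorphism of `A` for the comonad `U ⊗ -`. If `A` carries a map `U ⊗ A ⟶ A ⊗ U` compatible with
`Δ` and `ε`, co-Kleisli morphisms can be whiskered on both sides, and the interchange law follows
from equivariance (`whisk_exchange`). So equivariant morphisms form a monoidal category `SwapObj U`,
and the half-braiding of `U` lifts `F` to a monoidal functor `CentralCoalgebra.lift` into it.
Natural endomorphisms of the tensor powers of this lift are exactly the equivariant cochains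
(`exists_ofLift_eq`, `ofLift_natural`): the complex is the coefficient-free Davydov–Yetter complex
of the lift.

There `f ◇ᵢ g` means: apply `g` to a block, fuse the block by the monoidal structure of the functor,
apply `f`, and split the block again (`ofLift_compU`). Associativity of nested insertions and
commutation of disjoint ones become statements about cutting and fusing tuples (`Fuse.nest`,
`Fuse.disjoint`). The identity cochains of degrees 0, 1 and 2 are the unit of the cup product, the
operad unit and an associative multiplication `μ`, and `μ` expresses the differential and the cup
product (`differential_eq`, `cup_eq`).

The rest is the algebra of Gerstenhaber and Voronov, for any `MultiplicativeOperad`. With signs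
absorbed into the partial compositions, their sum `◇` is a graded pre-Lie product (`dia_dia`), so
its commutator is a Lie bracket. The differential is `-[-, μ]`, and it squares to zero because `μ ◇
μ = 0`. The cup product is `μ{x, y}` up to sign. It is associative and compatible with the
differential on cochains; commutativity and the Leibniz rule for the bracket hold up to the
homotopies `x ◇ y` (`exists_cup_comm`) and `z{x, y}` (`exists_br_cup`), whose boundaries are
computed by sorting insertions by relative position (`dia_brace₂`, `brace₂_dia`). -/

noncomputable section

namespace DavydovYetter

/-! ## The monoidal category of equivariant co-Kleisli morphisms -/

section SwapCategory

variable {D : Type u₂} [Category.{v₂} D] [MonoidalCategory D]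

/-- An object `A` with a map `U ⊗ A ⟶ A ⊗ U` compatible with the comonoid structure of `U`. -/
structure SwapObj (U : D) [ComonObj U] where
  obj : D
  s : U ⊗ obj ⟶ obj ⊗ U
  s_comul : s ≫ obj ◁ Δ[U] = Δ[U] ▷ obj ⊗≫ U ◁ s ⊗≫ s ▷ U ⊗≫ 𝟙 _
  s_counit : s ≫ obj ◁ ε[U] = ε[U] ▷ obj ⊗≫ 𝟙 _

variable {U : D} [ComonObj U]

/-- The morphism of cofree `U`-comodules corresponding to `f : U ⊗ A ⟶ B`. -/
def colift {A B : D} (f : U ⊗ A ⟶ B) : U ⊗ A ⟶ U ⊗ B :=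
  Δ[U] ▷ A ≫ (α_ U U A).hom ≫ U ◁ f

/-- The associator is hidden in `⊗≫`, so that `monoidal` can fit the composite into longer ones. -/
lemma comul_assoc_coherent :
    Δ[U] ≫ U ◁ Δ[U] = Δ[U] ≫ Δ[U] ▷ U ⊗≫ 𝟙 _ := by
  rw [ComonObj.comul_assoc]; monoidal

/-- Coassociativity of `Δ`; this is associativity of co-Kleisli composition. -/
lemma colift_colift {A B X : D} (f : U ⊗ A ⟶ B) (g : U ⊗ B ⟶ X) :
    colift (colift f ≫ g) = colift f ≫ colift g := by
  unfold colift
  calc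
    _ = 𝟙 _ ⊗≫ (Δ[U] ≫ U ◁ Δ[U]) ▷ A ⊗≫ U ◁ U ◁ f ⊗≫ U ◁ g := by monoidal
    _ = 𝟙 _ ⊗≫ Δ[U] ▷ A ⊗≫ (Δ[U] ▷ (U ⊗ A) ≫ (U ⊗ U) ◁ f) ⊗≫ U ◁ g := by
      rw [comul_assoc_coherent]; monoidal
    _ = _ := by rw [← whisker_exchange]; monoidal

/-- The morphism `U ⊗ A ⟶ B` with no dependence on `U`. -/
def pureHom (U : D) [ComonObj U] {A B : D} (a : A ⟶ B) : U ⊗ A ⟶ B :=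
  ε[U] ▷ A ≫ (λ_ A).hom ≫ a

/-- This and the next lemma are the two counit laws. They reduce composition with a pure morphism,
on either side, to composition in `D`. -/
lemma colift_pureHom {A B : D} (a : A ⟶ B) : colift (pureHom U a) = U ◁ a := by
  unfold colift pureHom
  calc
    _ = (Δ[U] ≫ U ◁ ε[U]) ▷ A ⊗≫ U ◁ a := by monoidal
    _ = _ := by rw [ComonObj.comul_counit]; monoidal

lemma colift_comp_pureHom {A B X : D} (f : U ⊗ A ⟶ B) (b : B ⟶ X) :
    colift f ≫ pureHom U b = f ≫ b := by
  unfold colift pureHom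
  calc
    _ = Δ[U] ▷ A ⊗≫ (U ◁ f ≫ ε[U] ▷ B) ⊗≫ b := by monoidal
    _ = 𝟙 _ ⊗≫ (Δ[U] ≫ ε[U] ▷ U) ▷ A ⊗≫ f ⊗≫ b := by rw [whisker_exchange]; monoidal
    _ = _ := by rw [ComonObj.counit_comul]; monoidal

namespace SwapObj

/-- Compatibility of `f : U ⊗ A ⟶ B` with the swaps. -/
def IsEquivariant {A B : D} (s : U ⊗ A ⟶ A ⊗ U) (t : U ⊗ B ⟶ B ⊗ U) (f : U ⊗ A ⟶ B) : Prop :=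
  (Δ[U] ▷ A ≫ (α_ U U A).hom ≫ U ◁ s ≫ (α_ U A U).inv) ≫ f ▷ U = colift f ≫ t

/-- Equivariance of `g` removes `r`; what remains is equivariance of `f`, applied under one of the
copies of `U` that coassociativity provides. -/
lemma IsEquivariant.comp {A B X : D} {s : U ⊗ A ⟶ A ⊗ U} {t : U ⊗ B ⟶ B ⊗ U} {r : U ⊗ X ⟶ X ⊗ U}
    {f : U ⊗ A ⟶ B} {g : U ⊗ B ⟶ X}
    (hf : IsEquivariant s t f) (hg : IsEquivariant t r g) :
    IsEquivariant s r (colift f ≫ g) := by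
  unfold IsEquivariant at *
  rw [colift_colift, Category.assoc (colift f), ← hg]
  unfold colift at *
  calc
    _ = 𝟙 _ ⊗≫ Δ[U] ▷ A ⊗≫ (U ◁ s ≫ Δ[U] ▷ (A ⊗ U)) ⊗≫ U ◁ f ▷ U ⊗≫ g ▷ U := by
      monoidal
    _ = 𝟙 _ ⊗≫ (Δ[U] ≫ Δ[U] ▷ U ⊗≫ 𝟙 (U ⊗ U ⊗ U)) ▷ A ⊗≫ U ◁ U ◁ s ⊗≫ U ◁ f ▷ U ⊗≫ g ▷ U := by
      rw [whisker_exchange]; monoidal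
    _ = 𝟙 _ ⊗≫ Δ[U] ▷ A ⊗≫
        U ◁ ((Δ[U] ▷ A ≫ (α_ U U A).hom ≫ U ◁ s ≫ (α_ U A U).inv) ≫ f ▷ U) ⊗≫
          g ▷ U := by
      rw [← comul_assoc_coherent]; monoidal
    _ = 𝟙 _ ⊗≫ (Δ[U] ≫ U ◁ Δ[U]) ▷ A ⊗≫ U ◁ U ◁ f ⊗≫ U ◁ t ⊗≫ g ▷ U := by
      rw [hf]; monoidal
    _ = 𝟙 _ ⊗≫ Δ[U] ▷ A ⊗≫ (Δ[U] ▷ (U ⊗ A) ≫ (U ⊗ U) ◁ f) ⊗≫ U ◁ t ⊗≫ g ▷ U := by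
      rw [comul_assoc_coherent]; monoidal
    _ = _ := by rw [← whisker_exchange]; monoidal

lemma isEquivariant_pureHom {A B : D} {s : U ⊗ A ⟶ A ⊗ U} {t : U ⊗ B ⟶ B ⊗ U} (a : A ⟶ B)
    (ha : U ◁ a ≫ t = s ≫ a ▷ U) : IsEquivariant s t (pureHom U a) := by
  unfold IsEquivariant
  rw [colift_pureHom, ha]
  unfold pureHom
  calc
    _ = 𝟙 _ ⊗≫ Δ[U] ▷ A ⊗≫ (U ◁ s ≫ ε[U] ▷ (A ⊗ U)) ⊗≫ a ▷ U := by monoidal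
    _ = 𝟙 _ ⊗≫ (Δ[U] ≫ ε[U] ▷ U) ▷ A ⊗≫ s ⊗≫ a ▷ U := by
      rw [whisker_exchange]; monoidal
    _ = _ := by rw [ComonObj.counit_comul]; monoidal

/-- Equivariant co-Kleisli morphisms. -/
@[ext]
structure Hom (A B : SwapObj U) where
  hom : U ⊗ A.obj ⟶ B.obj
  equivariant : IsEquivariant A.s B.s hom

/-- An equivariant morphism with no dependence on `U`. -/
@[simps]
def Hom.pure {A B : SwapObj U} (a : A.obj ⟶ B.obj)
    (ha : U ◁ a ≫ B.s = A.s ≫ a ▷ U) : Hom A B :=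
  ⟨pureHom U a, isEquivariant_pureHom a ha⟩

lemma pureHom_colift {A B X : D} (a : A ⟶ B) (g : U ⊗ B ⟶ X) :
    colift (pureHom U a) ≫ g = U ◁ a ≫ g := by rw [colift_pureHom]

instance : Category (SwapObj U) where
  Hom := Hom
  id A := Hom.pure (𝟙 _) (by simp)
  comp f g := ⟨colift f.hom ≫ g.hom, f.equivariant.comp g.equivariant⟩
  id_comp f := Hom.ext (by simp [pureHom_colift])
  comp_id f := Hom.ext (by simp [colift_comp_pureHom])
  assoc f g h := Hom.ext (by simp [colift_colift])

@[ext]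
lemma hom_ext {A B : SwapObj U} {f g : A ⟶ B} (h : f.hom = g.hom) : f = g := Hom.ext h

lemma id_hom (A : SwapObj U) : Hom.hom (𝟙 A) = pureHom U (𝟙 A.obj) := rfl

lemma comp_hom {A B X : SwapObj U} (f : A ⟶ B) (g : B ⟶ X) :
    (f ≫ g).hom = colift f.hom ≫ g.hom := rfl

/-- `Hom.pure` as a morphism of the category. -/
abbrev pure {A B : SwapObj U} (a : A.obj ⟶ B.obj)
    (ha : U ◁ a ≫ B.s = A.s ≫ a ▷ U) : A ⟶ B := Hom.pure a ha

lemma comp_pure_hom {A B X : SwapObj U} (f : A ⟶ B) (b : B.obj ⟶ X.obj) (hb) :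
    (f ≫ pure b hb).hom = f.hom ≫ b := colift_comp_pureHom _ _

/-- An isomorphism of underlying objects compatible with the swaps. -/
@[simps]
def pureIso {A B : SwapObj U} (a : A.obj ≅ B.obj)
    (ha : U ◁ a.hom ≫ B.s = A.s ≫ a.hom ▷ U) : A ≅ B where
  hom := pure a.hom ha
  inv := pure a.inv (by
    rw [← cancel_epi (U ◁ a.hom), reassoc_of% ha]; simp)
  hom_inv_id := by ext; simp [comp_pure_hom, pureHom, id_hom]
  inv_hom_id := by ext; simp [comp_pure_hom, pureHom, id_hom]

/-- The unit object. -/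
@[simps]
def unitObj (U : D) [ComonObj U] : SwapObj U where
  obj := 𝟙_ D
  s := (ρ_ U).hom ≫ (λ_ U).inv
  s_comul := by monoidal
  s_counit := by monoidal

/-- The swap of a tensor product. -/
def swapTens {A B : D} (s : U ⊗ A ⟶ A ⊗ U) (t : U ⊗ B ⟶ B ⊗ U) : U ⊗ (A ⊗ B) ⟶ (A ⊗ B) ⊗ U :=
  (α_ U A B).inv ≫ s ▷ B ≫ (α_ A U B).hom ≫ A ◁ t ≫ (α_ A B U).inv

/-- The tensor product of objects. -/
@[simps]
def tensObj (A B : SwapObj U) : SwapObj U where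
  obj := A.obj ⊗ B.obj
  s := swapTens A.s B.s
  s_comul := by
    unfold swapTens
    calc
      _ = 𝟙 _ ⊗≫ A.s ▷ B.obj ⊗≫ A.obj ◁ (B.s ≫ B.obj ◁ Δ[U]) ⊗≫ 𝟙 _ := by monoidal
      _ = 𝟙 _ ⊗≫ (A.s ≫ A.obj ◁ Δ[U]) ▷ B.obj ⊗≫ A.obj ◁ U ◁ B.s ⊗≫ A.obj ◁ B.s ▷ U ⊗≫ 𝟙 _ := by
        rw [B.s_comul]; monoidal
      _ = 𝟙 _ ⊗≫ Δ[U] ▷ (A.obj ⊗ B.obj) ⊗≫ U ◁ A.s ▷ B.obj ⊗≫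
          (A.s ▷ (U ⊗ B.obj) ≫ (A.obj ⊗ U) ◁ B.s) ⊗≫ A.obj ◁ B.s ▷ U ⊗≫ 𝟙 _ := by
        rw [A.s_comul]; monoidal
      _ = _ := by rw [← whisker_exchange]; monoidal
  s_counit := by
    unfold swapTens
    calc
      _ = 𝟙 _ ⊗≫ A.s ▷ B.obj ⊗≫ A.obj ◁ (B.s ≫ B.obj ◁ ε[U]) ⊗≫ 𝟙 _ := by monoidal
      _ = 𝟙 _ ⊗≫ (A.s ≫ A.obj ◁ ε[U]) ▷ B.obj ⊗≫ 𝟙 _ := by rw [B.s_counit]; monoidal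
      _ = _ := by rw [A.s_counit]; monoidal

/-! ### Whiskerings and the interchange law. -/

/-- Underlying morphism of the whiskering `A ◁ g`. -/
def whiskL (A : SwapObj U) {B B' : D} (g : U ⊗ B ⟶ B') : U ⊗ (A.obj ⊗ B) ⟶ A.obj ⊗ B' :=
  (α_ U A.obj B).inv ≫ A.s ▷ B ≫ (α_ A.obj U B).hom ≫ A.obj ◁ g

/-- Underlying morphism of the whiskering `f ▷ B`. -/
def whiskR {A A' : D} (f : U ⊗ A ⟶ A') (B : D) : U ⊗ (A ⊗ B) ⟶ A' ⊗ B :=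
  (α_ U A B).inv ≫ f ▷ B

/-- Two copies of `U` cross `A`, the one used by `g` and the one that survives. By `s_comul` they
may be created after the crossing, and then equivariance of `g` applies under `A`. -/
lemma isEquivariant_whiskL (A : SwapObj U) {B B' : SwapObj U} {g : U ⊗ B.obj ⟶ B'.obj}
    (hg : IsEquivariant B.s B'.s g) : IsEquivariant (swapTens A.s B.s) (swapTens A.s B'.s) (whiskL A g) := by
  unfold IsEquivariant colift at *
  simp only [swapTens, whiskL]
  calc
    _ = 𝟙 _ ⊗≫ Δ[U] ▷ (A.obj ⊗ B.obj) ⊗≫ U ◁ A.s ▷ B.obj ⊗≫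
        ((U ⊗ A.obj) ◁ B.s ≫ A.s ▷ (B.obj ⊗ U)) ⊗≫ A.obj ◁ g ▷ U ⊗≫ 𝟙 _ := by monoidal
    _ = 𝟙 _ ⊗≫ (Δ[U] ▷ A.obj ⊗≫ U ◁ A.s ⊗≫ A.s ▷ U ⊗≫ 𝟙 (A.obj ⊗ U ⊗ U)) ▷ B.obj ⊗≫
          A.obj ◁ U ◁ B.s ⊗≫ A.obj ◁ g ▷ U ⊗≫ 𝟙 _ := by rw [whisker_exchange]; monoidal
    _ = 𝟙 _ ⊗≫ A.s ▷ B.obj ⊗≫ A.obj ◁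
        ((Δ[U] ▷ B.obj ≫ (α_ U U B.obj).hom ≫ U ◁ B.s ≫ (α_ U B.obj U).inv) ≫ g ▷ U) ⊗≫ 𝟙 _ := by
      rw [← A.s_comul]; monoidal
    _ = 𝟙 _ ⊗≫ (A.s ≫ A.obj ◁ Δ[U]) ▷ B.obj ⊗≫ A.obj ◁ U ◁ g ⊗≫ A.obj ◁ B'.s ⊗≫ 𝟙 _ := by
      rw [hg]; monoidal
    _ = 𝟙 _ ⊗≫ Δ[U] ▷ (A.obj ⊗ B.obj) ⊗≫ U ◁ A.s ▷ B.obj ⊗≫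
          (A.s ▷ (U ⊗ B.obj) ≫ (A.obj ⊗ U) ◁ g) ⊗≫ A.obj ◁ B'.s ⊗≫ 𝟙 _ := by
      rw [A.s_comul]; monoidal
    _ = _ := by rw [← whisker_exchange]; monoidal

lemma isEquivariant_whiskR {A A' : SwapObj U} {f : U ⊗ A.obj ⟶ A'.obj} (B : SwapObj U)
    (hf : IsEquivariant A.s A'.s f) :
    IsEquivariant (swapTens A.s B.s) (swapTens A'.s B.s) (whiskR f B.obj) := by
  unfold IsEquivariant colift at *
  simp only [swapTens, whiskR]
  calc
    _ = 𝟙 _ ⊗≫ Δ[U] ▷ (A.obj ⊗ B.obj) ⊗≫ U ◁ A.s ▷ B.obj ⊗≫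
        ((U ⊗ A.obj) ◁ B.s ≫ f ▷ (B.obj ⊗ U)) ⊗≫ 𝟙 _ := by monoidal
    _ = 𝟙 _ ⊗≫ ((Δ[U] ▷ A.obj ≫ (α_ U U A.obj).hom ≫ U ◁ A.s ≫ (α_ U A.obj U).inv) ≫ f ▷ U) ▷
          B.obj ⊗≫ A'.obj ◁ B.s ⊗≫ 𝟙 _ := by rw [whisker_exchange]; monoidal
    _ = _ := by rw [hf]; monoidal

/-- The interchange law, which is where equivariance is needed. -/
lemma whisk_exchange {A A' B B' : SwapObj U} {f : U ⊗ A.obj ⟶ A'.obj}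
    (hf : IsEquivariant A.s A'.s f) (g : U ⊗ B.obj ⟶ B'.obj) :
    colift (whiskL A g) ≫ whiskR f B'.obj = colift (whiskR f B.obj) ≫ whiskL A' g := by
  unfold IsEquivariant colift at *
  unfold whiskL whiskR
  calc
    _ = 𝟙 _ ⊗≫ Δ[U] ▷ (A.obj ⊗ B.obj) ⊗≫ U ◁ A.s ▷ B.obj ⊗≫
        ((U ⊗ A.obj) ◁ g ≫ f ▷ B'.obj) := by monoidal
    _ = 𝟙 _ ⊗≫ ((Δ[U] ▷ A.obj ≫ (α_ U U A.obj).hom ≫ U ◁ A.s ≫ (α_ U A.obj U).inv) ≫ f ▷ U) ▷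
          B.obj ⊗≫ A'.obj ◁ g := by rw [whisker_exchange]; monoidal
    _ = _ := by rw [hf]; monoidal

lemma whiskL_pureHom (A : SwapObj U) {B B' : D} (b : B ⟶ B') :
    whiskL A (pureHom U b) = pureHom U (A.obj ◁ b) := by
  unfold whiskL pureHom
  calc
    _ = 𝟙 _ ⊗≫ (A.s ≫ A.obj ◁ ε[U]) ▷ B ⊗≫ A.obj ◁ b := by monoidal
    _ = _ := by rw [A.s_counit]; monoidal

lemma whiskR_pureHom {A A' : D} (a : A ⟶ A') (B : D) :
    whiskR (pureHom U a) B = pureHom U (a ▷ B) := by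
  unfold whiskR pureHom; monoidal

/-- Functoriality of left whiskering on composites is compatibility of the swap with `Δ`, as on
identities (`whiskL_pureHom`) it is compatibility with `ε`. -/
lemma whiskL_comp (A : SwapObj U) {B B' B'' : D} (g : U ⊗ B ⟶ B') (g' : U ⊗ B' ⟶ B'') :
    whiskL A (colift g ≫ g') = colift (whiskL A g) ≫ whiskL A g' := by
  unfold whiskL colift
  calc
    _ = 𝟙 _ ⊗≫ (A.s ≫ A.obj ◁ Δ[U]) ▷ B ⊗≫ A.obj ◁ U ◁ g ⊗≫ A.obj ◁ g' := by monoidal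
    _ = 𝟙 _ ⊗≫ Δ[U] ▷ (A.obj ⊗ B) ⊗≫ U ◁ A.s ▷ B ⊗≫
        (A.s ▷ (U ⊗ B) ≫ (A.obj ⊗ U) ◁ g) ⊗≫ A.obj ◁ g' := by rw [A.s_comul]; monoidal
    _ = _ := by rw [← whisker_exchange]; monoidal

lemma whiskR_comp {A A' A'' : D} (f : U ⊗ A ⟶ A') (f' : U ⊗ A' ⟶ A'') (B : D) :
    whiskR (colift f ≫ f') B = colift (whiskR f B) ≫ whiskR f' B := by
  unfold whiskR colift; monoidal

/-! ### Tensor product and coherence of the category of equivariant morphisms. -/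

instance : MonoidalCategoryStruct (SwapObj U) where
  tensorObj := tensObj
  tensorUnit := unitObj U
  whiskerLeft A _ _ g := ⟨whiskL A g.hom, isEquivariant_whiskL A g.equivariant⟩
  whiskerRight f B := ⟨whiskR f.hom B.obj, isEquivariant_whiskR B f.equivariant⟩
  tensorHom {A A' B B'} f g :=
    ⟨colift (whiskR f.hom B.obj) ≫ whiskL A' g.hom,
      IsEquivariant.comp (isEquivariant_whiskR B f.equivariant)
        (isEquivariant_whiskL A' g.equivariant)⟩
  associator A B X := pureIso (α_ A.obj B.obj X.obj) (by
    simp only [tensObj_s, swapTens]; monoidal)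
  leftUnitor A := pureIso (λ_ A.obj) (by simp only [tensObj_s, swapTens, unitObj]; monoidal)
  rightUnitor A := pureIso (ρ_ A.obj) (by simp only [tensObj_s, swapTens, unitObj]; monoidal)

lemma tensorObj_obj (A B : SwapObj U) : (A ⊗ B).obj = A.obj ⊗ B.obj := rfl

lemma whiskerLeft_hom (A : SwapObj U) {B B' : SwapObj U} (g : B ⟶ B') :
    (A ◁ g).hom = whiskL A g.hom := rfl
lemma whiskerRight_hom {A A' : SwapObj U} (f : A ⟶ A') (B : SwapObj U) :
    (f ▷ B).hom = whiskR f.hom B.obj := rfl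
lemma tensorHom_eq {A A' B B' : SwapObj U} (f : A ⟶ A') (g : B ⟶ B') :
    f ⊗ₘ g = f ▷ B ≫ A' ◁ g := rfl

lemma associator_inv_hom (A B X : SwapObj U) :
    (α_ A B X).inv.hom = pureHom U (α_ A.obj B.obj X.obj).inv := rfl
lemma leftUnitor_inv_hom (A : SwapObj U) : (λ_ A).inv.hom = pureHom U (λ_ A.obj).inv := rfl
lemma pureHom_comp {A B X : D} (a : A ⟶ B) (b : B ⟶ X) :
    colift (pureHom U a) ≫ pureHom U b = pureHom U (a ≫ b) := by
  rw [colift_comp_pureHom]; simp [pureHom]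

lemma whiskL_tensObj (A B : SwapObj U) {X X' : D} (f : U ⊗ X ⟶ X') :
    whiskL (tensObj A B) f ≫ (α_ A.obj B.obj X').hom =
      U ◁ (α_ A.obj B.obj X).hom ≫ whiskL A (whiskL B f) := by
  unfold whiskL
  simp only [tensObj_s, swapTens]
  monoidal

lemma whiskL_whiskR (A : SwapObj U) {B B' : D} (f : U ⊗ B ⟶ B') (X : D) :
    whiskR (whiskL A f) X ≫ (α_ A.obj B' X).hom =
      U ◁ (α_ A.obj B X).hom ≫ whiskL A (whiskR f X) := by
  unfold whiskL whiskR; monoidal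

omit [ComonObj U] in
lemma whiskR_tens {A A' : D} (f : U ⊗ A ⟶ A') (B X : D) :
    whiskR (whiskR f B) X ≫ (α_ A' B X).hom = U ◁ (α_ A B X).hom ≫ whiskR f (B ⊗ X) := by
  unfold whiskR; monoidal

lemma whiskL_unit {B B' : D} (f : U ⊗ B ⟶ B') :
    whiskL (unitObj U) f ≫ (λ_ B').hom = U ◁ (λ_ B).hom ≫ f := by
  unfold whiskL; simp only [unitObj]; monoidal

omit [ComonObj U] in
lemma whiskR_unit {B B' : D} (f : U ⊗ B ⟶ B') :
    whiskR f (𝟙_ D) ≫ (ρ_ B').hom = U ◁ (ρ_ B).hom ≫ f := by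
  unfold whiskR; monoidal

lemma whiskerLeft_comp' (A : SwapObj U) {B B' B'' : SwapObj U} (g : B ⟶ B') (g' : B' ⟶ B'') :
    A ◁ (g ≫ g') = A ◁ g ≫ A ◁ g' := hom_ext (whiskL_comp A g.hom g'.hom)

lemma whiskerRight_comp' {A A' A'' : SwapObj U} (f : A ⟶ A') (f' : A' ⟶ A'') (B : SwapObj U) :
    (f ≫ f') ▷ B = f ▷ B ≫ f' ▷ B := hom_ext (whiskR_comp f.hom f'.hom B.obj)

lemma whisker_exchange' {A A' B B' : SwapObj U} (f : A ⟶ A') (g : B ⟶ B') :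
    A ◁ g ≫ f ▷ B' = f ▷ B ≫ A' ◁ g := hom_ext (whisk_exchange f.equivariant g.hom)

lemma whiskerLeft_id' (A B : SwapObj U) : A ◁ 𝟙 B = 𝟙 (A ⊗ B) :=
  hom_ext (by simp [whiskerLeft_hom, id_hom, whiskL_pureHom, tensorObj_obj])

lemma id_whiskerRight' (A B : SwapObj U) : 𝟙 A ▷ B = 𝟙 (A ⊗ B) :=
  hom_ext (by simp [whiskerRight_hom, id_hom, whiskR_pureHom, tensorObj_obj])

lemma associator_naturality_left' {A A' : SwapObj U} (f : A ⟶ A') (B X : SwapObj U) :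
    (f ▷ B) ▷ X ≫ (α_ A' B X).hom = (α_ A B X).hom ≫ f ▷ (B ⊗ X) := by
  exact hom_ext ((colift_comp_pureHom _ _).trans
    ((whiskR_tens f.hom B.obj X.obj).trans (pureHom_colift _ _).symm))

lemma associator_naturality_middle' (A : SwapObj U) {B B' : SwapObj U} (f : B ⟶ B')
    (X : SwapObj U) : (A ◁ f) ▷ X ≫ (α_ A B' X).hom = (α_ A B X).hom ≫ A ◁ (f ▷ X) := by
  exact hom_ext ((colift_comp_pureHom _ _).trans
    ((whiskL_whiskR A f.hom X.obj).trans (pureHom_colift _ _).symm))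

lemma associator_naturality_right' (A B : SwapObj U) {X X' : SwapObj U} (f : X ⟶ X') :
    (A ⊗ B) ◁ f ≫ (α_ A B X').hom = (α_ A B X).hom ≫ A ◁ (B ◁ f) := by
  exact hom_ext ((colift_comp_pureHom _ _).trans
    ((whiskL_tensObj A B f.hom).trans (pureHom_colift _ _).symm))

instance : MonoidalCategory (SwapObj U) where
  tensorHom_def _ _ := rfl
  id_tensorHom_id A B := by rw [tensorHom_eq, id_whiskerRight', whiskerLeft_id', Category.id_comp]
  tensorHom_comp_tensorHom f₁ f₂ g₁ g₂ := by
    simp only [tensorHom_eq, whiskerLeft_comp', whiskerRight_comp', Category.assoc]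
    -- Functoriality of the tensor product in two variables is the interchange law, hence the
    -- restriction to equivariant morphisms.
    rw [← Category.assoc (_ ◁ f₂), whisker_exchange', Category.assoc]
  whiskerLeft_id := whiskerLeft_id'
  id_whiskerRight := id_whiskerRight'
  associator_naturality f₁ f₂ f₃ := by
    simp only [tensorHom_eq, whiskerLeft_comp', whiskerRight_comp', Category.assoc]
    rw [associator_naturality_right', ← Category.assoc ((_ ◁ f₂) ▷ _),
      associator_naturality_middle', Category.assoc, ← Category.assoc ((f₁ ▷ _) ▷ _),
      associator_naturality_left', Category.assoc]
  leftUnitor_naturality {A B} f := by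
    exact hom_ext ((colift_comp_pureHom _ _).trans
      ((whiskL_unit f.hom).trans (pureHom_colift _ _).symm))
  rightUnitor_naturality {A B} f := by
    exact hom_ext ((colift_comp_pureHom _ _).trans
      ((whiskR_unit f.hom).trans (pureHom_colift _ _).symm))
  pentagon A B X Y := by
    refine hom_ext ?_
    -- Associators are pure, and pure morphisms whisker and compose as in `D`, so the pentagon is
    -- inherited.
    change colift (whiskR (pureHom U (α_ A.obj B.obj X.obj).hom) Y.obj) ≫
      colift (pureHom U (α_ A.obj (B.obj ⊗ X.obj) Y.obj).hom) ≫
        whiskL A (pureHom U (α_ B.obj X.obj Y.obj).hom) =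
      colift (pureHom U (α_ (A.obj ⊗ B.obj) X.obj Y.obj).hom) ≫
        pureHom U (α_ A.obj B.obj (X.obj ⊗ Y.obj)).hom
    rw [whiskL_pureHom, whiskR_pureHom, pureHom_comp, pureHom_comp, pureHom_comp,
      MonoidalCategory.pentagon]
  triangle A B := by
    refine hom_ext ?_
    change colift (pureHom U (α_ A.obj (𝟙_ D) B.obj).hom) ≫ whiskL A (pureHom U (λ_ B.obj).hom) =
      whiskR (pureHom U (ρ_ A.obj).hom) B.obj
    rw [whiskL_pureHom, whiskR_pureHom, pureHom_comp, MonoidalCategory.triangle]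

end SwapObj

end SwapCategory

/-! ## Cutting tuples and fusing blocks -/

section Blocks

variable {C : Type u₁}

/-- `Cut xs A R` witnesses that `xs` is the concatenation of `A` and `R`. -/
inductive Cut : List C → List C → List C → Type u₁
  | nil (R : List C) : Cut R [] R
  | cons (X : C) {xs A R : List C} (c : Cut xs A R) : Cut (X :: xs) (X :: A) R

variable [Category.{v₁} C] [MonoidalCategory C]

/-- `Fuse i xs B ys` witnesses that `ys` arises from `xs` by replacing the block `B` starting at
position `i` with the object `prodObj B`. -/
inductive Fuse : ℕ → List C → List C → List C → Type u₁
  | zero {xs B R : List C} (c : Cut xs B R) : Fuse 0 xs B (prodObj B :: R)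
  | succ (X : C) {i : ℕ} {xs B ys : List C} (q : Fuse i xs B ys) : Fuse (i + 1) (X :: xs) B (X :: ys)

variable {D : Type u₂} [Category.{v₂} D] [MonoidalCategory D] (G : C ⥤ D)

/-- The isomorphism `tens xs ≅ tens A ⊗ tens R` of a cut. -/
def cutIso : {xs A R : List C} → Cut xs A R → (tens G xs ≅ tens G A ⊗ tens G R)
  | _, _, _, .nil R => (λ_ (tens G R)).symm
  | _, _, _, .cons (A := A) (R := R) X c => whiskerLeftIso (G.obj X) (cutIso c) ≪≫
      (α_ (G.obj X) (tens G A) (tens G R)).symm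

omit [MonoidalCategory C] in
@[simp] lemma cutIso_nil (R : List C) : cutIso G (.nil R) = (λ_ (tens G R)).symm := rfl

omit [MonoidalCategory C] in
@[simp] lemma cutIso_cons (X : C) {xs A R : List C} (c : Cut xs A R) :
    cutIso G (.cons X c) = whiskerLeftIso (G.obj X) (cutIso G c) ≪≫
      (α_ (G.obj X) (tens G A) (tens G R)).symm := rfl

/-- An endomorphism of the block `B` of the tuple `xs`, extended to all of `tens xs`. -/
def ins : {i : ℕ} → {xs B ys : List C} → Fuse i xs B ys → (tens G B ⟶ tens G B) →
    (tens G xs ⟶ tens G xs)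
  | _, _, _, _, .zero (R := R) c, m => (cutIso G c).hom ≫ m ▷ tens G R ≫ (cutIso G c).inv
  | _, _, _, _, .succ X q, m => G.obj X ◁ ins q m

@[simp] lemma ins_zero {xs B R : List C} (c : Cut xs B R) (m : tens G B ⟶ tens G B) :
    ins G (.zero c) m = (cutIso G c).hom ≫ m ▷ tens G R ≫ (cutIso G c).inv := rfl

@[simp] lemma ins_succ (X : C) {i : ℕ} {xs B ys : List C} (q : Fuse i xs B ys)
    (m : tens G B ⟶ tens G B) : ins G (.succ X q) m = G.obj X ◁ ins G q m := rfl

lemma ins_comp {i : ℕ} {xs B ys : List C} (q : Fuse i xs B ys) (m m' : tens G B ⟶ tens G B) :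
    ins G q (m ≫ m') = ins G q m ≫ ins G q m' := by
  induction q with
  | zero c => simp
  | succ X q ih => simp [ih]

lemma ins_id {i : ℕ} {xs B ys : List C} (q : Fuse i xs B ys) : ins G q (𝟙 _) = 𝟙 _ := by
  induction q with
  | zero c => simp
  | succ X q ih => simp [ih]

variable [G.Monoidal]

/-- The isomorphism that fuses a block. -/
def fuseIso : {i : ℕ} → {xs B ys : List C} → Fuse i xs B ys → (tens G xs ≅ tens G ys)
  | _, _, _, _, .zero (B := B) (R := R) c =>
      cutIso G c ≪≫ whiskerRightIso (prodIso G B) (tens G R)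
  | _, _, _, _, .succ X q => whiskerLeftIso (G.obj X) (fuseIso q)

@[simp] lemma fuseIso_zero {xs B R : List C} (c : Cut xs B R) :
    fuseIso G (.zero c) = cutIso G c ≪≫ whiskerRightIso (prodIso G B) (tens G R) := rfl

@[simp] lemma fuseIso_succ (X : C) {i : ℕ} {xs B ys : List C} (q : Fuse i xs B ys) :
    fuseIso G (.succ X q) = whiskerLeftIso (G.obj X) (fuseIso G q) := rfl

@[simp] lemma prodIso_nil : prodIso G ([] : List C) = Functor.Monoidal.εIso G := rfl

@[simp] lemma prodIso_cons (X : C) (xs : List C) :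
    prodIso G (X :: xs) = whiskerLeftIso (G.obj X) (prodIso G xs) ≪≫
      Functor.Monoidal.μIso G X (prodObj xs) := rfl

variable {G}

omit [MonoidalCategory C] [G.Monoidal] in
-- Witnesses and existential tuples replace equations between lists, along which isomorphisms would
-- have to be transported.
lemma Cut.assoc {xs B R B' R' : List C} (c : Cut xs B R) (c' : Cut B B' R') :
    ∃ (S : List C) (d : Cut xs B' S) (e : Cut S R' R),
      (cutIso G c).hom ≫ (cutIso G c').hom ▷ tens G R ≫ (α_ _ _ _).hom =
        (cutIso G d).hom ≫ tens G B' ◁ (cutIso G e).hom := by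
  induction c' generalizing xs with
  | nil => exact ⟨xs, .nil xs, c, by simp⟩
  | cons X c' ih =>
    cases c with
    | cons _ c =>
      obtain ⟨S, d, e, h⟩ := ih c
      refine ⟨S, .cons X d, e, ?_⟩
      have := congrArg (G.obj X ◁ ·) h
      simp only [whiskerLeft_comp] at this
      simp only [cutIso_cons, Iso.trans_hom, whiskerLeftIso_hom, Iso.symm_hom, Category.assoc,
        comp_whiskerRight, tensor_whiskerLeft, Iso.inv_hom_id_assoc]
      rw [← reassoc_of% this]
      simp

/-- Prepares the base case of `Fuse.nest`: fusing inside a prefix leaves a cut with the same rest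
`R`. -/
lemma Fuse.nest_cut {j : ℕ} {xs B R B' ys : List C} (c : Cut xs B R) (q : Fuse j B B' ys) :
    ∃ (zs : List C) (p : Fuse j xs B' zs) (d : Cut zs ys R),
      (∀ m, ins G p m = (cutIso G c).hom ≫ ins G q m ▷ tens G R ≫ (cutIso G c).inv) ∧
      (fuseIso G p).hom ≫ (cutIso G d).hom = (cutIso G c).hom ≫ (fuseIso G q).hom ▷ tens G R := by
  induction q generalizing xs with
  | @zero B B' R' c' =>
    obtain ⟨S, d, e, h⟩ := c.assoc (G := G) c'
    refine ⟨_, .zero d, .cons _ e, fun m => ?_, ?_⟩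
    · have h' : (cutIso G d).hom = (cutIso G c).hom ≫ (cutIso G c').hom ▷ tens G R ≫
          (α_ _ _ _).hom ≫ tens G B' ◁ (cutIso G e).inv := by
        rw [reassoc_of% h]; simp
      have h'' : (cutIso G d).inv = tens G B' ◁ (cutIso G e).hom ≫ (α_ _ _ _).inv ≫
          (cutIso G c').inv ▷ tens G R ≫ (cutIso G c).inv := by
        rw [← cancel_epi (cutIso G d).hom, Iso.hom_inv_id, h']; simp
      rw [ins_zero, ins_zero, h', h'']
      simp only [Category.assoc, whisker_exchange_assoc]
      simp
    · simp only [fuseIso_zero, Iso.trans_hom, whiskerRightIso_hom, cutIso_cons, whiskerLeftIso_hom,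
        Iso.symm_hom, Category.assoc, comp_whiskerRight]
      rw [← whisker_exchange_assoc, ← reassoc_of% h]
      simp
  | succ X q ih =>
    cases c with
    | cons _ c =>
      obtain ⟨zs, p, d, h₁, h₂⟩ := ih c
      refine ⟨_, .succ X p, .cons X d, fun m => ?_, ?_⟩
      · simp [h₁]
      · have := congrArg (G.obj X ◁ ·) h₂
        simp only [whiskerLeft_comp] at this
        simp [reassoc_of% this]

lemma whiskerLeft_prod_comp (X : C) {P Q S : C} (a : P ⊗ Q ⟶ S) {T A R : D} (e : T ⟶ A ⊗ R)
    (p : A ⟶ G.obj P) (r : R ⟶ G.obj Q) :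
    (G.obj X ◁ e ≫ (α_ _ _ _).inv) ≫ ((G.obj X ◁ p ≫ Functor.LaxMonoidal.μ G X P) ⊗ₘ r) ≫
      Functor.LaxMonoidal.μ G (X ⊗ P) Q ≫ G.map ((α_ X P Q).hom ≫ X ◁ a) =
    G.obj X ◁ (e ≫ (p ⊗ₘ r) ≫ Functor.LaxMonoidal.μ G P Q ≫ G.map a) ≫
      Functor.LaxMonoidal.μ G X S := by
  simp only [MonoidalCategory.tensorHom_def, Functor.map_comp, comp_whiskerRight, Category.assoc,
    whiskerLeft_comp, Functor.LaxMonoidal.μ_natural_right]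
  have h := Functor.LaxMonoidal.associativity G X P Q
  rw [← whisker_exchange_assoc, reassoc_of% h, ← associator_inv_naturality_middle_assoc]
  simp

/-- The two tensor products in `C` differ only by associators and unitors, and the coherence axioms
of `G` turn these into the comparison of the iterated structure isomorphisms. -/
lemma Cut.exists_prodMap {xs A R : List C} (c : Cut xs A R) :
    ∃ a : prodObj A ⊗ prodObj R ⟶ prodObj xs,
      (cutIso G c).hom ≫ ((prodIso G A).hom ⊗ₘ (prodIso G R).hom) ≫
        Functor.LaxMonoidal.μ G _ _ ≫ G.map a = (prodIso G xs).hom := by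
  induction c with
  | nil R =>
    refine ⟨(λ_ (prodObj R)).hom, ?_⟩
    change (λ_ (tens G R)).inv ≫ (Functor.LaxMonoidal.ε G ⊗ₘ (prodIso G R).hom) ≫
      Functor.LaxMonoidal.μ G (𝟙_ C) (prodObj R) ≫ G.map (λ_ (prodObj R)).hom = _
    rw [MonoidalCategory.tensorHom_def', Category.assoc, ← Functor.LaxMonoidal.left_unitality]
    simp
  | @cons X xs A R c ih =>
    obtain ⟨a, h⟩ := ih
    refine ⟨(α_ X (prodObj A) (prodObj R)).hom ≫ X ◁ a, ?_⟩
    refine (whiskerLeft_prod_comp X a _ _ _).trans ?_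
    rw [h]
    rfl

/-- Fusing in two stages brackets the tensor product differently from fusing at once. The map `a`
measures the discrepancy, which naturality of cochains later absorbs. -/
lemma Fuse.exists_prodMap {j : ℕ} {xs B ys : List C} (q : Fuse j xs B ys) :
    ∃ a : prodObj ys ⟶ prodObj xs,
      (fuseIso G q).hom ≫ (prodIso G ys).hom ≫ G.map a = (prodIso G xs).hom := by
  induction q with
  | @zero xs B R c =>
    obtain ⟨a, h⟩ := c.exists_prodMap (G := G)
    refine ⟨a, ?_⟩
    rw [← h, MonoidalCategory.tensorHom_def]
    change ((cutIso G c).hom ≫ (prodIso G B).hom ▷ tens G R) ≫ (G.obj (prodObj B) ◁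
      (prodIso G R).hom ≫ Functor.LaxMonoidal.μ G (prodObj B) (prodObj R)) ≫ G.map a = _
    simp only [Category.assoc]
  | @succ X i xs B ys q ih =>
    obtain ⟨a, h⟩ := ih
    refine ⟨X ◁ a, ?_⟩
    change G.obj X ◁ (fuseIso G q).hom ≫ (G.obj X ◁ (prodIso G ys).hom ≫
      Functor.LaxMonoidal.μ G X (prodObj ys)) ≫ G.map (X ◁ a) =
        G.obj X ◁ (prodIso G xs).hom ≫ Functor.LaxMonoidal.μ G X (prodObj xs)
    rw [← h]
    simp

/-- The identity of a tuple. -/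
def TupleHom.refl : (xs : List C) → TupleHom xs xs
  | [] => .nil
  | X :: xs => .cons (𝟙 X) (TupleHom.refl xs)

omit [MonoidalCategory C] [G.Monoidal] in
@[simp] lemma tensMap_refl (xs : List C) : tensMap G (TupleHom.refl xs) = 𝟙 (tens G xs) := by
  induction xs with
  | nil => rfl
  | cons X xs ih => simp [TupleHom.refl, tensMap, ih]

/-- Fusing a block inside of a block. -/
lemma Fuse.nest {i j : ℕ} {xs B ys B' B₁ : List C} (q : Fuse i xs B ys) (q' : Fuse j B B' B₁) :
    ∃ (zs ws : List C) (p : Fuse (j + i) xs B' zs) (p' : Fuse i zs B₁ ws) (φ : TupleHom ws ys),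
      (∀ m, ins G p m = ins G q (ins G q' m)) ∧
      (∀ m, (fuseIso G p).hom ≫ ins G p' m ≫ (fuseIso G p).inv =
        ins G q ((fuseIso G q').hom ≫ m ≫ (fuseIso G q').inv)) ∧
      (fuseIso G p).hom ≫ (fuseIso G p').hom ≫ tensMap G φ = (fuseIso G q).hom := by
  induction q with
  | @zero xs B R c =>
    obtain ⟨zs, p, d, h₁, h₂⟩ := q'.nest_cut (G := G) c
    obtain ⟨a, ha⟩ := q'.exists_prodMap (G := G)
    have h₃ : (cutIso G d).inv ≫ (fuseIso G p).inv =
        (fuseIso G q').inv ▷ tens G R ≫ (cutIso G c).inv := by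
      rw [← Iso.trans_inv, ← whiskerRightIso_inv, ← Iso.trans_inv, Iso.inv_eq_inv]
      simp [h₂]
    -- The tuples `ws` and `ys` differ only in the fused object, `prodObj B₁` against `prodObj B`,
    -- and `a` relates the two.
    refine ⟨_, _, p, .zero d, .cons a (TupleHom.refl R), h₁, fun m => ?_, ?_⟩
    · simp only [ins_zero, Category.assoc, h₃, reassoc_of% h₂, comp_whiskerRight]
    · simp only [fuseIso_zero, Iso.trans_hom, Category.assoc, reassoc_of% h₂, tensMap, tensMap_refl,
        whiskerRightIso_hom, tensorHom_id, ← ha, comp_whiskerRight]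
  | succ X q ih =>
    obtain ⟨zs, ws, p, p', φ, h₁, h₂, h₃⟩ := ih q'
    refine ⟨_, _, .succ X p, .succ X p', .cons (𝟙 X) φ, fun m => ?_, fun m => ?_, ?_⟩
    · simp [h₁]
    · simp [← h₂]
    · simp [← h₃, tensMap]

/-- Base case of `Fuse.disjoint`: a block starting at `r + B.length` lies beyond the prefix `B`, so
it only concerns the second tensor factor. -/
lemma Cut.disjoint_fuse {r : ℕ} {xs B R B' ys : List C} (c : Cut xs B R)
    (q : Fuse (r + B.length) xs B' ys) :
    ∃ (R' : List C) (p : Fuse r R B' R') (d : Cut ys B R'),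
      (∀ m, ins G q m = (cutIso G c).hom ≫ tens G B ◁ ins G p m ≫ (cutIso G c).inv) ∧
      (fuseIso G q).hom ≫ (cutIso G d).hom = (cutIso G c).hom ≫ tens G B ◁ (fuseIso G p).hom := by
  induction c generalizing ys with
  | nil R => exact ⟨ys, q, .nil ys, by simp, by simp⟩
  | cons X c ih =>
    cases q with
    | succ _ q =>
      obtain ⟨R', p, d, h₁, h₂⟩ := ih q
      refine ⟨R', p, .cons X d, fun m => ?_, ?_⟩
      · simp [h₁]
      · have := congrArg (G.obj X ◁ ·) h₂
        simp only [whiskerLeft_comp] at this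
        simp [reassoc_of% this]

/-- Fusing two disjoint blocks. -/
lemma Fuse.disjoint {i r : ℕ} {xs B ys B' ys' : List C} (q : Fuse i xs B ys)
    (q' : Fuse (r + B.length + i) xs B' ys') :
    ∃ (zs : List C) (p : Fuse i ys' B zs) (p' : Fuse (r + 1 + i) ys B' zs),
      (∀ m m', ins G q m ≫ ins G q' m' = ins G q' m' ≫ ins G q m) ∧
      (∀ m, (fuseIso G q').hom ≫ ins G p m ≫ (fuseIso G q').inv = ins G q m) ∧
      (∀ m, (fuseIso G q).hom ≫ ins G p' m ≫ (fuseIso G q).inv = ins G q' m) ∧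
      (fuseIso G q').hom ≫ (fuseIso G p).hom = (fuseIso G q).hom ≫ (fuseIso G p').hom := by
  induction q generalizing ys' with
  | @zero xs B R c =>
    obtain ⟨R', p, d, h₁, h₂⟩ := c.disjoint_fuse (G := G) q'
    have h₃ : (cutIso G d).inv ≫ (fuseIso G q').inv =
        tens G B ◁ (fuseIso G p).inv ≫ (cutIso G c).inv := by
      rw [← Iso.trans_inv, ← whiskerLeftIso_inv, ← Iso.trans_inv, Iso.inv_eq_inv]
      simp [h₂]
    -- Once fused, `B` occupies a single input, so the offset of the other block drops from `r +
    -- B.length` to `r + 1`; this is the `.succ`.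
    refine ⟨_, .zero d, .succ _ p, fun m m' => ?_, fun m => ?_, fun m => ?_, ?_⟩
    · simp [h₁, whisker_exchange_assoc]
    · simp only [ins_zero, Category.assoc, h₃, reassoc_of% h₂]
      rw [whisker_exchange_assoc]
      simp
    · simp only [h₁, ins_succ, fuseIso_zero, Iso.trans_hom, Iso.trans_inv, whiskerRightIso_hom,
        whiskerRightIso_inv, Category.assoc]
      rw [← whisker_exchange_assoc]
      simp
    · simp [reassoc_of% h₂, whisker_exchange]
  | succ X q ih =>
    cases q' with
    | succ _ q' =>
      obtain ⟨zs, p, p', h₁, h₂, h₃, h₄⟩ := ih q'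
      refine ⟨_, .succ X p, .succ X p', fun m m' => ?_, fun m => ?_, fun m => ?_, ?_⟩
      · simp [← whiskerLeft_comp, h₁]
      · simp [← whiskerLeft_comp, h₂]
      · simp [← whiskerLeft_comp, h₃]
      · simp [← whiskerLeft_comp, h₄]

omit [MonoidalCategory C] [G.Monoidal] in
lemma Cut.exists_tupleHom {xs A R xs' A' R' : List C} (c : Cut xs A R) (c' : Cut xs' A' R')
    (h : A.length = A'.length) (φ : TupleHom xs xs') :
    ∃ (φA : TupleHom A A') (φR : TupleHom R R'),
      tensMap G φ ≫ (cutIso G c').hom = (cutIso G c).hom ≫ (tensMap G φA ⊗ₘ tensMap G φR) := by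
  induction c generalizing xs' A' with
  | nil R =>
    cases c' with
    | nil _ => exact ⟨.nil, φ, by simp [tensMap]⟩
    | cons X c' => simp at h
  | cons X c ih =>
    cases c' with
    | nil _ => simp at h
    | cons X' c' =>
      cases φ with
      | cons f φ =>
        obtain ⟨φA, φR, h'⟩ := ih c' (by simpa using h) φ
        refine ⟨.cons f φA, φR, ?_⟩
        simp only [cutIso_cons, Iso.trans_hom, whiskerLeftIso_hom, Iso.symm_hom, tensMap,
          Category.assoc]
        rw [← MonoidalCategory.associator_inv_naturality, ← id_tensorHom, ← id_tensorHom,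
          tensorHom_comp_tensorHom_assoc,
          tensorHom_comp_tensorHom_assoc, h', Category.comp_id, Category.id_comp]

lemma exists_prodObj_map {xs ys : List C} (φ : TupleHom xs ys) :
    ∃ a : prodObj xs ⟶ prodObj ys,
      tensMap G φ ≫ (prodIso G ys).hom = (prodIso G xs).hom ≫ G.map a := by
  induction φ with
  | nil => exact ⟨𝟙 (𝟙_ C), by
      change 𝟙 (𝟙_ D) ≫ Functor.LaxMonoidal.ε G = Functor.LaxMonoidal.ε G ≫ G.map (𝟙 (𝟙_ C))
      simp⟩
  | @cons X Y xs ys f φ ih =>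
    obtain ⟨a, h⟩ := ih
    refine ⟨f ⊗ₘ a, ?_⟩
    change (G.map f ⊗ₘ tensMap G φ) ≫ G.obj Y ◁ (prodIso G ys).hom ≫ Functor.LaxMonoidal.μ G _ _ =
      (G.obj X ◁ (prodIso G xs).hom ≫ Functor.LaxMonoidal.μ G _ _) ≫ G.map (f ⊗ₘ a)
    rw [← id_tensorHom, ← id_tensorHom, tensorHom_comp_tensorHom_assoc, h, Category.assoc,
      ← Functor.LaxMonoidal.μ_natural, tensorHom_comp_tensorHom_assoc, Category.comp_id,
      Category.id_comp]

/-- Naturality of the extension of endomorphisms from a block and of fusing. -/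
lemma Fuse.exists_tupleHom {i : ℕ} {xs B ys xs' B' ys' : List C} (q : Fuse i xs B ys)
    (q' : Fuse i xs' B' ys') (h : B.length = B'.length) (φ : TupleHom xs xs') :
    ∃ (φB : TupleHom B B') (φy : TupleHom ys ys'),
      (∀ m m', tensMap G φB ≫ m' = m ≫ tensMap G φB →
        tensMap G φ ≫ ins G q' m' = ins G q m ≫ tensMap G φ) ∧
      tensMap G φ ≫ (fuseIso G q').hom = (fuseIso G q).hom ≫ tensMap G φy := by
  induction q generalizing xs' ys' with
  | zero c =>
    cases q' with
    | zero c' =>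
      obtain ⟨φB, φR, h₁⟩ := c.exists_tupleHom (G := G) c' h φ
      obtain ⟨a, h₂⟩ := exists_prodObj_map (G := G) φB
      refine ⟨φB, .cons a φR, fun m m' hm => ?_, ?_⟩
      · have h₃ : tensMap G φ = (cutIso G c).hom ≫ (tensMap G φB ⊗ₘ tensMap G φR) ≫
            (cutIso G c').inv := by rw [← reassoc_of% h₁]; simp
        rw [h₃, ins_zero, ins_zero, ← tensorHom_id, ← tensorHom_id]
        simp only [Category.assoc, Iso.inv_hom_id_assoc, tensorHom_comp_tensorHom_assoc, hm,
          Category.comp_id, Category.id_comp]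
      · simp only [fuseIso_zero, Iso.trans_hom, whiskerRightIso_hom, reassoc_of% h₁, tensMap]
        rw [← tensorHom_id, ← tensorHom_id, tensorHom_comp_tensorHom, h₂, Category.assoc,
          tensorHom_comp_tensorHom, Category.comp_id, Category.id_comp]
  | succ X q ih =>
    cases q' with
    | succ X' q' =>
      cases φ with
      | cons f φ =>
        obtain ⟨φB, φy, h₁, h₂⟩ := ih q' h φ
        refine ⟨φB, .cons f φy, fun m m' hm => ?_, ?_⟩
        · simp only [ins_succ, tensMap]
          rw [← id_tensorHom, ← id_tensorHom, tensorHom_comp_tensorHom, tensorHom_comp_tensorHom,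
            h₁ m m' hm, Category.comp_id, Category.id_comp]
        · simp only [fuseIso_succ, whiskerLeftIso_hom, tensMap]
          rw [← id_tensorHom, ← id_tensorHom, tensorHom_comp_tensorHom, tensorHom_comp_tensorHom,
            h₂, Category.comp_id, Category.id_comp]

end Blocks

/-! ## The monoidal functor to equivariant co-Kleisli morphisms -/

section Lift

variable {C : Type u₁} [Category.{v₁} C] [MonoidalCategory C]
  {D : Type u₂} [Category.{v₂} D] [MonoidalCategory D] {F : C ⥤ D} [F.Monoidal]

open Functor.LaxMonoidal (μ)

/-- Compatibility with units is not part of a half-braiding. Monoidality at the pair of unit objects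
makes `b` idempotent once `F.obj (𝟙_ C)` is identified with the unit, and an invertible idempotent
is the identity. -/
lemma RelHalfBraiding.unit_conj {U : D} (ρ : RelHalfBraiding F U) :
    U ◁ Functor.LaxMonoidal.ε F ≫ (ρ.β (𝟙_ C)).hom ≫ Functor.OplaxMonoidal.η F ▷ U = (ρ_ U).hom ≫ (λ_ U).inv := by
  set b := (ρ.β (𝟙_ C)).hom with hb
  have h₁ : U ◁ (μ F (𝟙_ C) (𝟙_ C) ≫ F.map (λ_ (𝟙_ C)).hom) ≫ b =
      (α_ _ _ _).inv ≫ b ▷ F.obj (𝟙_ C) ≫ (α_ _ _ _).hom ≫ F.obj (𝟙_ C) ◁ b ≫ (α_ _ _ _).inv ≫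
        (μ F (𝟙_ C) (𝟙_ C) ≫ F.map (λ_ (𝟙_ C)).hom) ▷ U := by
    rw [whiskerLeft_comp, Category.assoc, hb, ρ.naturality, ← Category.assoc, ρ.monoidal]
    simp
  have h₂ : μ F (𝟙_ C) (𝟙_ C) ≫ F.map (λ_ (𝟙_ C)).hom =
      Functor.OplaxMonoidal.η F ▷ F.obj (𝟙_ C) ≫ (λ_ (F.obj (𝟙_ C))).hom := by
    rw [Functor.LaxMonoidal.left_unitality, ← comp_whiskerRight_assoc]
    simp
  rw [h₂] at h₁
  have h₃ : (U ◁ Functor.LaxMonoidal.ε F ≫ b ≫ Functor.OplaxMonoidal.η F ▷ U) ▷ F.obj (𝟙_ C) =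
      ((ρ_ U).hom ≫ (λ_ U).inv) ▷ F.obj (𝟙_ C) := by
    have h₄ := congrArg (fun t => U ◁ Functor.LaxMonoidal.ε F ▷ F.obj (𝟙_ C) ≫ t) h₁
    have h₅ : U ◁ Functor.LaxMonoidal.ε F ▷ F.obj (𝟙_ C) ≫ (α_ _ _ _).inv ≫ b ▷ F.obj (𝟙_ C) ≫ (α_ _ _ _).hom ≫
        F.obj (𝟙_ C) ◁ b ≫ (α_ _ _ _).inv ≫
          (Functor.OplaxMonoidal.η F ▷ F.obj (𝟙_ C) ≫ (λ_ (F.obj (𝟙_ C))).hom) ▷ U =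
        ((α_ U (𝟙_ D) (F.obj (𝟙_ C))).inv ≫ (U ◁ Functor.LaxMonoidal.ε F ≫ b ≫ Functor.OplaxMonoidal.η F ▷ U) ▷ F.obj (𝟙_ C) ≫
          (α_ (𝟙_ D) U (F.obj (𝟙_ C))).hom ≫ (λ_ _).hom) ≫ b := by
      calc
        _ = 𝟙 _ ⊗≫ U ◁ Functor.LaxMonoidal.ε F ▷ F.obj (𝟙_ C) ⊗≫ b ▷ F.obj (𝟙_ C) ⊗≫
            (F.obj (𝟙_ C) ◁ b ≫ Functor.OplaxMonoidal.η F ▷ (F.obj (𝟙_ C) ⊗ U)) ⊗≫ 𝟙 _ := by monoidal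
        _ = _ := by rw [whisker_exchange]; monoidal
    have h₆ : U ◁ Functor.LaxMonoidal.ε F ▷ F.obj (𝟙_ C) ≫
        U ◁ (Functor.OplaxMonoidal.η F ▷ F.obj (𝟙_ C) ≫ (λ_ (F.obj (𝟙_ C))).hom) ≫ b =
        ((α_ U (𝟙_ D) (F.obj (𝟙_ C))).inv ≫ ((ρ_ U).hom ≫ (λ_ U).inv) ▷ F.obj (𝟙_ C) ≫
          (α_ (𝟙_ D) U (F.obj (𝟙_ C))).hom ≫ (λ_ _).hom) ≫ b := by
      rw [whiskerLeft_comp, Category.assoc, ← whiskerLeft_comp_assoc, ← comp_whiskerRight]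
      simp
    rw [h₅, h₆] at h₄
    -- Cancelling one of the two occurrences of the invertible `b` leaves the claim whiskered by
    -- `F.obj (𝟙_ C)`. Whiskering by an object isomorphic to the unit reflects equality, which is
    -- the conjugation below.
    rw [hb, cancel_mono, cancel_epi] at h₄
    exact ((cancel_mono _).1 h₄).symm
  have h₇ := congrArg (fun t => (ρ_ _).inv ≫ _ ◁ Functor.LaxMonoidal.ε F ≫ t ≫ _ ◁ Functor.OplaxMonoidal.η F ≫ (ρ_ _).hom) h₃
  simp only [whisker_exchange_assoc] at h₇
  simpa [← whiskerLeft_comp_assoc] using h₇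

variable (U : CentralCoalgebra F)

namespace CentralCoalgebra

/-- `F.obj X` with the half-braiding of `U`. -/
@[simps]
def swapObj (X : C) : SwapObj U.obj where
  obj := F.obj X
  s := (U.ρ.β X).hom
  s_comul := by
    have h := U.comul_central X
    simp only [RelHalfBraiding.tensor, Iso.trans_hom, Iso.symm_hom, whiskerLeftIso_hom,
      whiskerRightIso_hom] at h
    rw [← h]; monoidal
  s_counit := by
    have h := U.counit_central X
    simp only [RelHalfBraiding.unit, Iso.trans_hom, Iso.symm_hom] at h
    rw [← h]; monoidal

/-- Whiskering of a co-Kleisli morphism by `F.obj X`. -/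
def whiskF (X : C) {B B' : D} (g : U.obj ⊗ B ⟶ B') : U.obj ⊗ (F.obj X ⊗ B) ⟶ F.obj X ⊗ B' :=
  (α_ U.obj (F.obj X) B).inv ≫ (U.ρ.β X).hom ▷ B ≫ (α_ (F.obj X) U.obj B).hom ≫ F.obj X ◁ g

lemma whiskF_pureHom (X : C) {B B' : D} (b : B ⟶ B') :
    U.whiskF X (pureHom U.obj b) = pureHom U.obj (F.obj X ◁ b) :=
  SwapObj.whiskL_pureHom (U.swapObj X) b

/-- The functor `C ⥤ SwapObj U.obj` lifting `F`. -/
@[simps]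
def lift : C ⥤ SwapObj U.obj where
  obj := U.swapObj
  map f := SwapObj.pure (F.map f) (U.ρ.naturality f)
  map_id X := SwapObj.hom_ext (congrArg (pureHom U.obj) (F.map_id X))
  map_comp f g := SwapObj.hom_ext ((congrArg (pureHom U.obj) (F.map_comp f g)).trans
    (SwapObj.pureHom_comp (F.map f) (F.map g)).symm)

/-- The monoidal structure of the lift of `F`. -/
def liftCore : U.lift.CoreMonoidal where
  εIso := SwapObj.pureIso (A := SwapObj.unitObj U.obj) (B := U.swapObj (𝟙_ C))
    (Functor.Monoidal.εIso F) (by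
      -- Equivariance of the unit isomorphism is `unit_conj`; that of `μIso` is monoidality of the
      -- half-braiding.
      have h := congrArg (· ≫ Functor.LaxMonoidal.ε F ▷ U.obj) U.ρ.unit_conj
      simp only [Category.assoc, ← comp_whiskerRight, Functor.Monoidal.η_ε] at h
      simp only [id_whiskerRight, Category.comp_id] at h
      exact h.trans (Category.assoc _ _ _).symm)
  μIso X Y := SwapObj.pureIso (A := SwapObj.tensObj (U.swapObj X) (U.swapObj Y))
    (B := U.swapObj (X ⊗ Y)) (Functor.Monoidal.μIso F X Y) (by
      refine (U.ρ.monoidal X Y).trans ?_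
      change _ = ((α_ U.obj (F.obj X) (F.obj Y)).inv ≫ (U.ρ.β X).hom ▷ F.obj Y ≫
        (α_ (F.obj X) U.obj (F.obj Y)).hom ≫ F.obj X ◁ (U.ρ.β Y).hom ≫
          (α_ (F.obj X) (F.obj Y) U.obj).inv) ≫ μ F X Y ▷ U.obj
      simp only [Category.assoc])
  μIso_hom_natural_left {X Y} f X' := by
    refine SwapObj.hom_ext ?_
    change colift (SwapObj.whiskR (pureHom U.obj (F.map f)) (F.obj X')) ≫ pureHom U.obj (μ F Y X') =
      colift (pureHom U.obj (μ F X X')) ≫ pureHom U.obj (F.map (f ▷ X'))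
    simp only [SwapObj.whiskR_pureHom, SwapObj.pureHom_comp, Functor.LaxMonoidal.μ_natural_left]
  μIso_hom_natural_right {X Y} X' f := by
    refine SwapObj.hom_ext ?_
    change colift (U.whiskF X' (pureHom U.obj (F.map f))) ≫
        pureHom U.obj (μ F X' Y) =
      colift (pureHom U.obj (μ F X' X)) ≫ pureHom U.obj (F.map (X' ◁ f))
    simp only [whiskF_pureHom, SwapObj.pureHom_comp,
      Functor.LaxMonoidal.μ_natural_right]
  associativity X Y Z := by
    refine SwapObj.hom_ext ?_
    change colift (SwapObj.whiskR (pureHom U.obj (μ F X Y)) (F.obj Z)) ≫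
        colift (pureHom U.obj (μ F (X ⊗ Y) Z)) ≫ pureHom U.obj (F.map (α_ X Y Z).hom) =
      colift (pureHom U.obj (α_ (F.obj X) (F.obj Y) (F.obj Z)).hom) ≫
        colift (U.whiskF X (pureHom U.obj (μ F Y Z))) ≫
          pureHom U.obj (μ F X (Y ⊗ Z))
    simp only [whiskF_pureHom, SwapObj.whiskR_pureHom, SwapObj.pureHom_comp,
      Functor.LaxMonoidal.associativity]
  left_unitality X := by
    refine SwapObj.hom_ext ?_
    change pureHom U.obj (λ_ (F.obj X)).hom =
      colift (SwapObj.whiskR (pureHom U.obj (Functor.LaxMonoidal.ε F)) (F.obj X)) ≫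
        colift (pureHom U.obj (μ F (𝟙_ C) X)) ≫ pureHom U.obj (F.map (λ_ X).hom)
    simp only [SwapObj.whiskR_pureHom, SwapObj.pureHom_comp, Functor.LaxMonoidal.left_unitality]
  right_unitality X := by
    refine SwapObj.hom_ext ?_
    change pureHom U.obj (ρ_ (F.obj X)).hom =
      colift (U.whiskF X (pureHom U.obj (Functor.LaxMonoidal.ε F))) ≫
        colift (pureHom U.obj (μ F X (𝟙_ C))) ≫ pureHom U.obj (F.map (ρ_ X).hom)
    simp only [whiskF_pureHom, SwapObj.pureHom_comp,
      Functor.LaxMonoidal.right_unitality]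

instance : U.lift.Monoidal := U.liftCore.toMonoidal

lemma lift_ε_hom : (Functor.LaxMonoidal.ε U.lift).hom = pureHom U.obj (Functor.LaxMonoidal.ε F) := rfl

lemma lift_μ_hom (X Y : C) : (μ U.lift X Y).hom = pureHom U.obj (μ F X Y) := rfl

end CentralCoalgebra

end Lift

/-! ## Comparison of the tensor powers of `F` and of its lift -/

section Comparison

variable {C : Type u₁} [Category.{v₁} C] [MonoidalCategory C]
  {D : Type u₂} [Category.{v₂} D] [MonoidalCategory D] {F : C ⥤ D} [F.Monoidal]

section Pure

variable {U : D} [ComonObj U] {A B X : SwapObj U}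

lemma pureHom_comp_right {A B X : D} (a : A ⟶ B) (b : B ⟶ X) :
    pureHom U a ≫ b = pureHom U (a ≫ b) := by simp [pureHom]

lemma whiskerLeft_comp_pureHom {A B X : D} (a : A ⟶ B) (b : B ⟶ X) :
    U ◁ a ≫ pureHom U b = pureHom U (a ≫ b) := by
  rw [← colift_pureHom, SwapObj.pureHom_comp]

lemma whiskR_conj {x x' b b' r r' : D} (ex : x' ≅ x) (eb : b' ≅ b) (er : r' ≅ r)
    (c : x ≅ b ⊗ r) (m : U ⊗ b' ⟶ b') :
    U ◁ ex.inv ≫ (colift (pureHom U (ex.hom ≫ c.hom ≫ eb.inv ▷ r ≫ b' ◁ er.inv)) ≫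
      colift (SwapObj.whiskR m r') ≫
        pureHom U (b' ◁ er.hom ≫ eb.hom ▷ r ≫ c.inv ≫ ex.inv)) ≫ ex.hom =
      U ◁ c.hom ≫ SwapObj.whiskR (U ◁ eb.inv ≫ m ≫ eb.hom) r ≫ c.inv := by
  rw [colift_pureHom, colift_comp_pureHom]
  unfold SwapObj.whiskR
  simp only [whiskerLeft_comp, Category.assoc, Iso.inv_hom_id, Category.comp_id,
    whiskerLeft_inv_hom_assoc, comp_whiskerRight, associator_inv_naturality_middle_assoc,
    associator_inv_naturality_right_assoc, whisker_exchange_assoc]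

/-- `f` is the morphism `a` with no dependence on `U`. -/
def SwapObj.IsPure (f : A ⟶ B) (a : A.obj ⟶ B.obj) : Prop := f.hom = pureHom U a

lemma SwapObj.IsPure.comp {f : A ⟶ B} {g : B ⟶ X} {a : A.obj ⟶ B.obj} {b : B.obj ⟶ X.obj}
    (hf : IsPure f a) (hg : IsPure g b) : IsPure (f ≫ g) (a ≫ b) := by
  unfold IsPure at *
  rw [comp_hom, hf, hg, pureHom_comp]

lemma SwapObj.IsPure.whiskerRight {f : A ⟶ B} {a : A.obj ⟶ B.obj} (hf : IsPure f a)
    (X : SwapObj U) : IsPure (f ▷ X) (a ▷ X.obj) := by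
  unfold IsPure at *
  rw [whiskerRight_hom, hf]
  exact whiskR_pureHom _ _

lemma SwapObj.IsPure.whiskerLeft {f : A ⟶ B} {a : A.obj ⟶ B.obj} (X : SwapObj U)
    (hf : IsPure f a) : IsPure (X ◁ f) (X.obj ◁ a) := by
  unfold IsPure at *
  rw [whiskerLeft_hom, hf]
  exact whiskL_pureHom _ _

lemma SwapObj.IsPure.inv {f : A ≅ B} {a : A.obj ≅ B.obj} (hf : IsPure f.hom a.hom) :
    IsPure f.inv a.inv := by
  unfold IsPure at *
  have h := congrArg Hom.hom f.hom_inv_id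
  rw [comp_hom, hf, colift_pureHom, id_hom] at h
  rw [← cancel_epi (U ◁ a.hom), h, ← colift_pureHom, pureHom_comp, Iso.hom_inv_id]

end Pure

namespace CentralCoalgebra

variable (U : CentralCoalgebra F)

/-- The comparison of underlying objects. -/
def liftTens : (xs : List C) → ((tens U.lift xs).obj ≅ tens F xs)
  | [] => Iso.refl (𝟙_ D)
  | X :: xs => whiskerLeftIso (F.obj X) (liftTens xs)

/-- Because of this, equivariance in `SwapObj` is the condition that defines `equivCochains`. -/
lemma liftTens_swap (xs : List C) :
    U.obj ◁ (U.liftTens xs).hom ≫ U.ρ.iter xs =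
      (tens U.lift xs).s ≫ (U.liftTens xs).hom ▷ U.obj := by
  induction xs with
  | nil =>
    change U.obj ◁ 𝟙 (𝟙_ D) ≫ ((ρ_ U.obj).hom ≫ (λ_ U.obj).inv) =
      ((ρ_ U.obj).hom ≫ (λ_ U.obj).inv) ≫ 𝟙 (𝟙_ D) ▷ U.obj
    simp
  | cons X xs ih =>
    change U.obj ◁ F.obj X ◁ (U.liftTens xs).hom ≫ (α_ U.obj (F.obj X) (tens F xs)).inv ≫
        (U.ρ.β X).hom ▷ tens F xs ≫ (α_ (F.obj X) U.obj (tens F xs)).hom ≫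
          F.obj X ◁ U.ρ.iter xs ≫ (α_ (F.obj X) (tens F xs) U.obj).inv =
      ((α_ U.obj (F.obj X) (tens U.lift xs).obj).inv ≫ (U.ρ.β X).hom ▷ (tens U.lift xs).obj ≫
        (α_ (F.obj X) U.obj (tens U.lift xs).obj).hom ≫ F.obj X ◁ (tens U.lift xs).s ≫
          (α_ (F.obj X) (tens U.lift xs).obj U.obj).inv) ≫
        (F.obj X ◁ (U.liftTens xs).hom) ▷ U.obj
    calc
      _ = 𝟙 _ ⊗≫ ((U.obj ⊗ F.obj X) ◁ (U.liftTens xs).hom ≫ (U.ρ.β X).hom ▷ tens F xs) ⊗≫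
          F.obj X ◁ U.ρ.iter xs ⊗≫ 𝟙 _ := by monoidal
      _ = 𝟙 _ ⊗≫ (U.ρ.β X).hom ▷ (tens U.lift xs).obj ⊗≫
          F.obj X ◁ (U.obj ◁ (U.liftTens xs).hom ≫ U.ρ.iter xs) ⊗≫ 𝟙 _ := by
        rw [whisker_exchange]; monoidal
      _ = _ := by rw [ih]; monoidal

/-- Compatibility with the iterated half-braidings. -/
def IsEquiv {xs ys : List C} (m : U.obj ⊗ tens F xs ⟶ tens F ys) : Prop :=
  SwapObj.IsEquivariant (U.ρ.iter xs) (U.ρ.iter ys) m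

variable {U}

/-- The underlying morphism of a morphism of tensor powers of the lift. -/
def ofLift {xs ys : List C} (m : tens U.lift xs ⟶ tens U.lift ys) :
    U.obj ⊗ tens F xs ⟶ tens F ys :=
  U.obj ◁ (U.liftTens xs).inv ≫ m.hom ≫ (U.liftTens ys).hom

lemma ofLift_injective {xs ys : List C} {m m' : tens U.lift xs ⟶ tens U.lift ys}
    (h : ofLift m = ofLift m') : m = m' := by
  unfold ofLift at h
  rw [cancel_epi, cancel_mono] at h
  exact SwapObj.hom_ext h

lemma liftTens_inv_swap (xs : List C) :
    U.obj ◁ (U.liftTens xs).inv ≫ (tens U.lift xs).s =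
      U.ρ.iter xs ≫ (U.liftTens xs).inv ▷ U.obj := by
  rw [← cancel_epi (U.obj ◁ (U.liftTens xs).hom), ← cancel_mono ((U.liftTens xs).hom ▷ U.obj)]
  simp only [Category.assoc, ← comp_whiskerRight, Iso.inv_hom_id, id_whiskerRight,
    Category.comp_id, liftTens_swap, whiskerLeft_hom_inv_assoc]

lemma isEquiv_ofLift {xs ys : List C} (m : tens U.lift xs ⟶ tens U.lift ys) :
    U.IsEquiv (ofLift m) := by
  have h₁ := SwapObj.isEquivariant_pureHom (U := U.obj) _ (liftTens_inv_swap (U := U) xs)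
  have h₂ := SwapObj.isEquivariant_pureHom (U := U.obj) _ (U.liftTens_swap ys)
  have h := (h₁.comp m.equivariant).comp h₂
  rw [colift_comp_pureHom, colift_pureHom, Category.assoc] at h
  exact h

/-- With `ofLift_injective`, this moves identities between equivariant maps into `SwapObj`, where
`U` no longer appears explicitly. -/
lemma exists_ofLift_eq {xs ys : List C} {m : U.obj ⊗ tens F xs ⟶ tens F ys} (hm : U.IsEquiv m) :
    ∃ m', ofLift m' = m := by
  have h₁ := SwapObj.isEquivariant_pureHom (U := U.obj) _ (U.liftTens_swap xs)
  have h₂ := SwapObj.isEquivariant_pureHom (U := U.obj) _ (liftTens_inv_swap (U := U) ys)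
  refine ⟨⟨_, (h₁.comp hm).comp h₂⟩, ?_⟩
  change U.obj ◁ (U.liftTens xs).inv ≫ (colift (colift (pureHom U.obj (U.liftTens xs).hom) ≫ m) ≫
    pureHom U.obj (U.liftTens ys).inv) ≫ (U.liftTens ys).hom = m
  rw [colift_comp_pureHom, colift_pureHom]
  simp

lemma ofLift_comp {xs ys zs : List C} (m : tens U.lift xs ⟶ tens U.lift ys)
    (m' : tens U.lift ys ⟶ tens U.lift zs) : ofLift (m ≫ m') = colift (ofLift m) ≫ ofLift m' := by
  unfold ofLift colift
  rw [SwapObj.comp_hom, colift]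
  simp only [whiskerLeft_comp, Category.assoc, whiskerLeft_hom_inv_assoc]
  rw [← associator_naturality_right_assoc, whisker_exchange_assoc]

lemma ofLift_of_isPure {xs ys : List C} {m : tens U.lift xs ⟶ tens U.lift ys}
    {a : tens F xs ⟶ tens F ys}
    (h : SwapObj.IsPure m ((U.liftTens xs).hom ≫ a ≫ (U.liftTens ys).inv)) :
    ofLift m = pureHom U.obj a := by
  unfold ofLift
  unfold SwapObj.IsPure at h
  rw [h, pureHom_comp_right, whiskerLeft_comp_pureHom]
  simp

lemma ofLift_id (xs : List C) : ofLift (𝟙 (tens U.lift xs)) = pureHom U.obj (𝟙 (tens F xs)) :=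
  ofLift_of_isPure (by simp [SwapObj.IsPure, SwapObj.id_hom])

lemma isPure_cutIso {xs A R : List C} (c : Cut xs A R) :
    SwapObj.IsPure (cutIso U.lift c).hom ((U.liftTens xs).hom ≫ (cutIso F c).hom ≫
      (U.liftTens A).inv ▷ tens F R ≫ (tens U.lift A).obj ◁ (U.liftTens R).inv) := by
  induction c with
  | nil R =>
    refine Eq.trans (SwapObj.leftUnitor_inv_hom _) (congrArg _ ?_)
    change _ = (U.liftTens R).hom ≫ (λ_ (tens F R)).inv ≫ 𝟙 (𝟙_ D) ▷ tens F R ≫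
      𝟙_ D ◁ (U.liftTens R).inv
    simp
  | @cons X xs A R c ih =>
    refine Eq.trans ((ih.whiskerLeft (U.swapObj X)).comp
      (SwapObj.associator_inv_hom _ _ _)) (congrArg _ ?_)
    change F.obj X ◁ ((U.liftTens xs).hom ≫ (cutIso F c).hom ≫
      (U.liftTens A).inv ▷ tens F R ≫ (tens U.lift A).obj ◁ (U.liftTens R).inv) ≫
        (α_ (F.obj X) (tens U.lift A).obj (tens U.lift R).obj).inv =
      F.obj X ◁ (U.liftTens xs).hom ≫ (F.obj X ◁ (cutIso F c).hom ≫ (α_ _ _ _).inv) ≫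
        (F.obj X ◁ (U.liftTens A).inv) ▷ tens F R ≫
          (F.obj X ⊗ (tens U.lift A).obj) ◁ (U.liftTens R).inv
    monoidal

lemma isPure_prodIso (xs : List C) :
    SwapObj.IsPure (prodIso U.lift xs).hom ((U.liftTens xs).hom ≫ (prodIso F xs).hom) := by
  induction xs with
  | nil =>
    refine Eq.trans U.lift_ε_hom (congrArg _ ?_)
    change _ = 𝟙 (𝟙_ D) ≫ Functor.LaxMonoidal.ε F
    simp
  | cons X xs ih =>
    refine Eq.trans ((ih.whiskerLeft (U.swapObj X)).comp (U.lift_μ_hom X (prodObj xs)))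
      (congrArg _ ?_)
    change F.obj X ◁ ((U.liftTens xs).hom ≫ (prodIso F xs).hom) ≫ Functor.LaxMonoidal.μ F _ _ =
      F.obj X ◁ (U.liftTens xs).hom ≫ F.obj X ◁ (prodIso F xs).hom ≫ Functor.LaxMonoidal.μ F _ _
    simp

lemma isPure_fuseIso {i : ℕ} {xs B ys : List C} (q : Fuse i xs B ys) :
    SwapObj.IsPure (fuseIso U.lift q).hom
      ((U.liftTens xs).hom ≫ (fuseIso F q).hom ≫ (U.liftTens ys).inv) := by
  induction q with
  | @zero xs B R c =>
    refine Eq.trans ((isPure_cutIso c).comp ((isPure_prodIso B).whiskerRight (tens U.lift R)))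
      (congrArg _ ?_)
    change ((U.liftTens xs).hom ≫ (cutIso F c).hom ≫
      (U.liftTens B).inv ▷ tens F R ≫ (tens U.lift B).obj ◁ (U.liftTens R).inv) ≫
        ((U.liftTens B).hom ≫ (prodIso F B).hom) ▷ (tens U.lift R).obj =
      (U.liftTens xs).hom ≫ ((cutIso F c).hom ≫ (prodIso F B).hom ▷ tens F R) ≫
        F.obj (prodObj B) ◁ (U.liftTens R).inv
    simp only [Category.assoc, comp_whiskerRight, whisker_exchange_assoc, whisker_exchange,
      inv_hom_whiskerRight_assoc]
  | @succ X i xs B ys q ih =>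
    refine Eq.trans (ih.whiskerLeft (U.swapObj X)) (congrArg _ ?_)
    change F.obj X ◁ ((U.liftTens xs).hom ≫ (fuseIso F q).hom ≫ (U.liftTens ys).inv) =
      F.obj X ◁ (U.liftTens xs).hom ≫ F.obj X ◁ (fuseIso F q).hom ≫ F.obj X ◁ (U.liftTens ys).inv
    simp

lemma ofLift_fuseIso_hom {i : ℕ} {xs B ys : List C} (q : Fuse i xs B ys) :
    ofLift (fuseIso U.lift q).hom = pureHom U.obj (fuseIso F q).hom :=
  ofLift_of_isPure (isPure_fuseIso q)

lemma ofLift_fuseIso_inv {i : ℕ} {xs B ys : List C} (q : Fuse i xs B ys) :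
    ofLift (fuseIso U.lift q).inv = pureHom U.obj (fuseIso F q).inv := by
  refine ofLift_of_isPure ?_
  have h : SwapObj.IsPure (fuseIso U.lift q).hom
      (U.liftTens xs ≪≫ fuseIso F q ≪≫ (U.liftTens ys).symm).hom := isPure_fuseIso q
  simpa using h.inv

lemma isPure_tensMap {xs ys : List C} (φ : TupleHom xs ys) :
    SwapObj.IsPure (tensMap U.lift φ)
      ((U.liftTens xs).hom ≫ tensMap F φ ≫ (U.liftTens ys).inv) := by
  induction φ with
  | nil =>
    refine Eq.trans (SwapObj.id_hom _) (congrArg _ ?_)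
    change 𝟙 (𝟙_ D) = 𝟙 (𝟙_ D) ≫ 𝟙 (𝟙_ D) ≫ 𝟙 (𝟙_ D)
    simp
  | @cons X Y xs ys f φ ih =>
    have hf : SwapObj.IsPure (U.lift.map f) (F.map f) := rfl
    refine Eq.trans ((hf.whiskerRight (tens U.lift xs)).comp (ih.whiskerLeft (U.swapObj Y)))
      (congrArg _ ?_)
    change F.map f ▷ (tens U.lift xs).obj ≫
        F.obj Y ◁ ((U.liftTens xs).hom ≫ tensMap F φ ≫ (U.liftTens ys).inv) =
      F.obj X ◁ (U.liftTens xs).hom ≫ (F.map f ⊗ₘ tensMap F φ) ≫ F.obj Y ◁ (U.liftTens ys).inv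
    rw [MonoidalCategory.tensorHom_def]
    simp only [Category.assoc, whiskerLeft_comp, whisker_exchange_assoc]

lemma ofLift_tensMap {xs ys : List C} (φ : TupleHom xs ys) :
    ofLift (tensMap U.lift φ) = pureHom U.obj (tensMap F φ) :=
  ofLift_of_isPure (isPure_tensMap φ)

variable (U) in
/-- A family member on the block `B` of `xs`, extended to all of `xs` with the half-braiding. -/
def insU : {i : ℕ} → {xs B ys : List C} → Fuse i xs B ys → (U.obj ⊗ tens F B ⟶ tens F B) →
    (U.obj ⊗ tens F xs ⟶ tens F xs)
  | _, _, _, _, .zero (R := R) c, m =>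
      U.obj ◁ (cutIso F c).hom ≫ SwapObj.whiskR m (tens F R) ≫ (cutIso F c).inv
  | _, _, _, _, .succ X q, m => U.whiskF X (insU q m)

/-- The half-braidings in `insU` are exactly those that left whiskering in `SwapObj` produces when
`U` passes the earlier inputs. -/
lemma ofLift_ins {i : ℕ} {xs B ys : List C} (q : Fuse i xs B ys)
    (m : tens U.lift B ⟶ tens U.lift B) : ofLift (ins U.lift q m) = U.insU q (ofLift m) := by
  induction q with
  | @zero xs B R c =>
    have h₁ : (cutIso U.lift c).hom.hom = _ := isPure_cutIso c
    have h₂ : (cutIso U.lift c).inv.hom = pureHom U.obj ((tens U.lift B).obj ◁ (U.liftTens R).hom ≫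
        (U.liftTens B).hom ▷ tens F R ≫ (cutIso F c).inv ≫ (U.liftTens xs).inv) := by
      have h : SwapObj.IsPure (cutIso U.lift c).hom
        (U.liftTens xs ≪≫ cutIso F c ≪≫ whiskerRightIso (U.liftTens B).symm (tens F R) ≪≫
          whiskerLeftIso (tens U.lift B).obj (U.liftTens R).symm).hom := isPure_cutIso c
      refine Eq.trans h.inv (congrArg _ ?_)
      simp
      rfl
    change U.obj ◁ (U.liftTens xs).inv ≫ (colift (cutIso U.lift c).hom.hom ≫
      colift (SwapObj.whiskR m.hom (tens U.lift R).obj) ≫ (cutIso U.lift c).inv.hom) ≫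
        (U.liftTens xs).hom = U.obj ◁ (cutIso F c).hom ≫
          SwapObj.whiskR (ofLift m) (tens F R) ≫ (cutIso F c).inv
    rw [h₁, h₂]
    exact whiskR_conj _ _ _ _ _
  | @succ X i xs B ys q ih =>
    change U.obj ◁ F.obj X ◁ (U.liftTens xs).inv ≫ U.whiskF X (ins U.lift q m).hom ≫
      F.obj X ◁ (U.liftTens xs).hom = U.whiskF X (U.insU q (ofLift m))
    rw [← ih]
    unfold ofLift whiskF
    calc
      _ = 𝟙 _ ⊗≫ ((U.obj ⊗ F.obj X) ◁ (U.liftTens xs).inv ≫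
          (U.ρ.β X).hom ▷ (tens U.lift xs).obj) ⊗≫
          F.obj X ◁ (ins U.lift q m).hom ⊗≫ F.obj X ◁ (U.liftTens xs).hom ⊗≫ 𝟙 _ := by monoidal
      _ = _ := by rw [whisker_exchange]; monoidal

end CentralCoalgebra

end Comparison

/-! ## Partial compositions through fusing data -/

section PartialComposition

variable {C : Type u₁}

lemma Cut.length_eq {xs A R : List C} (c : Cut xs A R) : xs.length = A.length + R.length := by
  induction c with
  | nil R => simp
  | cons X c ih => simp [ih]; omega

lemma Cut.unique {xs A R A' R' : List C} (c : Cut xs A R) (c' : Cut xs A' R')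
    (h : A.length = A'.length) :
    (⟨A, R, c⟩ : Σ A R, Cut xs A R) = ⟨A', R', c'⟩ := by
  induction c generalizing A' with
  | nil R =>
    cases c' with
    | nil _ => rfl
    | cons X c' => simp at h
  | cons X c ih =>
    cases c' with
    | nil _ => simp at h
    | cons X c' =>
      exact congrArg (fun t : Σ A R, Cut _ A R => (⟨X :: t.1, t.2.1, .cons X t.2.2⟩ :
        Σ A R, Cut _ A R)) (ih c' (by simpa using h))

variable [Category.{v₁} C] [MonoidalCategory C]

lemma Fuse.length_eq {i : ℕ} {xs B ys : List C} (q : Fuse i xs B ys) :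
    xs.length + 1 = ys.length + B.length := by
  induction q with
  | zero c => simp [c.length_eq]; omega
  | succ X q ih => simp; omega

lemma Fuse.add_length_le {i : ℕ} {xs B ys : List C} (q : Fuse i xs B ys) :
    i + B.length ≤ xs.length := by
  induction q with
  | zero c => simp [c.length_eq]
  | succ X q ih => simp; omega

/-- Equality in a sigma type avoids transports and lets `Fuse.at_eq` exchange any fusing datum for
the one read off from `take` and `drop`. -/
lemma Fuse.unique {i i' : ℕ} {xs B ys B' ys' : List C} (q : Fuse i xs B ys)
    (q' : Fuse i' xs B' ys') (hi : i = i') (h : B.length = B'.length) :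
    (⟨i, B, ys, q⟩ : Σ i B ys, Fuse i xs B ys) = ⟨i', B', ys', q'⟩ := by
  induction q generalizing i' ys' with
  | @zero xs B R c =>
    cases q' with
    | zero c' =>
      exact congrArg (fun t : Σ A R, Cut _ A R => (⟨0, t.1, _, .zero t.2.2⟩ :
        Σ i B ys, Fuse i xs B ys)) (c.unique c' h)
    | succ X q' => simp at hi
  | @succ X i xs B ys q ih =>
    cases q' with
    | zero c' => simp at hi
    | succ X q' =>
      exact congrArg (fun t : Σ i B ys, Fuse i xs B ys => (⟨t.1 + 1, t.2.1, _, .succ X t.2.2.2⟩ :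
        Σ i B ys, Fuse i (X :: xs) B ys)) (ih q' (by simpa using hi) h)

variable {D : Type u₂} [Category.{v₂} D] [MonoidalCategory D]

omit [MonoidalCategory C] in
lemma exists_cut_eq_splitIso (F : C ⥤ D) (i : ℕ) (xs : List C) :
    ∃ c : Cut xs (xs.take i) (xs.drop i), cutIso F c = splitIso F i xs := by
  induction xs generalizing i with
  | nil =>
    cases i with
    | zero => exact ⟨.nil [], rfl⟩
    | succ i => exact ⟨.nil [], rfl⟩
  | cons X xs ih =>
    cases i with
    | zero => exact ⟨.nil _, rfl⟩
    | succ i =>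
      obtain ⟨c, hc⟩ := ih i
      exact ⟨.cons X c, congrArg (fun e => whiskerLeftIso (F.obj X) e ≪≫ (α_ _ _ _).symm) hc⟩

/-- The fusing datum of a tuple cut into three blocks. -/
def Fuse.ofCuts : {xs A R B E : List C} → Cut xs A R → Cut R B E →
    Fuse A.length xs B (A ++ prodObj B :: E)
  | _, _, _, _, _, .nil _, c => .zero c
  | _, _, _, _, _, .cons X d, c => .succ X (ofCuts d c)

lemma exists_fuse (i n : ℕ) (xs : List C) (h : i + n ≤ xs.length) :
    ∃ (B ys : List C) (_ : Fuse i xs B ys), B.length = n := by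
  obtain ⟨d, -⟩ := exists_cut_eq_splitIso (𝟭 C) i xs
  obtain ⟨c, -⟩ := exists_cut_eq_splitIso (𝟭 C) n (xs.drop i)
  have h₁ : (xs.take i).length = i := by simp; omega
  exact ⟨_, _, h₁ ▸ Fuse.ofCuts d c, by simp; omega⟩

variable {F : C ⥤ D} [F.Monoidal]

/-- Together with `insU_ofCuts`, this matches the inductive description with the explicit `blocks`
and `fuse` of `diamondAt`. -/
lemma fuseIso_ofCuts {xs A R B E : List C} (d : Cut xs A R) (c : Cut R B E) :
    fuseIso F (.ofCuts d c) = (cutIso F d ≪≫ whiskerLeftIso (tens F A) (cutIso F c)) ≪≫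
      whiskerLeftIso (tens F A) (whiskerRightIso (prodIso F B) (tens F E)) ≪≫
        appendIso F A (prodObj B :: E) := by
  induction d with
  | nil R =>
    ext
    change (cutIso F c).hom ≫ (prodIso F B).hom ▷ tens F E =
      ((λ_ _).inv ≫ 𝟙_ D ◁ (cutIso F c).hom) ≫ 𝟙_ D ◁ (prodIso F B).hom ▷ tens F E ≫ (λ_ _).hom
    simp
  | @cons X xs A R d ih =>
    ext
    have h := congrArg (fun t => F.obj X ◁ t.hom) (ih c)
    refine Eq.trans h ?_
    change F.obj X ◁ (((cutIso F d).hom ≫ tens F A ◁ (cutIso F c).hom) ≫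
        tens F A ◁ (prodIso F B).hom ▷ tens F E ≫ (appendIso F A (prodObj B :: E)).hom) =
      ((F.obj X ◁ (cutIso F d).hom ≫ (α_ _ _ _).inv) ≫
        (F.obj X ⊗ tens F A) ◁ (cutIso F c).hom) ≫
          (F.obj X ⊗ tens F A) ◁ (prodIso F B).hom ▷ tens F E ≫
            (α_ _ _ _).hom ≫ F.obj X ◁ (appendIso F A (prodObj B :: E)).hom
    simp

namespace CentralCoalgebra

variable {U : CentralCoalgebra F}

lemma insU_ofCuts {xs A R B E : List C} (d : Cut xs A R) (c : Cut R B E)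
    (m : U.obj ⊗ tens F B ⟶ tens F B) :
    U.insU (.ofCuts d c) m =
      U.obj ◁ ((cutIso F d).hom ≫ tens F A ◁ (cutIso F c).hom) ≫
        ((α_ U.obj (tens F A) (tens F B ⊗ tens F E)).inv ≫
          U.ρ.iter A ▷ (tens F B ⊗ tens F E) ≫ (α_ (tens F A) U.obj (tens F B ⊗ tens F E)).hom ≫
            tens F A ◁ ((α_ U.obj (tens F B) (tens F E)).inv ≫ m ▷ tens F E)) ≫
        tens F A ◁ (cutIso F c).inv ≫ (cutIso F d).inv := by
  induction d with
  | nil R =>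
    change U.obj ◁ (cutIso F c).hom ≫ ((α_ _ _ _).inv ≫ m ▷ tens F E) ≫ (cutIso F c).inv =
      U.obj ◁ ((λ_ _).inv ≫ 𝟙_ D ◁ (cutIso F c).hom) ≫ ((α_ _ _ _).inv ≫
        ((ρ_ U.obj).hom ≫ (λ_ U.obj).inv) ▷ (tens F B ⊗ tens F E) ≫ (α_ _ _ _).hom ≫
          𝟙_ D ◁ ((α_ _ _ _).inv ≫ m ▷ tens F E)) ≫ 𝟙_ D ◁ (cutIso F c).inv ≫ (λ_ _).hom
    monoidal
  | @cons X xs A R d ih =>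
    change U.whiskF X (U.insU (.ofCuts d c) m) = U.obj ◁ ((F.obj X ◁ (cutIso F d).hom ≫
        (α_ _ _ _).inv) ≫ (F.obj X ⊗ tens F A) ◁ (cutIso F c).hom) ≫ ((α_ _ _ _).inv ≫
        ((α_ U.obj (F.obj X) (tens F A)).inv ≫ (U.ρ.β X).hom ▷ tens F A ≫
          (α_ (F.obj X) U.obj (tens F A)).hom ≫ F.obj X ◁ U.ρ.iter A ≫
            (α_ (F.obj X) (tens F A) U.obj).inv) ▷ (tens F B ⊗ tens F E) ≫ (α_ _ _ _).hom ≫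
          (F.obj X ⊗ tens F A) ◁ ((α_ _ _ _).inv ≫ m ▷ tens F E)) ≫
            (F.obj X ⊗ tens F A) ◁ (cutIso F c).inv ≫ (α_ _ _ _).hom ≫ F.obj X ◁ (cutIso F d).inv
    rw [ih, whiskF]
    calc
      _ = 𝟙 _ ⊗≫ (U.ρ.β X).hom ▷ tens F xs ⊗≫ F.obj X ◁ U.obj ◁ ((cutIso F d).hom ≫
          tens F A ◁ (cutIso F c).hom) ⊗≫
            F.obj X ◁ U.ρ.iter A ▷ (tens F B ⊗ tens F E) ⊗≫
              (F.obj X ⊗ tens F A) ◁ m ▷ tens F E ⊗≫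
                F.obj X ◁ (tens F A ◁ (cutIso F c).inv ≫ (cutIso F d).inv) ⊗≫ 𝟙 _ := by monoidal
      _ = 𝟙 _ ⊗≫ ((U.ρ.β X).hom ▷ tens F xs ≫ (F.obj X ⊗ U.obj) ◁ ((cutIso F d).hom ≫
          tens F A ◁ (cutIso F c).hom)) ⊗≫
            F.obj X ◁ U.ρ.iter A ▷ (tens F B ⊗ tens F E) ⊗≫
              (F.obj X ⊗ tens F A) ◁ m ▷ tens F E ⊗≫
                F.obj X ◁ (tens F A ◁ (cutIso F c).inv ≫ (cutIso F d).inv) ⊗≫ 𝟙 _ := by monoidal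
      _ = _ := by rw [← whisker_exchange]; monoidal

lemma colift_whiskerLeft_comp {A B X : D} (a : A ⟶ B) (f : U.obj ⊗ B ⟶ X) :
    colift (U.obj ◁ a ≫ f) = U.obj ◁ a ≫ colift f := by
  unfold colift
  rw [whiskerLeft_comp, whisker_exchange_assoc]
  simp

lemma colift_comp {A B X : D} (f : U.obj ⊗ A ⟶ B) (b : B ⟶ X) :
    colift (f ≫ b) = colift f ≫ U.obj ◁ b := by
  simp [colift]

variable (U) in
/-- The partial composition along a fusing datum. -/
def compU {i : ℕ} {xs B ys : List C} (q : Fuse i xs B ys) (f : U.obj ⊗ tens F ys ⟶ tens F ys)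
    (g : U.obj ⊗ tens F B ⟶ tens F B) : U.obj ⊗ tens F xs ⟶ tens F xs :=
  colift (U.insU q g) ≫ U.obj ◁ (fuseIso F q).hom ≫ f ≫ (fuseIso F q).inv

/-- Composition in `SwapObj` already contains the comultiplication, so there a partial composition
is an ordinary composite, and equivariance of `compU` comes for free. -/
lemma ofLift_compU {i : ℕ} {xs B ys : List C} (q : Fuse i xs B ys)
    (f : tens U.lift ys ⟶ tens U.lift ys) (g : tens U.lift B ⟶ tens U.lift B) :
    ofLift (ins U.lift q g ≫ (fuseIso U.lift q).hom ≫ f ≫ (fuseIso U.lift q).inv) =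
      U.compU q (ofLift f) (ofLift g) := by
  simp only [ofLift_comp, ofLift_fuseIso_hom, ofLift_fuseIso_inv, ofLift_ins, colift_pureHom,
    colift_comp_pureHom, compU]

lemma IsEquiv.compU {i : ℕ} {xs B ys : List C} (q : Fuse i xs B ys)
    {f : U.obj ⊗ tens F ys ⟶ tens F ys} {g : U.obj ⊗ tens F B ⟶ tens F B}
    (hf : U.IsEquiv f) (hg : U.IsEquiv g) : U.IsEquiv (U.compU q f g) := by
  obtain ⟨f, rfl⟩ := exists_ofLift_eq hf
  obtain ⟨g, rfl⟩ := exists_ofLift_eq hg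
  rw [← ofLift_compU]
  exact isEquiv_ofLift _

lemma ofLift_natural {xs ys : List C} {f : tens U.lift xs ⟶ tens U.lift xs}
    {g : tens U.lift ys ⟶ tens U.lift ys} {φ : TupleHom xs ys} :
    U.obj ◁ tensMap F φ ≫ ofLift g = ofLift f ≫ tensMap F φ ↔
      tensMap U.lift φ ≫ g = f ≫ tensMap U.lift φ := by
  have h₁ : U.obj ◁ tensMap F φ ≫ ofLift g = ofLift (tensMap U.lift φ ≫ g) := by
    rw [ofLift_comp, ofLift_tensMap, colift_pureHom]
  have h₂ : ofLift f ≫ tensMap F φ = ofLift (f ≫ tensMap U.lift φ) := by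
    rw [ofLift_comp, ofLift_tensMap, colift_comp_pureHom]
  rw [h₁, h₂]
  exact ⟨fun h => ofLift_injective h, fun h => by rw [h]⟩

/-- In use, `f'` and `f` are components of one cochain at `ws` and `ys`, which bracket the fused
object differently; the hypothesis on `φ` is its naturality. -/
lemma compU_nest {i j : ℕ} {xs B ys B' B₁ : List C} (q : Fuse i xs B ys) (q' : Fuse j B B' B₁) :
    ∃ (zs ws : List C) (p : Fuse (j + i) xs B' zs) (p' : Fuse i zs B₁ ws) (φ : TupleHom ws ys),
      ∀ {f f' g h}, U.IsEquiv f → U.IsEquiv f' → U.IsEquiv g → U.IsEquiv h →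
        U.obj ◁ tensMap F φ ≫ f = f' ≫ tensMap F φ →
          U.compU p (U.compU p' f' g) h = U.compU q f (U.compU q' g h) := by
  obtain ⟨zs, ws, p, p', φ, h₁, h₂, h₃⟩ := q.nest (G := U.lift) q'
  refine ⟨zs, ws, p, p', φ, fun {f f' g h} hf hf' hg hh e => ?_⟩
  obtain ⟨f, rfl⟩ := exists_ofLift_eq hf
  obtain ⟨f', rfl⟩ := exists_ofLift_eq hf'
  obtain ⟨g, rfl⟩ := exists_ofLift_eq hg
  obtain ⟨h, rfl⟩ := exists_ofLift_eq hh
  rw [ofLift_natural] at e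
  simp only [← ofLift_compU]
  congr 1
  rw [ins_comp, ← h₁, ← h₂]
  have h₄ : (fuseIso U.lift p).inv ≫ (fuseIso U.lift q).hom =
      (fuseIso U.lift p').hom ≫ tensMap U.lift φ := by rw [← h₃]; simp
  have h₅ : tensMap U.lift φ ≫ (fuseIso U.lift q).inv =
      (fuseIso U.lift p').inv ≫ (fuseIso U.lift p).inv := by
    rw [Iso.comp_inv_eq, Category.assoc, h₄]; simp
  simp only [Category.assoc, reassoc_of% h₄, reassoc_of% e, h₅]

/-- The two insertions commute by the interchange law of `SwapObj`, through `Fuse.disjoint`. -/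
lemma compU_disjoint {i r : ℕ} {xs B ys B' ys' : List C} (q : Fuse i xs B ys)
    (q' : Fuse (r + B.length + i) xs B' ys') :
    ∃ (zs : List C) (p : Fuse i ys' B zs) (p' : Fuse (r + 1 + i) ys B' zs),
      ∀ {f g h}, U.IsEquiv f → U.IsEquiv g → U.IsEquiv h →
        U.compU q' (U.compU p f g) h = U.compU q (U.compU p' f h) g := by
  obtain ⟨zs, p, p', h₁, h₂, h₃, h₄⟩ := q.disjoint (G := U.lift) q'
  refine ⟨zs, p, p', fun {f g h} hf hg hh => ?_⟩
  obtain ⟨f, rfl⟩ := exists_ofLift_eq hf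
  obtain ⟨g, rfl⟩ := exists_ofLift_eq hg
  obtain ⟨h, rfl⟩ := exists_ofLift_eq hh
  simp only [← ofLift_compU]
  congr 1
  have h₂' : (fuseIso U.lift q').hom ≫ ins U.lift p g = ins U.lift q g ≫ (fuseIso U.lift q').hom := by
    rw [← h₂]; simp
  have h₃' : (fuseIso U.lift q).hom ≫ ins U.lift p' h = ins U.lift q' h ≫ (fuseIso U.lift q).hom := by
    rw [← h₃]; simp
  have h₄' : (fuseIso U.lift p).inv ≫ (fuseIso U.lift q').inv =
      (fuseIso U.lift p').inv ≫ (fuseIso U.lift q).inv := by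
    rw [← Iso.trans_inv, ← Iso.trans_inv, Iso.inv_eq_inv]; exact h₄
  simp only [Category.assoc, reassoc_of% h₂', reassoc_of% h₃', h₄', reassoc_of% h₄]
  rw [← reassoc_of% (h₁ g h)]

lemma compU_natural {i : ℕ} {xs B ys xs' B' ys' : List C} (q : Fuse i xs B ys)
    (q' : Fuse i xs' B' ys') (h : B.length = B'.length) (φ : TupleHom xs xs') :
    ∃ (φB : TupleHom B B') (φy : TupleHom ys ys'), ∀ {f f' g g'}, U.IsEquiv f → U.IsEquiv f' →
      U.IsEquiv g → U.IsEquiv g' →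
        U.obj ◁ tensMap F φB ≫ g' = g ≫ tensMap F φB →
        U.obj ◁ tensMap F φy ≫ f' = f ≫ tensMap F φy →
          U.obj ◁ tensMap F φ ≫ U.compU q' f' g' = U.compU q f g ≫ tensMap F φ := by
  obtain ⟨φB, φy, h₁, h₂⟩ := q.exists_tupleHom (G := U.lift) q' h φ
  refine ⟨φB, φy, fun {f f' g g'} hf hf' hg hg' eg ef => ?_⟩
  obtain ⟨f, rfl⟩ := exists_ofLift_eq hf
  obtain ⟨f', rfl⟩ := exists_ofLift_eq hf'
  obtain ⟨g, rfl⟩ := exists_ofLift_eq hg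
  obtain ⟨g', rfl⟩ := exists_ofLift_eq hg'
  rw [ofLift_natural] at ef eg
  rw [← ofLift_compU, ← ofLift_compU, ofLift_natural, reassoc_of% (h₁ g g' eg),
    reassoc_of% h₂, reassoc_of% ef]
  have h₃ : tensMap U.lift φy ≫ (fuseIso U.lift q').inv =
      (fuseIso U.lift q).inv ≫ tensMap U.lift φ := by
    rw [Iso.comp_inv_eq, Category.assoc, h₂]; simp
  simp only [Category.assoc, h₃]

end CentralCoalgebra

end PartialComposition

/-! ## The partial compositions of cochains form an operad with multiplication -/

section CochainOperad

variable (k : Type w) [Field k] {C : Type u₁} [Category.{v₁} C] [MonoidalCategory C]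
  {D : Type u₂} [Category.{v₂} D] [MonoidalCategory D] [Preadditive D] [Linear k D]
  {F : C ⥤ D} [F.Monoidal] {U : CentralCoalgebra F}

lemma Family.at_of_length {n : ℤ} (f : Family U n) {xs : List C} (h : (xs.length : ℤ) = n) :
    f.at xs = f ⟨xs, h⟩ := dif_pos h

lemma Family.at_of_ne {n : ℤ} (f : Family U n) {xs : List C} (h : (xs.length : ℤ) ≠ n) :
    f.at xs = 0 := dif_neg h

lemma Family.ext_at {n : ℤ} {f g : Family U n}
    (h : ∀ xs : List C, (xs.length : ℤ) = n → f.at xs = g.at xs) : f = g := by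
  ext ⟨xs, hx⟩
  rw [← f.at_of_length hx, ← g.at_of_length hx, h xs hx]

@[simp] lemma Family.at_zero {n : ℤ} (xs : List C) : (0 : Family U n).at xs = 0 := by
  unfold Family.at; split <;> rfl

lemma Family.eq_zero_of_neg {n : ℤ} (h : n < 0) (f : Family U n) : f = 0 :=
  Family.ext_at fun xs hx => by omega

omit [MonoidalCategory C] in
lemma TupleHom.length_eq {xs ys : List C} (φ : TupleHom xs ys) : xs.length = ys.length := by
  induction φ with
  | nil => rfl
  | cons f φ ih => simp [ih]

section Bilinear

variable [MonoidalPreadditive D] {k} [MonoidalLinear k D] {m n : ℤ} (l : ℤ) (i : ℕ)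

omit [MonoidalPreadditive D] in
lemma diamondAt_add_left (f f' : Family U m) (g : Family U n) :
    diamondAt l i (f + f') g = diamondAt l i f g + diamondAt l i f' g := by
  ext xs
  simp only [diamondAt, Pi.add_apply]
  split_ifs <;> simp [Family.at_add]

lemma diamondAt_add_right (f : Family U m) (g g' : Family U n) :
    diamondAt l i f (g + g') = diamondAt l i f g + diamondAt l i f g' := by
  ext xs
  simp only [diamondAt, Pi.add_apply]
  split_ifs <;> simp [Family.at_add]

omit [MonoidalPreadditive D] [MonoidalLinear k D] in
lemma diamondAt_smul_left (r : k) (f : Family U m) (g : Family U n) :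
    diamondAt l i (r • f) g = r • diamondAt l i f g := by
  ext xs
  simp only [diamondAt, Pi.smul_apply]
  split_ifs <;> simp [Family.at_smul]

lemma diamondAt_smul_right (r : k) (f : Family U m) (g : Family U n) :
    diamondAt l i f (r • g) = r • diamondAt l i f g := by
  ext xs
  simp only [diamondAt, Pi.smul_apply]
  split_ifs <;> simp [Family.at_smul]

lemma cup_zero_left (g : Family U n) : cup l (0 : Family U m) g = 0 := by
  ext xs
  simp [cup, MonoidalCategory.tensorHom_def]

lemma cup_zero_right (f : Family U m) : cup l f (0 : Family U n) = 0 := by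
  ext xs
  simp [cup, MonoidalCategory.tensorHom_def]

omit [MonoidalPreadditive D] in
lemma diamondAt_zero_left (g : Family U n) : diamondAt l i (0 : Family U m) g = 0 := by
  ext xs
  simp [diamondAt]

lemma diamondAt_zero_right (f : Family U m) : diamondAt l i f (0 : Family U n) = 0 := by
  ext xs
  simp [diamondAt]

omit [MonoidalPreadditive D] in
lemma diamondAt_of_le (f : Family U m) (g : Family U n) (h : m ≤ i) : diamondAt l i f g = 0 := by
  ext xs
  simp [diamondAt, h.not_gt]

end Bilinear

namespace CentralCoalgebra

lemma isEquiv_zero [MonoidalPreadditive D] (xs ys : List C) :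
    U.IsEquiv (0 : U.obj ⊗ tens F xs ⟶ tens F ys) := by
  simp [IsEquiv, SwapObj.IsEquivariant, colift]

end CentralCoalgebra

/-! ### Equivariant cochains in terms of their components. -/

section Membership

variable {k} [MonoidalPreadditive D] [MonoidalLinear k D]

lemma mem_equivCochains_iff {n : ℤ} {f : Family U n} :
    f ∈ equivCochains k U n ↔
      (∀ (xs ys : List C) (φ : TupleHom xs ys), (xs.length : ℤ) = n →
        U.obj ◁ tensMap F φ ≫ f.at ys = f.at xs ≫ tensMap F φ) ∧
      ∀ xs : List C, U.IsEquiv (f.at xs) := by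
  have key : ∀ xs : List C, ∀ h : (xs.length : ℤ) = n, (U.IsEquiv (f.at xs) ↔
      lamR U xs ≫ f ⟨xs, h⟩ ▷ U.obj = lamL U xs ≫ U.obj ◁ f ⟨xs, h⟩ ≫ U.ρ.iter xs) := by
    intro xs h
    rw [f.at_of_length h, CentralCoalgebra.IsEquiv, SwapObj.IsEquivariant, lamR, lamL, colift]
    simp only [Category.assoc]
  constructor
  · rintro ⟨h₁, h₂⟩
    refine ⟨fun xs ys φ hx => ?_, fun xs => ?_⟩
    · have hy : (ys.length : ℤ) = n := by rw [← φ.length_eq]; exact hx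
      rw [f.at_of_length hx, f.at_of_length hy]
      exact h₁ xs ys hx hy φ
    · by_cases hx : (xs.length : ℤ) = n
      · exact (key xs hx).2 (h₂ xs hx)
      · rw [f.at_of_ne hx]
        exact CentralCoalgebra.isEquiv_zero xs xs
  · rintro ⟨h₁, h₂⟩
    refine ⟨fun xs ys hx hy φ => ?_, fun xs hx => (key xs hx).1 (h₂ xs)⟩
    rw [← f.at_of_length hx, ← f.at_of_length hy]
    exact h₁ xs ys φ hx

lemma isEquiv_at {n : ℤ} {f : Family U n} (hf : f ∈ equivCochains k U n) (xs : List C) :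
    U.IsEquiv (f.at xs) := (mem_equivCochains_iff.1 hf).2 xs

lemma at_natural {n : ℤ} {f : Family U n} (hf : f ∈ equivCochains k U n) {xs ys : List C}
    (φ : TupleHom xs ys) : U.obj ◁ tensMap F φ ≫ f.at ys = f.at xs ≫ tensMap F φ := by
  by_cases hx : (xs.length : ℤ) = n
  · exact (mem_equivCochains_iff.1 hf).1 xs ys φ hx
  · rw [f.at_of_ne hx, f.at_of_ne (by rw [← φ.length_eq]; exact hx)]
    simp

end Membership

lemma Fuse.at_eq {m n : ℤ} (f : Family U m) (g : Family U n) {i i' : ℕ} {xs B ys B' ys' : List C}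
    (q : Fuse i xs B ys) (q' : Fuse i' xs B' ys') (hi : i = i') (h : B.length = B'.length) :
    U.compU q (f.at ys) (g.at B) = U.compU q' (f.at ys') (g.at B') :=
  congrArg (fun t : Σ i B ys, Fuse i xs B ys => U.compU t.2.2.2 (f.at t.2.2.1) (g.at t.2.1))
    (q.unique q' hi h)

/-- The datum `q` is arbitrary, not only the one from `take` and `drop`; this freedom allows
different orders of insertion to be compared. -/
lemma diamondAt_at {m n l : ℤ} (f : Family U m) (g : Family U n) {i : ℕ} {xs B ys : List C}
    (hi : (i : ℤ) < m) (hB : (B.length : ℤ) = n) (hx : (xs.length : ℤ) = l) (q : Fuse i xs B ys) :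
    (diamondAt l i f g).at xs = U.compU q (f.at ys) (g.at B) := by
  obtain ⟨d, hd⟩ := exists_cut_eq_splitIso F i xs
  obtain ⟨c, hc⟩ := exists_cut_eq_splitIso F n.toNat (xs.drop i)
  have hq := q.add_length_le
  rw [Fuse.at_eq f g q (.ofCuts d c) (by simp; omega) (by simp; omega), Family.at_of_length _ hx,
    CentralCoalgebra.compU, CentralCoalgebra.insU_ofCuts, fuseIso_ofCuts,
    CentralCoalgebra.colift_whiskerLeft_comp, CentralCoalgebra.colift_comp]
  simp only [diamondAt, if_pos hi, ← hd, ← hc, colift, Iso.trans_hom, Iso.trans_inv,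
    whiskerLeftIso_hom, whiskerLeftIso_inv, whiskerRightIso_hom, whiskerRightIso_inv,
    whiskerLeft_comp, Category.assoc, whiskerLeft_inv_hom_assoc]
  rw [← whiskerLeft_comp_assoc U.obj (tens F _ ◁ (cutIso F c).inv), whiskerLeft_inv_hom,
    MonoidalCategory.whiskerLeft_id, Category.id_comp]

/-! ### Closure and associativity of the partial compositions of cochains. -/

section Operad

variable {k} [MonoidalPreadditive D] [MonoidalLinear k D] {m n p l l' d : ℤ}
  {f : Family U m} {g : Family U n} {h : Family U p}

lemma diamondAt_mem (hf : f ∈ equivCochains k U m) (hg : g ∈ equivCochains k U n)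
    (hl : m + n = l + 1) (i : ℕ) : diamondAt l i f g ∈ equivCochains k U l := by
  by_cases hi : m ≤ i
  · rw [diamondAt_of_le l i f g hi]; exact zero_mem _
  -- Degrees are integers and lengths are naturals. In negative degree every cochain is zero, and
  -- this case is split off before `toNat` is used.
  by_cases hn : n < 0
  · rw [g.eq_zero_of_neg hn, diamondAt_zero_right]; exact zero_mem _
  rw [mem_equivCochains_iff]
  refine ⟨fun xs ys φ hx => ?_, fun xs => ?_⟩
  · have hxy := φ.length_eq
    obtain ⟨B, zs, q, hB⟩ := exists_fuse i n.toNat xs (by omega)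
    obtain ⟨B', zs', q', hB'⟩ := exists_fuse i n.toNat ys (by omega)
    obtain ⟨φB, φy, H⟩ := CentralCoalgebra.compU_natural (U := U) q q' (hB.trans hB'.symm) φ
    rw [diamondAt_at f g (by omega) (by omega) hx q,
      diamondAt_at f g (by omega) (by omega) (by omega) q']
    exact H (isEquiv_at hf _) (isEquiv_at hf _) (isEquiv_at hg _) (isEquiv_at hg _)
      (at_natural hg _) (at_natural hf _)
  · by_cases hx : (xs.length : ℤ) = l
    · obtain ⟨B, zs, q, hB⟩ := exists_fuse i n.toNat xs (by omega)
      rw [diamondAt_at f g (by omega) (by omega) hx q]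
      exact (isEquiv_at hf _).compU q (isEquiv_at hg _)
    · rw [Family.at_of_ne _ hx]
      exact CentralCoalgebra.isEquiv_zero _ _

/-- The bound on `j` matters: for `j ≥ n` the right side vanishes, while on the left `h` may enter
an input of `f` to the right of `g`. -/
lemma diamondAt_nest (hf : f ∈ equivCochains k U m) (hg : g ∈ equivCochains k U n)
    (hh : h ∈ equivCochains k U p) (h₁ : m + n = l + 1) (h₂ : n + p = l' + 1)
    (h₃ : l + p = d + 1) (i j : ℕ) (hj : (j : ℤ) < n) :
    diamondAt d (j + i) (diamondAt l i f g) h = diamondAt d i f (diamondAt l' j g h) := by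
  by_cases hi : m ≤ i
  · rw [diamondAt_of_le l i f g hi, diamondAt_of_le d i f _ hi, diamondAt_zero_left]
  by_cases hp : p < 0
  · simp only [h.eq_zero_of_neg hp, diamondAt_zero_right]
  refine Family.ext_at fun xs hx => ?_
  -- The outer block carries all arguments of the inner composite, whose degree is `l' = n + p - 1`.
  obtain ⟨B, ys, q, hB⟩ := exists_fuse i (n + p - 1).toNat xs (by omega)
  obtain ⟨B', B₁, q', hB'⟩ := exists_fuse j p.toNat B (by omega)
  obtain ⟨zs, ws, r, r', φ, H⟩ := CentralCoalgebra.compU_nest (U := U) q q'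
  have e₁ := q.length_eq
  have e₂ := q'.length_eq
  have e₃ := r.length_eq
  have e₄ := r'.length_eq
  rw [diamondAt_at _ h (by push_cast; omega) (by omega) hx r,
    diamondAt_at f g (by omega) (by omega) (by omega) r',
    diamondAt_at f _ (by omega) (by omega) hx q,
    diamondAt_at g h (by omega) (by omega) (by omega) q']
  exact H (isEquiv_at hf _) (isEquiv_at hf _) (isEquiv_at hg _) (isEquiv_at hh _)
    (at_natural hf _)

lemma diamondAt_disjoint (hf : f ∈ equivCochains k U m) (hg : g ∈ equivCochains k U n)
    (hh : h ∈ equivCochains k U p) (h₁ : m + n = l + 1) (h₂ : m + p = l' + 1)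
    (h₃ : l + p = d + 1) (i r n' : ℕ) (hn : (n' : ℤ) = n) :
    diamondAt d (r + n' + i) (diamondAt l i f g) h =
      diamondAt d i (diamondAt l' (r + 1 + i) f h) g := by
  by_cases hi : m ≤ (r + 1 + i : ℕ)
  -- Beyond the last input of `f` both sides vanish: `r + 1 + i ≥ m` gives `r + n' + i ≥ l`.
  · rw [diamondAt_of_le l' _ f h hi, diamondAt_of_le d _ _ h (by push_cast at *; omega),
      diamondAt_zero_left]
  by_cases hp : p < 0
  · simp only [h.eq_zero_of_neg hp, diamondAt_zero_right, diamondAt_zero_left]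
  push_cast at hi
  refine Family.ext_at fun xs hx => ?_
  obtain ⟨B, ys, q, hB⟩ := exists_fuse i n' xs (by omega)
  obtain ⟨B', ys', q', hB'⟩ := exists_fuse (r + B.length + i) p.toNat xs (by omega)
  obtain ⟨zs, s, s', H⟩ := CentralCoalgebra.compU_disjoint (U := U) q q'
  have e₁ := q.length_eq
  have e₂ := q'.length_eq
  have e₃ := s.length_eq
  have e₄ := s'.length_eq
  rw [← hB, diamondAt_at _ h (by push_cast; omega) (by omega) hx q',
    diamondAt_at f g (by omega) (by omega) (by omega) s,
    diamondAt_at _ g (by omega) (by omega) hx q,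
    diamondAt_at f h (by push_cast; omega) (by omega) (by omega) s']
  exact H (isEquiv_at hf _) (isEquiv_at hg _) (isEquiv_at hh _)

end Operad

end CochainOperad

/-! ## Differential and cup product through partial compositions -/

section Multiplication

variable {k : Type w} [Field k] {C : Type u₁} [Category.{v₁} C] [MonoidalCategory C]
  {D : Type u₂} [Category.{v₂} D] [MonoidalCategory D]
  {F : C ⥤ D} [F.Monoidal] {U : CentralCoalgebra F}

namespace CentralCoalgebra

lemma insU_pureHom_id {i : ℕ} {xs B ys : List C} (q : Fuse i xs B ys) :
    U.insU q (pureHom U.obj (𝟙 _)) = pureHom U.obj (𝟙 _) := by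
  rw [← ofLift_id, ← ofLift_ins, ins_id, ofLift_id]

lemma compU_pureHom_id_left {i : ℕ} {xs B ys : List C} (q : Fuse i xs B ys)
    (g : U.obj ⊗ tens F B ⟶ tens F B) : U.compU q (pureHom U.obj (𝟙 _)) g = U.insU q g := by
  rw [compU, pureHom_comp_right, whiskerLeft_comp_pureHom, colift_comp_pureHom]
  simp

lemma compU_pureHom_id_right {i : ℕ} {xs B ys : List C} (q : Fuse i xs B ys)
    (f : U.obj ⊗ tens F ys ⟶ tens F ys) :
    U.compU q f (pureHom U.obj (𝟙 _)) =
      U.obj ◁ (fuseIso F q).hom ≫ f ≫ (fuseIso F q).inv := by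
  rw [compU, insU_pureHom_id, colift_pureHom, MonoidalCategory.whiskerLeft_id, Category.id_comp]

end CentralCoalgebra

/-- Used for the cup product, where the block of `g` lies directly to the right of that of `f`. -/
lemma CentralCoalgebra.insU_disjoint {i r : ℕ} {xs B ys B' ys' : List C} (q : Fuse i xs B ys)
    (q' : Fuse (r + B.length + i) xs B' ys') :
    ∃ (zs : List C) (p : Fuse i ys' B zs), ∀ {g}, U.IsEquiv g →
      U.obj ◁ (fuseIso F q').hom ≫ U.insU p g ≫ (fuseIso F q').inv = U.insU q g := by
  obtain ⟨zs, p, p', h₁, h₂, h₃, h₄⟩ := q.disjoint (G := U.lift) q'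
  refine ⟨zs, p, fun {g} hg => ?_⟩
  obtain ⟨g, rfl⟩ := exists_ofLift_eq hg
  rw [← ofLift_ins, ← ofLift_ins, ← h₂, ofLift_comp, ofLift_comp, ofLift_fuseIso_hom,
    ofLift_fuseIso_inv, colift_pureHom, colift_comp_pureHom]

omit [MonoidalCategory C] in
lemma exists_cut_full (F : C ⥤ D) (xs : List C) :
    ∃ c : Cut xs xs [], cutIso F c = (ρ_ (tens F xs)).symm := by
  induction xs with
  | nil => exact ⟨.nil [], by ext; exact unitors_inv_equal⟩
  | cons X xs ih =>
    obtain ⟨c, hc⟩ := ih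
    refine ⟨.cons X c, ?_⟩
    rw [cutIso_cons, hc]
    ext
    change F.obj X ◁ (ρ_ (tens F xs)).inv ≫ (α_ _ _ _).inv = (ρ_ (F.obj X ⊗ tens F xs)).inv
    simp

lemma CentralCoalgebra.exists_fuse_full (xs : List C) :
    ∃ q : Fuse 0 xs xs [prodObj xs], ∀ m, U.insU q m = m := by
  obtain ⟨c, hc⟩ := exists_cut_full F xs
  refine ⟨.zero c, fun m => ?_⟩
  change U.obj ◁ (cutIso F c).hom ≫ ((α_ _ _ _).inv ≫ m ▷ 𝟙_ D) ≫ (cutIso F c).inv = m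
  rw [hc]
  change U.obj ◁ (ρ_ (tens F xs)).inv ≫ ((α_ _ _ _).inv ≫ m ▷ 𝟙_ D) ≫ (ρ_ (tens F xs)).hom = m
  monoidal

/-- Contracting yields `X ⊗ Y`, fusing `[X, Y]` yields `X ⊗ (Y ⊗ 𝟙_ C)`; `φ` is an inverse right
unitor in this slot. Naturality along `φ` identifies `dMiddle` with an insertion of the identity
cochain. -/
lemma exists_contract_tupleHom {j : ℕ} {xs B ys : List C} (q : Fuse j xs B ys)
    (hB : B.length = 2) :
    ∃ φ : TupleHom (contract j xs) ys,
      (contractIso F j xs).hom ≫ tensMap F φ = (fuseIso F q).hom := by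
  induction q with
  | @zero xs B R c =>
    cases c with
    | nil _ => simp at hB
    | cons X c =>
      cases c with
      | nil _ => simp at hB
      | cons Y c =>
        cases c with
        | cons _ _ => simp at hB
        | nil R =>
          refine ⟨.cons (X ◁ (ρ_ Y).inv) (TupleHom.refl R), ?_⟩
          simp only [tensMap, tensMap_refl, tensorHom_id]
          change ((α_ (F.obj X) (F.obj Y) (tens F R)).inv ≫
            Functor.LaxMonoidal.μ F X Y ▷ tens F R) ≫ F.map (X ◁ (ρ_ Y).inv) ▷ tens F R =
              (F.obj X ◁ (F.obj Y ◁ (λ_ (tens F R)).inv ≫ (α_ _ _ _).inv) ≫ (α_ _ _ _).inv) ≫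
                (F.obj X ◁ (F.obj Y ◁ Functor.LaxMonoidal.ε F ≫ Functor.LaxMonoidal.μ F Y (𝟙_ C)) ≫
                  Functor.LaxMonoidal.μ F X (Y ⊗ 𝟙_ C)) ▷ tens F R
          have h : F.map (ρ_ Y).inv = (ρ_ (F.obj Y)).inv ≫ F.obj Y ◁ Functor.LaxMonoidal.ε F ≫
              Functor.LaxMonoidal.μ F Y (𝟙_ C) := by
            rw [Functor.LaxMonoidal.right_unitality_inv]
          rw [Category.assoc, ← comp_whiskerRight, ← Functor.LaxMonoidal.μ_natural_right, h]
          monoidal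
  | @succ X i xs B ys q ih =>
    obtain ⟨φ, h⟩ := ih hB
    refine ⟨.cons (𝟙 X) φ, ?_⟩
    have h' := congrArg (F.obj X ◁ ·) h
    simp only [whiskerLeft_comp] at h'
    change F.obj X ◁ (contractIso F i xs).hom ≫ (F.map (𝟙 X) ⊗ₘ tensMap F φ) =
      F.obj X ◁ (fuseIso F q).hom
    rw [F.map_id, id_tensorHom]
    exact h'

variable (U) in
/-- The cochain of degree `n` given by the identities; of degree `2` it is the multiplication of
the operad of cochains, of degree `1` its unit, and of degree `0` the unit of the cup product. -/
def idCochain (n : ℤ) : Family U n := fun xs => pureHom U.obj (𝟙 (tens F xs.1))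

variable [Preadditive D]

lemma unitCochain_eq : unitCochain U = idCochain U 0 := by
  ext ⟨xs, hx⟩
  match xs, hx with
  | [], _ =>
    change (ρ_ U.obj).hom ≫ ε[U.obj] = ε[U.obj] ▷ 𝟙_ D ≫ (λ_ (𝟙_ D)).hom ≫ 𝟙 _
    monoidal
  | _ :: _, hx => simp at hx; omega

lemma idCochain_at {n : ℤ} {xs : List C} (h : (xs.length : ℤ) = n) :
    (idCochain U n).at xs = pureHom U.obj (𝟙 (tens F xs)) :=
  Family.at_of_length _ h

variable [Linear k D] [MonoidalPreadditive D] [MonoidalLinear k D]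

omit [MonoidalPreadditive D] in
lemma diamondAt_id_one {n : ℤ} (f : Family U n) : diamondAt n 0 (idCochain U 1) f = f := by
  refine Family.ext_at fun xs hx => ?_
  obtain ⟨q, hq⟩ := CentralCoalgebra.exists_fuse_full (U := U) xs
  rw [diamondAt_at _ f (by simp) hx hx q, idCochain_at (by simp),
    CentralCoalgebra.compU_pureHom_id_left, hq]

omit [MonoidalPreadditive D] in
lemma diamondAt_id_id {m n l : ℤ} (i : ℕ) (hi : (i : ℤ) < m) (hn : 0 ≤ n) (h : m + n = l + 1) :
    diamondAt l i (idCochain U m) (idCochain U n) = idCochain U l := by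
  refine Family.ext_at fun xs hx => ?_
  obtain ⟨B, ys, q, hB⟩ := exists_fuse i n.toNat xs (by omega)
  have hq := q.length_eq
  rw [diamondAt_at _ _ hi (by omega) hx q, idCochain_at (by omega), idCochain_at (by omega),
    CentralCoalgebra.compU_pureHom_id_left, CentralCoalgebra.insU_pureHom_id, idCochain_at hx]

omit [MonoidalPreadditive D] in
-- In the second input of the multiplication, `f` is reached only after `U` has crossed the first
-- object: this is the half-braiding in `dFirst`.
lemma diamondAt_id_two_one {n : ℤ} (f : Family U n) {xs : List C}
    (hx : (xs.length : ℤ) = n + 1) (hn : 0 ≤ n) :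
    (diamondAt (n + 1) 1 (idCochain U 2) f).at xs = dFirst f xs := by
  cases xs with
  | nil => simp at hx; omega
  | cons X xs =>
    simp only [List.length_cons, Nat.cast_add, Nat.cast_one] at hx
    obtain ⟨q, hq⟩ := CentralCoalgebra.exists_fuse_full (U := U) xs
    rw [diamondAt_at _ f (by simp) (by omega) (by simp; omega) (Fuse.succ X q),
      idCochain_at (by simp), CentralCoalgebra.compU_pureHom_id_left]
    change U.whiskF X (U.insU q _) = _
    rw [hq]
    rfl

omit [MonoidalPreadditive D] in
lemma diamondAt_id_two_zero {n : ℤ} (f : Family U n) {xs : List C}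
    (hx : (xs.length : ℤ) = n + 1) (hn : 0 ≤ n) :
    (diamondAt (n + 1) 0 (idCochain U 2) f).at xs = dLast f xs := by
  obtain ⟨c, hc⟩ := exists_cut_eq_splitIso F n.toNat xs
  have h := c.length_eq
  have h' : (xs.take n.toNat).length = n.toNat := by simp; omega
  rw [diamondAt_at _ f (by simp) (by omega) hx (Fuse.zero c),
    idCochain_at (by simp only [List.length_cons]; omega), CentralCoalgebra.compU_pureHom_id_left]
  change U.obj ◁ (cutIso F c).hom ≫ ((α_ _ _ _).inv ≫ _) ≫ (cutIso F c).inv = _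
  rw [hc, dLast]
  simp only [Category.assoc]

lemma diamondAt_id_two_right {n : ℤ} {f : Family U n} (hf : f ∈ equivCochains k U n) {xs : List C}
    (hx : (xs.length : ℤ) = n + 1) (j : ℕ) (hj : (j : ℤ) < n) :
    (diamondAt (n + 1) j f (idCochain U 2)).at xs = dMiddle f j xs := by
  obtain ⟨B, ys, q, hB⟩ := exists_fuse j 2 xs (by omega)
  obtain ⟨φ, hφ⟩ := exists_contract_tupleHom (F := F) q hB
  rw [diamondAt_at f _ hj (by omega) hx q, idCochain_at (by omega),
    CentralCoalgebra.compU_pureHom_id_right, dMiddle, ← hφ, whiskerLeft_comp, Category.assoc,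
    reassoc_of% (at_natural hf φ)]
  have h : tensMap F φ ≫ (fuseIso F q).inv = (contractIso F j xs).inv := by
    rw [Iso.comp_inv_eq, ← hφ]; simp
  rw [h]

lemma idCochain_mem (n : ℤ) : idCochain U n ∈ equivCochains k U n := by
  rw [mem_equivCochains_iff]
  refine ⟨fun xs ys φ hx => ?_, fun xs => ?_⟩
  · have hy : (ys.length : ℤ) = n := by rw [← φ.length_eq]; exact hx
    rw [idCochain_at hx, idCochain_at hy, pureHom_comp_right, whiskerLeft_comp_pureHom]
    simp
  · by_cases hx : (xs.length : ℤ) = n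
    · rw [idCochain_at hx, ← CentralCoalgebra.ofLift_id]
      exact CentralCoalgebra.isEquiv_ofLift _
    · rw [Family.at_of_ne _ hx]
      exact CentralCoalgebra.isEquiv_zero xs xs

/-- The outer terms insert `f` into the multiplication, the middle ones insert the multiplication
into `f`. Only the latter need naturality of `f`. -/
lemma differential_eq {n l : ℤ} {f : Family U n} (hf : f ∈ equivCochains k U n) (hl : l = n + 1) :
    differential k n l f = diamondAt l 1 (idCochain U 2) f +
      ∑ j ∈ Finset.range n.toNat, ((j : ℤ) + 1).negOnePow • diamondAt l j f (idCochain U 2) +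
        (n + 1).negOnePow • diamondAt l 0 (idCochain U 2) f := by
  subst hl
  by_cases hn : n < 0
  · rw [f.eq_zero_of_neg hn]
    simp [diamondAt_zero_left, diamondAt_zero_right]
  push Not at hn
  ext ⟨xs, hx⟩
  have e : differential k n (n + 1) f ⟨xs, hx⟩ = dFirst f xs +
      ∑ j ∈ Finset.range n.toNat, ((j : ℤ) + 1).negOnePow • dMiddle f j xs +
        (n + 1).negOnePow • dLast f xs := rfl
  rw [e, ← diamondAt_id_two_one f hx hn, ← diamondAt_id_two_zero f hx hn]
  simp only [Pi.add_apply, Finset.sum_apply, Pi.smul_apply]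
  simp only [← Family.at_of_length _ hx]
  congr 2
  refine Finset.sum_congr rfl fun j hj => ?_
  rw [Finset.mem_range] at hj
  rw [diamondAt_id_two_right hf hx j (by omega)]

omit [Preadditive D] [MonoidalPreadditive D] in
-- Splits `f ⊗ₘ g` so that `g` acts first. The factor `𝟙_ D` is the empty block to the right of the
-- arguments of `g`.
lemma CentralCoalgebra.tensorHom_eq_colift {T A B : D} (c : T ≅ A ⊗ B)
    (r : U.obj ⊗ A ⟶ A ⊗ U.obj) (f : U.obj ⊗ A ⟶ A) (g : U.obj ⊗ B ⟶ B) :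
    U.obj ◁ c.hom ≫ Δ[U.obj] ▷ (A ⊗ B) ≫ (α_ _ _ _).hom ≫
        U.obj ◁ ((α_ _ _ _).inv ≫ r ▷ B ≫ (α_ _ _ _).hom) ≫ (α_ _ _ _).inv ≫
          (f ⊗ₘ g) ≫ c.inv =
      colift (U.obj ◁ (c.hom ≫ A ◁ (ρ_ B).symm.hom) ≫
          ((α_ _ _ _).inv ≫ r ▷ (B ⊗ 𝟙_ D) ≫ (α_ _ _ _).hom ≫ A ◁ ((α_ _ _ _).inv ≫ g ▷ 𝟙_ D)) ≫
            A ◁ (ρ_ B).symm.inv ≫ c.inv) ≫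
        U.obj ◁ c.hom ≫ ((α_ _ _ _).inv ≫ f ▷ B) ≫ c.inv := by
  have h : U.obj ◁ (A ◁ (ρ_ B).symm.inv ≫ c.inv) ≫ U.obj ◁ c.hom = U.obj ◁ A ◁ (ρ_ B).hom := by
    rw [← MonoidalCategory.whiskerLeft_comp]
    simp
  have h' : U.obj ◁ (c.hom ≫ A ◁ (ρ_ B).symm.hom) = U.obj ◁ c.hom ≫ U.obj ◁ A ◁ (ρ_ B).inv :=
    MonoidalCategory.whiskerLeft_comp _ _ _
  rw [colift_whiskerLeft_comp, h', colift_comp]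
  simp only [Category.assoc]
  rw [reassoc_of% h, tensorHom_def']
  simp only [← Category.assoc]
  refine congrArg (· ≫ c.inv) ?_
  simp only [Category.assoc]
  refine congrArg (U.obj ◁ c.hom ≫ ·) ?_
  simp only [colift]
  monoidal

/-- Once `f` fills the first input of the multiplication, the second input is number `m`, right
after the arguments of `f`; `g` goes there. -/
lemma cup_eq {m n l : ℤ} {f : Family U m} (hf : f ∈ equivCochains k U m) (g : Family U n)
    (h : m + n = l) :
    cup l f g = diamondAt l m.toNat (diamondAt (m + 1) 0 (idCochain U 2) f) g := by
  by_cases hm : m < 0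
  · rw [f.eq_zero_of_neg hm, cup_zero_left, diamondAt_zero_right, diamondAt_zero_left]
  by_cases hn : n < 0
  · rw [g.eq_zero_of_neg hn, cup_zero_right, diamondAt_zero_right]
  refine Family.ext_at fun xs hx => ?_
  obtain ⟨c, hc⟩ := exists_cut_eq_splitIso F m.toNat xs
  obtain ⟨e, he⟩ := exists_cut_full F (xs.drop m.toNat)
  have hA : (xs.take m.toNat).length = m.toNat := by simp; omega
  have hR : (xs.drop m.toNat).length = n.toNat := by simp; omega
  -- The position is spelled in the shape `r + B.length + i` that `insU_disjoint` expects.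
  obtain ⟨B, ys, q, hB⟩ := exists_fuse (0 + (xs.take m.toNat).length + 0) n.toNat xs (by omega)
  obtain ⟨zs, p, hp⟩ := CentralCoalgebra.insU_disjoint (U := U) (.zero c) q
  have h₁ := q.length_eq
  have h₂ := p.length_eq
  have h₃ : U.insU q (g.at B) = U.insU (.ofCuts c e) (g.at (xs.drop m.toNat)) :=
    congrArg (fun t : Σ i B ys, Fuse i xs B ys => U.insU t.2.2.2 (g.at t.2.1))
      (q.unique (.ofCuts c e) (by simp) (by omega))
  have h₄ : m.toNat = 0 + (xs.take m.toNat).length + 0 := by omega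
  conv_rhs => rw [h₄]
  rw [diamondAt_at _ g (by push_cast; omega) (by omega) hx q,
    diamondAt_at _ f (by simp) (by omega) (by omega) p, idCochain_at (by omega),
    CentralCoalgebra.compU_pureHom_id_left, CentralCoalgebra.compU,
    hp (isEquiv_at hf _), h₃, CentralCoalgebra.insU_ofCuts, he, Family.at_of_length _ hx]
  change _ = colift _ ≫ U.obj ◁ (cutIso F c).hom ≫ ((α_ _ _ _).inv ≫ _) ≫ (cutIso F c).inv
  simp only [cup, ← hc]
  exact CentralCoalgebra.tensorHom_eq_colift (cutIso F c) (U.ρ.iter _) _ _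

end Multiplication

/-! ## Graded operads

Partial compositions carry the signs of the operadic suspension: composition is associative without
signs, and two insertions into different inputs commute up to the Koszul sign of the shifted
degrees. -/

lemma sum_range_sum_Ico_comm {A : Type*} [AddCommMonoid A] (N : ℕ) (H : ℕ → ℕ → A) :
    ∑ i ∈ Finset.range N, ∑ j ∈ Finset.Ico (i + 1) N, H i j =
      ∑ j ∈ Finset.range N, ∑ i ∈ Finset.range j, H i j := by
  simp only [Finset.range_eq_Ico]
  exact Finset.sum_Ico_Ico_comm' 0 N H

lemma map_intUnits_smul {A B G : Type*} [AddCommGroup A] [AddCommGroup B] [FunLike G A B]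
    [AddMonoidHomClass G A B] (φ : G) (u : ℤˣ) (a : A) : φ (u • a) = u • φ a := by
  rw [Units.smul_def, Units.smul_def, map_zsmul]

/-- The sign of interchanging elements of degrees `a` and `b` with respect to the degree shifted
by one. -/
def koszul (a b : ℤ) : ℤˣ := ((a - 1) * (b - 1)).negOnePow

lemma koszul_comm (a b : ℤ) : koszul a b = koszul b a := by
  rw [koszul, koszul, mul_comm]

lemma koszul_two_left (b : ℤ) : koszul 2 b = (b - 1).negOnePow := by
  rw [koszul]; congr 1; ring

lemma koszul_two_right (b : ℤ) : koszul b 2 = (b - 1).negOnePow := by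
  rw [koszul_comm, koszul_two_left]

/-- The shifted degree is additive under partial composition, so `koszul` is multiplicative in it.
-/
lemma koszul_of_add_eq {a b c : ℤ} (h : a + b = c + 1) (d : ℤ) :
    koszul c d = koszul a d * koszul b d := by
  rw [koszul, koszul, koszul, ← Int.negOnePow_add, show c - 1 = (a - 1) + (b - 1) by omega,
    add_mul]

/-- A graded operad without unit: partial compositions `x ∘ᵢ f`, vanishing negative degrees, and the
associativity of nested and of disjoint insertions. -/
structure GradedOperad (k : Type w) [Field k] (V : ℤ → Type*) [∀ n, AddCommGroup (V n)]
    [∀ n, Module k (V n)] where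
  circ : ∀ {m n : ℤ} (l : ℤ) (_ : ℕ), V m →ₗ[k] V n →ₗ[k] V l
  eq_zero_of_neg : ∀ {n : ℤ}, n < 0 → ∀ x : V n, x = 0
  circ_nest : ∀ {m n p l l' d : ℤ} (_ : m + n = l + 1) (_ : n + p = l' + 1) (_ : l + p = d + 1)
    (i j : ℕ) (_ : (j : ℤ) < n) (x : V m) (f : V n) (g : V p),
    circ d (j + i) (circ l i x f) g = circ d i x (circ l' j f g)
  circ_disjoint : ∀ {m n p l l' d : ℤ} (_ : m + n = l + 1) (_ : m + p = l' + 1) (_ : l + p = d + 1)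
    (i r n' : ℕ) (_ : (n' : ℤ) = n) (x : V m) (f : V n) (g : V p),
    circ d (r + n' + i) (circ l i x f) g =
      koszul n p • circ d i (circ l' (r + 1 + i) x g) f

namespace GradedOperad

variable {k : Type w} [Field k] {V : ℤ → Type*} [∀ n, AddCommGroup (V n)]
    [∀ n, Module k (V n)] (O : GradedOperad k V) {m n p q l l' l'' d : ℤ}

/-- The sum of all partial compositions, a pre-Lie product. -/
def dia (l : ℤ) : V m →ₗ[k] V n →ₗ[k] V l := ∑ i ∈ Finset.range m.toNat, O.circ l i

lemma dia_apply (x : V m) (f : V n) :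
    O.dia l x f = ∑ i ∈ Finset.range m.toNat, O.circ l i x f := by
  simp [dia]

/-- Simultaneous insertion of `f` and `g` into `x`, with `f` to the left of `g`. -/
def brace₂ (l d : ℤ) (x : V m) (f : V n) (g : V p) : V d :=
  ∑ j ∈ Finset.range m.toNat, ∑ i ∈ Finset.range j, O.circ d i (O.circ l j x g) f

/-- Simultaneous insertion of `f`, `g` and `h` into `x`, from left to right. -/
def brace₃ (l l' d : ℤ) (x : V m) (f : V n) (g : V p) (h : V q) : V d :=
  ∑ t ∈ Finset.range m.toNat, ∑ j ∈ Finset.range t, ∑ i ∈ Finset.range j,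
    O.circ d i (O.circ l' j (O.circ l t x h) g) f

/-- With `f` in input `i` of `x`, the insertion of `g` falls to the left of `f`, into `f` (nested)
or to the right of `f` (disjoint, with the Koszul sign). The bounds `a` and `b` stay general because
the brace identities need partial ranges; `c` is `b` shifted by the `n - 1` inputs that `f` adds. -/
lemma sum_circ_circ (h₁ : m + n = l + 1) (h₂ : n + p = l' + 1) (h₃ : l + p = d + 1)
    (h₄ : m + p = l'' + 1) {a i b c : ℕ} (ha : a ≤ i) (hi : i < b) (hc : (b : ℤ) + n = c + 1)
    (x : V m) (f : V n) (g : V p) :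
    ∑ t ∈ Finset.Ico a c, O.circ d t (O.circ l i x f) g =
      ∑ t ∈ Finset.Ico a i, O.circ d t (O.circ l i x f) g + O.circ d i x (O.dia l' f g) +
        koszul n p •
          ∑ t ∈ Finset.Ico (i + 1) b, O.circ d i (O.circ l'' t x g) f := by
  rcases lt_or_ge n 0 with hn | hn
  · simp [O.eq_zero_of_neg hn f]
  lift n to ℕ using hn
  rw [← Finset.sum_Ico_consecutive _ ha (by omega : i ≤ c),
    ← Finset.sum_Ico_consecutive _ (Nat.le_add_right i n) (by omega : i + n ≤ c), add_assoc]
  congr 2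
  · rw [Finset.sum_Ico_eq_sum_range, dia_apply, map_sum]
    refine Finset.sum_congr (by simp) fun j hj => ?_
    rw [Finset.mem_range] at hj
    rw [add_comm, O.circ_nest h₁ h₂ h₃ i j (by omega)]
  · rw [Finset.sum_Ico_eq_sum_range, Finset.sum_Ico_eq_sum_range, Finset.smul_sum]
    refine Finset.sum_congr (congrArg _ (by omega)) fun r _ => ?_
    rw [show i + n + r = r + n + i by omega, O.circ_disjoint h₁ h₄ h₃ i r n rfl,
      show i + 1 + r = r + 1 + i by omega]

/-- The pre-Lie identity. -/
theorem dia_dia (h₁ : m + n = l + 1) (h₂ : n + p = l' + 1) (h₃ : l + p = d + 1)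
    (h₄ : m + p = l'' + 1) (x : V m) (f : V n) (g : V p) :
    O.dia d (O.dia l x f) g = O.dia d x (O.dia l' f g) + O.brace₂ l d x g f +
      koszul n p • O.brace₂ l'' d x f g := by
  rcases lt_or_ge n 0 with hn | hn
  · simp [O.eq_zero_of_neg hn f, brace₂]
  have key (i : ℕ) (hi : i ∈ Finset.range m.toNat) :=
    O.sum_circ_circ (b := m.toNat) (c := l.toNat) h₁ h₂ h₃ h₄ (Nat.zero_le i)
      (Finset.mem_range.1 hi) (by have := Finset.mem_range.1 hi; omega) x f g
  simp only [← Finset.range_eq_Ico] at key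
  rw [dia_apply, dia_apply, dia_apply _ x]
  simp only [map_sum, LinearMap.sum_apply]
  rw [Finset.sum_comm, Finset.sum_congr rfl key]
  simp only [Finset.sum_add_distrib, ← Finset.smul_sum, sum_range_sum_Ico_comm]
  rw [brace₂, brace₂]
  abel

@[simp]
lemma brace₂_zero (f : V n) (g : V p) : O.brace₂ l d (0 : V m) f g = 0 := by
  simp [brace₂]

lemma brace₂_smul (u : ℤˣ) (x : V m) (f : V n) (g : V p) :
    O.brace₂ l d (u • x) f g = u • O.brace₂ l d x f g := by
  simp only [brace₂, map_intUnits_smul, LinearMap.smul_apply, Finset.smul_sum]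

lemma brace₂_smul_left (u : ℤˣ) (x : V m) (f : V n) (g : V p) :
    O.brace₂ l d x (u • f) g = u • O.brace₂ l d x f g := by
  simp only [brace₂, map_intUnits_smul, Finset.smul_sum]

lemma brace₂_smul_right (u : ℤˣ) (x : V m) (f : V n) (g : V p) :
    O.brace₂ l d x f (u • g) = u • O.brace₂ l d x f g := by
  simp only [brace₂, map_intUnits_smul, LinearMap.smul_apply, Finset.smul_sum]

lemma brace₂_sub_left (x : V m) (f f' : V n) (g : V p) :
    O.brace₂ l d x (f - f') g = O.brace₂ l d x f g - O.brace₂ l d x f' g := by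
  simp only [brace₂, map_sub, Finset.sum_sub_distrib]

lemma brace₂_sub_right (x : V m) (f : V n) (g g' : V p) :
    O.brace₂ l d x f (g - g') = O.brace₂ l d x f g - O.brace₂ l d x f g' := by
  simp only [brace₂, map_sub, LinearMap.sub_apply, Finset.sum_sub_distrib]

lemma brace₂_of_neg_left (h : n < 0) (x : V m) (f : V n) (g : V p) : O.brace₂ l d x f g = 0 := by
  simp [brace₂, O.eq_zero_of_neg h f]

lemma brace₂_of_neg_right (h : p < 0) (x : V m) (f : V n) (g : V p) : O.brace₂ l d x f g = 0 := by
  simp [brace₂, O.eq_zero_of_neg h g]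

lemma brace₃_of_neg_left (h : n < 0) (x : V m) (f : V n) (g : V p) (y : V q) :
    O.brace₃ l l' d x f g y = 0 := by
  simp [brace₃, O.eq_zero_of_neg h f]

lemma brace₃_of_neg_middle (h : p < 0) (x : V m) (f : V n) (g : V p) (y : V q) :
    O.brace₃ l l' d x f g y = 0 := by
  simp [brace₃, O.eq_zero_of_neg h g]

lemma brace₃_of_neg_right (h : q < 0) (x : V m) (f : V n) (g : V p) (y : V q) :
    O.brace₃ l l' d x f g y = 0 := by
  simp [brace₃, O.eq_zero_of_neg h y]

/-- The five terms are the places where `y` can land: left of `f`, in `f`, between `f` and `g`, in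
`g`, right of `g`. -/
theorem dia_brace₂ {xg xq xfg xgq fq gq : ℤ} (hxg : m + p = xg + 1) (hxq : m + q = xq + 1)
    (hxfg : xg + n = xfg + 1) (hxgq : xg + q = xgq + 1) (hfq : n + q = fq + 1)
    (hgq : p + q = gq + 1) (hd : xfg + q = d + 1) (x : V m) (f : V n) (g : V p) (y : V q) :
    O.dia d (O.brace₂ xg xfg x f g) y =
      O.brace₃ xg xfg d x y f g + O.brace₂ xg d x (O.dia fq f y) g +
        koszul n q • (O.brace₃ xg xgq d x f y g +
          O.brace₂ xgq d x f (O.dia gq g y) +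
            koszul p q • O.brace₃ xq xgq d x f g y) := by
  rcases lt_or_ge p 0 with hp | hp
  · rw [O.brace₂_of_neg_right hp, O.brace₂_of_neg_right hp, O.brace₃_of_neg_right hp,
      O.brace₃_of_neg_right hp, O.brace₃_of_neg_middle hp, O.eq_zero_of_neg hp g]
    simp [brace₂]
  rcases lt_or_ge n 0 with hn | hn
  · rw [O.brace₂_of_neg_left hn, O.brace₂_of_neg_left hn, O.brace₃_of_neg_left hn,
      O.brace₃_of_neg_left hn, O.brace₃_of_neg_middle hn, O.eq_zero_of_neg hn f]
    simp [brace₂]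
  have key : ∀ j ∈ Finset.range m.toNat, ∀ i ∈ Finset.range j,
      ∑ t ∈ Finset.range xfg.toNat, O.circ d t (O.circ xfg i (O.circ xg j x g) f) y =
        ∑ t ∈ Finset.range i, O.circ d t (O.circ xfg i (O.circ xg j x g) f) y +
          O.circ d i (O.circ xg j x g) (O.dia fq f y) +
          koszul n q •
            (∑ t ∈ Finset.Ico (i + 1) j, O.circ d i (O.circ xgq t (O.circ xg j x g) y) f +
              O.circ d i (O.circ xgq j x (O.dia gq g y)) f +
              koszul p q • ∑ t ∈ Finset.Ico (j + 1) m.toNat,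
                O.circ d i (O.circ xgq j (O.circ xq t x y) g) f) := by
    intro j hj i hi
    rw [Finset.mem_range] at hi hj
    have h₁ := O.sum_circ_circ (b := xg.toNat) (c := xfg.toNat) hxfg hfq hd hxgq
      (Nat.zero_le i) (by omega) (by omega) (O.circ xg j x g) f y
    have h₂ := congrArg (fun z => O.circ d i z f)
      -- To the right of `f`, the insertion of `y` can be done before that of `f`; it is now sorted
      -- relative to `g`.
      (O.sum_circ_circ (c := xg.toNat) hxg hgq hxgq hxq (show i + 1 ≤ j by omega) hj (by omega)
        x g y)
    simp only [map_sum, map_add, LinearMap.sum_apply, LinearMap.add_apply, map_intUnits_smul,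
      LinearMap.smul_apply] at h₂
    rw [Finset.range_eq_Ico, h₁, h₂, Finset.range_eq_Ico]
  rw [dia_apply, brace₂]
  simp only [map_sum, LinearMap.sum_apply]
  rw [Finset.sum_comm, Finset.sum_congr rfl fun j hj =>
    Finset.sum_comm.trans (Finset.sum_congr rfl (key j hj))]
  simp only [Finset.sum_add_distrib, ← Finset.smul_sum, smul_add, sum_range_sum_Ico_comm]
  rw [Finset.sum_congr rfl fun j _ => Finset.sum_comm (s := Finset.range j),
    sum_range_sum_Ico_comm]
  rfl

/-- The six terms sort the pair `f`, `g`, in this order, relative to `y`: each of the two is left of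
`y`, in `y` or right of `y`, with `f` never further right than `g`. -/
theorem brace₂_dia {xq xg xqg xgf qg qf qgf : ℤ} (hxq : m + q = xq + 1) (hxg : m + p = xg + 1)
    (hxqg : xq + p = xqg + 1) (hxgf : xg + n = xgf + 1) (hqg : q + p = qg + 1)
    (hqf : q + n = qf + 1) (hqgf : qg + n = qgf + 1) (hd : xqg + n = d + 1)
    (x : V m) (y : V q) (f : V n) (g : V p) :
    O.brace₂ xqg d (O.dia xq x y) f g =
      O.brace₃ xq xqg d x f g y + O.brace₂ xqg d x f (O.dia qg y g) +
        O.dia d x (O.brace₂ qg qgf y f g) +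
          koszul q p • (O.brace₃ xg xqg d x f y g +
            O.brace₂ xg d x (O.dia qf y f) g +
              koszul q n • O.brace₃ xg xgf d x y f g) := by
  rcases lt_or_ge q 0 with hq | hq
  · rw [O.brace₃_of_neg_left hq, O.brace₃_of_neg_middle hq, O.brace₃_of_neg_right hq,
      O.eq_zero_of_neg hq y]
    simp [brace₂]
  rcases lt_or_ge p 0 with hp | hp
  · rw [O.brace₃_of_neg_right hp, O.brace₃_of_neg_middle hp, O.brace₃_of_neg_right hp,
      O.brace₂_of_neg_right hp, O.brace₂_of_neg_right hp, O.brace₂_of_neg_right hp,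
      O.eq_zero_of_neg hp g]
    simp [brace₂]
  have key : ∀ l ∈ Finset.range m.toNat,
      ∑ j ∈ Finset.range xq.toNat, ∑ i ∈ Finset.range j,
          O.circ d i (O.circ xqg j (O.circ xq l x y) g) f =
        ∑ j ∈ Finset.range l, ∑ i ∈ Finset.range j,
            O.circ d i (O.circ xqg j (O.circ xq l x y) g) f +
          (∑ i ∈ Finset.range l, O.circ d i (O.circ xqg l x (O.dia qg y g)) f +
            O.circ d l x (O.brace₂ qg qgf y f g)) +
          koszul q p • ∑ j ∈ Finset.Ico (l + 1) m.toNat,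
            (∑ i ∈ Finset.range l, O.circ d i (O.circ xqg l (O.circ xg j x g) y) f +
              O.circ d l (O.circ xg j x g) (O.dia qf y f) +
              koszul q n • ∑ i ∈ Finset.Ico (l + 1) j,
                O.circ d l (O.circ xgf i (O.circ xg j x g) f) y) := by
    intro l hl
    rw [Finset.mem_range] at hl
    lift q to ℕ using hq
    rw [Finset.range_eq_Ico (a := xq.toNat),
      ← Finset.sum_Ico_consecutive _ (Nat.zero_le l) (by omega : l ≤ xq.toNat),
      ← Finset.sum_Ico_consecutive _ (Nat.le_add_right l q) (by omega : l + q ≤ xq.toNat),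
      ← add_assoc, ← Finset.range_eq_Ico]
    congr 2
    · rw [Finset.sum_Ico_eq_sum_range, dia_apply, brace₂]
      simp only [map_sum, LinearMap.sum_apply]
      rw [Finset.sum_comm, ← Finset.sum_add_distrib]
      refine Finset.sum_congr (by simp) fun s hs => ?_
      rw [Finset.mem_range] at hs
      rw [Finset.sum_range_add, add_comm l s, O.circ_nest hxq hqg hxqg l s (by omega)]
      congr 1
      refine Finset.sum_congr rfl fun t ht => ?_
      rw [Finset.mem_range] at ht
      rw [add_comm l t, O.circ_nest (by omega) hqgf hd l t (by omega)]
    -- Here `g` is right of `y`. After the two are exchanged, `sum_circ_circ` sorts `f` relative to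
    -- `y`.
    · rw [Finset.sum_Ico_eq_sum_range, Finset.sum_Ico_eq_sum_range, Finset.smul_sum]
      refine Finset.sum_congr (congrArg _ (by omega)) fun r _ => ?_
      simp only [show l + q + r = r + q + l by omega, show l + 1 + r = r + 1 + l by omega]
      rw [O.circ_disjoint hxq hxg hxqg l r q rfl]
      simp only [map_intUnits_smul, LinearMap.smul_apply, ← Finset.smul_sum]
      rw [Finset.range_eq_Ico, O.sum_circ_circ (b := r + 1 + l) (by omega) hqf hd hxgf
        (Nat.zero_le l) (by omega) (by push_cast; omega), Finset.range_eq_Ico]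
  rw [dia_apply, brace₂]
  simp only [map_sum, LinearMap.sum_apply]
  rw [Finset.sum_congr rfl fun j _ => Finset.sum_comm, Finset.sum_comm, Finset.sum_congr rfl key]
  simp only [Finset.sum_add_distrib, ← Finset.smul_sum, smul_add, sum_range_sum_Ico_comm]
  simp only [brace₃, brace₂, dia_apply _ x]
  abel

end GradedOperad

lemma negOnePow_eq_neg_koszul (a : ℤ) : a.negOnePow = -koszul a 2 := by
  rw [koszul_two_right, Int.negOnePow_sub, Int.negOnePow_one]; simp

lemma negOnePow_mul_sub_one (a b : ℤ) :
    (a * (b - 1)).negOnePow = koszul a b * koszul b 2 := by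
  rw [koszul_two_right, koszul, ← Int.negOnePow_add]; congr 1; ring

lemma negOnePow_mul_eq (a b : ℤ) :
    (a * b).negOnePow = -(koszul a b * koszul a 2 * koszul b 2) := by
  rw [koszul_two_right a, mul_right_comm, ← negOnePow_mul_sub_one, ← Int.negOnePow_add,
    show a * (b - 1) + (a - 1) = a * b - 1 by ring, Int.negOnePow_sub, Int.negOnePow_one]
  simp

lemma koszul_two_two : koszul 2 2 = -1 := rfl

lemma koszul_add_one (a : ℤ) : koszul (a + 1) 2 = -koszul a 2 := by
  rw [koszul_of_add_eq (show a + 2 = a + 1 + 1 by omega), koszul_two_two, mul_neg, mul_one]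

/-! ### The graded Lie bracket of a graded operad. -/

namespace GradedOperad

variable {k : Type w} [Field k] {V : ℤ → Type*} [∀ n, AddCommGroup (V n)]
    [∀ n, Module k (V n)] (O : GradedOperad k V) {m n p l d : ℤ}

/-- The graded commutator of the pre-Lie product. -/
def br (l : ℤ) : V m →ₗ[k] V n →ₗ[k] V l := O.dia l - koszul m n • (O.dia l).flip

lemma br_apply (x : V m) (y : V n) :
    O.br l x y = O.dia l x y - koszul m n • O.dia l y x := rfl

theorem br_antisymm (x : V m) (y : V n) : O.br l x y = -(koszul m n • O.br l y x) := by
  rw [br_apply, br_apply, koszul_comm n m]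
  rcases Int.units_eq_one_or (koszul m n) with h | h <;> simp [h]

/-- The graded Jacobi identity. -/
theorem br_br {xy yz xz : ℤ} (hxy : m + n = xy + 1) (hyz : n + p = yz + 1) (hxz : m + p = xz + 1)
    (hd : m + yz = d + 1) (x : V m) (y : V n) (z : V p) :
    O.br d x (O.br yz y z) =
      O.br d (O.br xy x y) z + koszul m n • O.br d y (O.br xz x z) := by
  have e₁ : koszul m yz = koszul m n * koszul m p := by
    rw [koszul_comm, koszul_of_add_eq hyz, koszul_comm n, koszul_comm p]
  have e₂ : koszul n xz = koszul m n * koszul n p := by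
    rw [koszul_comm, koszul_of_add_eq hxz, koszul_comm p]
  simp only [br_apply, map_sub, LinearMap.sub_apply, map_intUnits_smul, LinearMap.smul_apply, e₁,
    e₂, koszul_of_add_eq hxy p]
  -- One pre-Lie identity for each ordering of the three elements; every brace occurs in two of
  -- them, and the two occurrences cancel.
  rw [O.dia_dia (l := yz) (l' := xz) (l'' := xy) (by omega) (by omega) (by omega) (by omega)
      y z x,
    O.dia_dia (l := yz) (l' := xy) (l'' := xz) (by omega) (by omega) (by omega) (by omega)
      z y x,
    O.dia_dia (l := xy) (l' := yz) (l'' := xz) (by omega) (by omega) (by omega) (by omega)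
      x y z,
    O.dia_dia (l := xy) (l' := xz) (l'' := yz) (by omega) (by omega) (by omega) (by omega)
      y x z,
    O.dia_dia (l := xz) (l' := yz) (l'' := xy) (by omega) (by omega) (by omega) (by omega)
      x z y,
    O.dia_dia (l := xz) (l' := xy) (l'' := yz) (by omega) (by omega) (by omega) (by omega)
      z x y]
  rw [koszul_comm n m, koszul_comm p m, koszul_comm p n]
  rcases Int.units_eq_one_or (koszul m n) with h₁ | h₁ <;>
  rcases Int.units_eq_one_or (koszul m p) with h₂ | h₂ <;>
  rcases Int.units_eq_one_or (koszul n p) with h₃ | h₃ <;>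
  simp only [h₁, h₂, h₃, one_smul, mul_one, Units.neg_smul, neg_neg, mul_neg] <;>
  abel

lemma br_self (hm : Odd m) (x : V m) : O.br l x x = 0 := by
  have h : koszul m m = 1 := Int.negOnePow_even _ (Even.mul_left (hm.sub_odd odd_one) _)
  rw [br_apply, h, one_smul, sub_self]

/-- In even degree the two braces in the pre-Lie identity for `x, x, x` are equal with opposite
signs, so `x` associates with itself and no division by 3 is needed. -/
lemma br_br_self (h : m + m = l + 1) (h' : m + l = d + 1) (hm : Even m) (x : V m) :
    O.br d x (O.br l x x) = 0 := by
  have e : koszul m m = -1 := Int.negOnePow_odd _ ((hm.sub_odd odd_one).mul (hm.sub_odd odd_one))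
  have e' : koszul m l = 1 := by rw [koszul_comm, koszul_of_add_eq h, e]; rfl
  have E := O.dia_dia (l := l) (l' := l) (l'' := l) h h (d := d) (by omega) h x x x
  rw [e] at E
  simp only [br_apply, e, e', one_smul, Units.neg_smul, sub_neg_eq_add, map_add, E]
  abel

theorem isGradedLieAlgebra : IsGradedLieAlgebra k V (fun _ _ c _ => O.br c) where
  antisymm _ _ _ _ _ x y := O.br_antisymm x y
  jacobi _ _ _ _ _ _ _ hab hbc hac h₁ _ _ x y z := O.br_br hab hbc hac h₁ x y z
  lie_self _ _ _ x ha := O.br_self ha x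
  lie_lie_self _ _ _ h h' x ha := O.br_br_self h h' ha x

end GradedOperad

/-! ## Operads with multiplication -/

/-- A graded operad with a multiplication `μ` and a unit `e` of the multiplication. -/
structure MultiplicativeOperad (k : Type w) [Field k] (V : ℤ → Type*) [∀ n, AddCommGroup (V n)]
    [∀ n, Module k (V n)] extends GradedOperad k V where
  one : V 1
  circ_one : ∀ {n : ℤ} (x : V n), circ n 0 one x = x
  μ : V 2
  circ_μ_μ : circ 3 0 μ μ + circ 3 1 μ μ = 0
  e : V 0
  circ_μ_e_zero : circ 1 0 μ e = one
  circ_μ_e_one : circ 1 1 μ e = -one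

namespace MultiplicativeOperad

variable {k : Type w} [Field k] {V : ℤ → Type*} [∀ n, AddCommGroup (V n)]
    [∀ n, Module k (V n)] (O : MultiplicativeOperad k V) {m n p l d : ℤ}

/-- The differential `-[-, μ]`. -/
def δ (l : ℤ) : V n →ₗ[k] V l := -(O.br l).flip O.μ

lemma δ_apply (x : V n) : O.δ l x = koszul n 2 • O.dia l O.μ x - O.dia l x O.μ := by
  change -(O.br l x O.μ) = _
  rw [GradedOperad.br_apply, neg_sub]

lemma dia_μ_μ : O.dia 3 O.μ O.μ = 0 := by
  rw [GradedOperad.dia_apply, ← O.circ_μ_μ]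
  exact Finset.sum_range_succ _ 1 |>.trans (by simp)

/-- The Jacobi identity would only show that twice this vanishes. The pre-Lie identity works in
every characteristic: the two braces `x{μ, μ}` in `h₁` cancel, and `h₃` disposes of the braces from
`h₂`. -/
theorem δ_δ (hl : l = n + 1) (hd : d = l + 1) (x : V n) : O.δ d (O.δ l x) = 0 := by
  have h₁ := O.dia_dia (l := l) (l' := 3) (l'' := l) (d := d) (by omega) (by omega) (by omega)
    (by omega) x O.μ O.μ
  have h₂ := O.dia_dia (l := l) (l' := l) (l'' := 3) (d := d) (by omega) (by omega) (by omega)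
    (by omega) O.μ x O.μ
  have h₃ := O.dia_dia (l := 3) (l' := l) (l'' := l) (d := d) (by omega) (by omega) (by omega)
    (by omega) O.μ O.μ x
  have e : koszul l 2 = -koszul n 2 := by
    rw [koszul_of_add_eq (show n + 2 = l + 1 by omega), koszul_two_two, mul_neg, mul_one]
  rw [koszul_comm 2 n] at h₃
  simp only [dia_μ_μ, map_zero, LinearMap.zero_apply, koszul_two_two] at h₁ h₃
  simp only [δ_apply, e, map_sub, map_intUnits_smul, h₁, h₂]
  rcases Int.units_eq_one_or (koszul n 2) with h | h <;>
  simp only [h, one_smul, Units.neg_smul, neg_neg] at h₃ ⊢ <;>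
  grind

/-- The Jacobi identity for `x`, `y`, `μ`, rearranged by antisymmetry. -/
theorem δ_br (hl : m + n = l + 1) {m' n' : ℤ} (hm : m' = m + 1) (hn : n' = n + 1) (hd : d = l + 1)
    (x : V m) (y : V n) :
    O.δ d (O.br l x y) = O.br d x (O.δ n' y) + koszul n 2 • O.br d (O.δ m' x) y := by
  subst hm hn
  have h := O.br_br (p := 2) (yz := n + 1) (xz := m + 1) (d := d) hl (by omega) (by omega)
    (by omega) x y O.μ
  change -O.br d (O.br l x y) O.μ =
    O.br d x (-O.br (n + 1) y O.μ) + koszul n 2 • O.br d (-O.br (m + 1) x O.μ) y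
  rw [map_neg, map_neg, LinearMap.neg_apply, h, O.br_antisymm y, koszul_comm n,
    koszul_of_add_eq (show m + 2 = m + 1 + 1 by omega), koszul_comm m n, koszul_two_left,
    koszul_two_right]
  rcases Int.units_eq_one_or (koszul n m) with h₁ | h₁ <;>
  rcases Int.units_eq_one_or (n - 1).negOnePow with h₂ | h₂ <;>
  simp only [h₁, h₂, one_smul, Units.neg_smul, mul_one, mul_neg, neg_neg] <;>
  abel

lemma brace₂_μ (x : V m) (y : V n) :
    O.brace₂ l d O.μ x y = O.circ d 0 (O.circ l 1 O.μ y) x := by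
  rw [GradedOperad.brace₂, show (2 : ℤ).toNat = 2 from rfl, Finset.sum_range_succ,
    Finset.sum_range_one, Finset.sum_range_zero, zero_add, Finset.sum_range_one]

lemma brace₃_μ {q l' : ℤ} (x : V m) (y : V n) (z : V q) : O.brace₃ l l' d O.μ x y z = 0 := by
  rw [GradedOperad.brace₃, show (2 : ℤ).toNat = 2 from rfl, Finset.sum_range_succ,
    Finset.sum_range_one, Finset.sum_range_zero, zero_add, Finset.sum_range_one,
    Finset.sum_range_zero]

/-- The cup product, up to sign the insertion of two elements into `μ`. -/
def cup (l : ℤ) : V m →ₗ[k] V n →ₗ[k] V l :=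
  koszul n 2 • (O.circ l 0 ∘ₗ O.circ (n + 1) 1 O.μ).flip

lemma cup_apply (x : V m) (y : V n) :
    O.cup l x y = koszul n 2 • O.brace₂ (n + 1) l O.μ x y := by
  rw [brace₂_μ]; rfl

/-- Both sides insert `x`, `y`, `z` into the two composites of `μ` with itself, which agree up to
sign by `circ_μ_μ`; `circ_nest` and `circ_disjoint` bring the insertions into the same order. -/
theorem cup_assoc {a b c ab bc : ℤ} (hab : a + b = ab) (hbc : b + c = bc) (hd : ab + c = d)
    (x : V a) (y : V b) (z : V c) : O.cup d (O.cup ab x y) z = O.cup d x (O.cup bc y z) := by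
  rcases lt_or_ge b 0 with hb | hb
  · simp [O.eq_zero_of_neg hb y]
  rcases lt_or_ge c 0 with hc | hc
  · simp [O.eq_zero_of_neg hc z]
  subst hab hbc
  have h₀ : O.circ 3 0 O.μ O.μ = -O.circ 3 1 O.μ O.μ := eq_neg_of_add_eq_zero_left O.circ_μ_μ
  have h₁ : O.circ (c + 2) 0 (O.circ (c + 1) 1 O.μ z) O.μ =
      -(koszul c 2 • O.circ (c + 2) 1 O.μ (O.circ (c + 1) 1 O.μ z)) := by
    have e₁ := O.circ_nest (l := 3) (l' := c + 1) (d := c + 2) (by omega) (by omega) (by omega)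
      1 1 (by omega) O.μ O.μ z
    have e₂ := O.circ_disjoint (l := 3) (l' := c + 1) (d := c + 2) (by omega) (by omega)
      (by omega) 0 0 2 (by omega) O.μ O.μ z
    rw [h₀, koszul_comm 2] at e₂
    simp only [map_neg, LinearMap.neg_apply, zero_add, Nat.reduceAdd, add_zero] at e₁ e₂
    rw [e₁, neg_eq_iff_eq_neg] at e₂
    rw [e₂]
    rcases Int.units_eq_one_or (koszul c 2) with h | h <;> simp [h]
  have h₂ : O.circ (b + c + 1) 0 (O.circ (c + 1) 1 O.μ z) (O.circ (b + 1) 1 O.μ y) =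
      -(koszul c 2 • O.circ (b + c + 1) 1 O.μ (O.circ (b + c) 0 (O.circ (c + 1) 1 O.μ z) y)) := by
    have e₁ := O.circ_nest (l := c + 2) (l' := b + 1) (d := b + c + 1) (by omega) (by omega)
      (by omega) 0 1 (by omega) (O.circ (c + 1) 1 O.μ z) O.μ y
    have e₂ := O.circ_nest (l := c + 2) (l' := b + c) (d := b + c + 1) (by omega) (by omega)
      (by omega) 1 0 (by omega) O.μ (O.circ (c + 1) 1 O.μ z) y
    rw [← e₁, ← e₂, add_zero, h₁]
    simp only [map_neg, LinearMap.neg_apply, map_intUnits_smul, LinearMap.smul_apply, zero_add]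
  have h₃ := O.circ_nest (l := b + c + 1) (l' := a + b) (d := d) (by omega) (by omega) (by omega)
    0 0 (by omega) (O.circ (c + 1) 1 O.μ z) (O.circ (b + 1) 1 O.μ y) x
  have e : koszul (b + c) 2 = -(koszul b 2 * koszul c 2) := by
    rw [koszul_of_add_eq (show b + (c + 1) = b + c + 1 by omega), koszul_add_one, mul_neg]
  simp only [cup_apply, brace₂_μ, map_intUnits_smul, LinearMap.smul_apply, ← h₃, h₂, map_neg,
    LinearMap.neg_apply, e, zero_add]
  rcases Int.units_eq_one_or (koszul b 2) with h | h <;>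
  rcases Int.units_eq_one_or (koszul c 2) with h' | h' <;>
  simp [h, h']

theorem e_cup (x : V n) : O.cup n O.e x = x := by
  -- Here `r = n' = 0`: an element of degree 0 occupies no inputs, so after its insertion the second
  -- input of `μ` has number 0.
  have h := O.circ_disjoint (l := 1) (l' := n + 1) (d := n) (by omega) (by omega) (by omega)
    0 0 0 Nat.cast_zero O.μ O.e x
  rw [cup_apply, brace₂_μ]
  simp only [add_zero, zero_add, circ_μ_e_zero, circ_one] at h
  rw [show koszul 0 n = koszul n 2 by
    rw [koszul_two_right, koszul, ← Int.negOnePow_neg]; congr 1; ring] at h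
  exact h.symm

theorem cup_e (x : V n) : O.cup n x O.e = x := by
  have h : O.circ (0 + 1) 1 O.μ O.e = -O.one := O.circ_μ_e_one
  rw [cup_apply, brace₂_μ, show koszul 0 2 = -1 from rfl, h]
  simp only [map_neg, LinearMap.neg_apply, circ_one, Units.neg_smul, one_smul, neg_neg]

theorem δ_e : O.δ 1 O.e = 0 := by
  rw [δ_apply, show koszul 0 2 = -1 from rfl, GradedOperad.dia_apply, GradedOperad.dia_apply,
    show (2 : ℤ).toNat = 2 from rfl, Finset.sum_range_succ, Finset.sum_range_one, circ_μ_e_zero,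
    circ_μ_e_one]
  simp

/-- The multiplication has two inputs, so braces of three elements into it vanish. Expanding `(μ{x,
y}) ◇ μ` and `(μ ◇ μ){x, y} = 0` gives all terms. -/
theorem δ_cup (hl : m + n = l) {m' n' : ℤ} (hm : m' = m + 1) (hn : n' = n + 1) (hd : d = l + 1)
    (x : V m) (y : V n) :
    O.δ d (O.cup l x y) = O.cup d (O.δ m' x) y + m.negOnePow • O.cup d x (O.δ n' y) := by
  subst hm hn
  have h₁ := O.dia_brace₂ (xg := n + 1) (xq := 3) (xfg := l) (xgq := n + 1 + 1) (fq := m + 1)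
    (gq := n + 1) (d := d) (by omega) (by omega) (by omega) (by omega) (by omega) (by omega)
    (by omega) O.μ x y O.μ
  have h₂ := O.brace₂_dia (xq := 3) (xg := n + 1) (xqg := n + 1 + 1) (xgf := l) (qg := n + 1)
    (qf := m + 1) (qgf := l) (d := d) (by omega) (by omega) (by omega) (by omega) (by omega)
    (by omega) (by omega) (by omega) O.μ O.μ x y
  have e : koszul l 2 = -(koszul m 2 * koszul n 2) := by
    rw [koszul_of_add_eq (show m + (n + 1) = l + 1 by omega), koszul_add_one, mul_neg]
  simp only [dia_μ_μ, brace₃_μ, koszul_comm 2, O.brace₂_zero, smul_zero, add_zero, zero_add]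
    at h₁ h₂
  simp only [cup_apply, δ_apply, e, map_intUnits_smul, h₁, negOnePow_eq_neg_koszul,
    koszul_add_one, O.brace₂_sub_left, O.brace₂_sub_right,
    O.brace₂_smul_left, O.brace₂_smul_right]
  rcases Int.units_eq_one_or (koszul m 2) with h | h <;>
  rcases Int.units_eq_one_or (koszul n 2) with h' | h' <;>
  simp only [h, h', one_smul, mul_one, mul_neg, Units.neg_smul, neg_neg] at h₂ ⊢ <;>
  grind

/-- The cup product of cocycles is graded commutative up to a coboundary. -/
theorem exists_cup_comm (hl : m + n = l + 1) {x : V m} {y : V n} (hx : O.δ (m + 1) x = 0)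
    (hy : O.δ (n + 1) y = 0) :
    ∃ z : V l, O.cup (l + 1) x y = (m * n).negOnePow • O.cup (l + 1) y x + O.δ (l + 1) z := by
  -- Expanding `(μ ◇ x) ◇ y` produces `μ{x, y}` and `μ{y, x}`; the braces into `x` from `h₁` and
  -- `h₃` cancel by the cocycle conditions.
  refine ⟨-((koszul m n * koszul m 2) • O.dia l x y), ?_⟩
  have h₁ := O.dia_dia (l := l) (l' := n + 1) (l'' := m + 1) (d := l + 1) (by omega) (by omega)
    (by omega) (by omega) x y O.μ
  have h₂ := O.dia_dia (l := m + 1) (l' := l) (l'' := n + 1) (d := l + 1) (by omega) (by omega)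
    (by omega) (by omega) O.μ x y
  have h₃ := O.dia_dia (l := m + 1) (l' := n + 1) (l'' := l) (d := l + 1) (by omega) (by omega)
    (by omega) (by omega) x O.μ y
  rw [δ_apply, sub_eq_zero] at hx hy
  rw [koszul_comm 2] at h₃
  rw [← hx] at h₃
  rw [← hy] at h₁
  simp only [map_intUnits_smul, LinearMap.smul_apply] at h₁ h₃
  simp only [map_neg, cup_apply, δ_apply, map_intUnits_smul, h₁, negOnePow_mul_eq, koszul_of_add_eq hl]
  rcases Int.units_eq_one_or (koszul m 2) with h | h <;>
  rcases Int.units_eq_one_or (koszul n 2) with h' | h' <;>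
  rcases Int.units_eq_one_or (koszul m n) with h'' | h'' <;>
  simp only [h, h', h'', one_smul, mul_one, mul_neg, Units.neg_smul, neg_neg] at h₂ h₃ ⊢ <;>
  grind

/-- The sign bookkeeping of `exists_br_cup`. `P` and `Q` are braces into `μ` in which `z` is
composed with `x`, respectively `y`; `R` is `(μ ◇ z){x, y}`; `X₁` and `X₂` are `μ ◇ (z{x, y})` and
`z ◇ (μ{x, y})`; `S` and `T` are braces into `z`. -/
lemma sign_identity {A : Type*} [AddCommGroup A] (α β γ s t : ℤˣ)
    (P₁ P₂ Q₁ Q₂ R X₁ X₂ S₁ S₂ T₁ T₂ T₃ : A) (hR : R = Q₂ + X₁ + t • P₂)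
    (hX : γ • R = T₃ + S₂ + X₂ + β • (T₂ + S₁ + α • T₁)) :
    β • (P₁ + s • Q₁ - (s * t * γ) • X₂) =
      β • (P₁ - s • P₂) + (s * γ) • (β * γ) • (Q₁ - t • Q₂) +
        -((s * t * γ * α) • ((α * β * γ) • X₁ - (T₁ + α • S₁ + α • (T₂ + β • S₂ + β • T₃)))) := by
  obtain rfl : X₂ = γ • R - (T₃ + S₂ + β • (T₂ + S₁ + α • T₁)) := by rw [hX]; abel
  subst hR
  rcases Int.units_eq_one_or α with rfl | rfl <;>
  rcases Int.units_eq_one_or β with rfl | rfl <;>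
  rcases Int.units_eq_one_or γ with rfl | rfl <;>
  rcases Int.units_eq_one_or s with rfl | rfl <;>
  rcases Int.units_eq_one_or t with rfl | rfl <;>
  simp only [one_smul, mul_one, mul_neg, Units.neg_smul, neg_neg] <;>
  abel

/-- The bracket with a cocycle is a derivation of the cup product of cocycles up to a
coboundary. -/
theorem exists_br_cup {a b c ab ac bc : ℤ} (hab : a + b = ab) (hac : a + c = ac + 1)
    (hbc : b + c = bc + 1) (hd : ab + c = d + 2) {x : V a} {y : V b} {z : V c}
    (hx : O.δ (a + 1) x = 0) (hy : O.δ (b + 1) y = 0) (hz : O.δ (c + 1) z = 0) :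
    ∃ w : V d, O.br (d + 1) (O.cup ab x y) z = O.cup (d + 1) (O.br ac x z) y +
      (a * (c - 1)).negOnePow • O.cup (d + 1) x (O.br bc y z) + O.δ (d + 1) w := by
  -- The boundary of `z{x, y}` is governed by `h₃`. Since `z` is a cocycle, `h₂` and `h₄` expand the
  -- same element up to sign, which links the braces into `z` with those into `μ`.
  refine ⟨-((koszul a c * koszul b c * koszul c 2 * koszul a 2) • O.brace₂ bc d z x y), ?_⟩
  have h₁ := O.dia_brace₂ (xg := b + 1) (xq := c + 1) (xfg := ab) (xgq := bc + 1) (fq := ac)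
    (gq := bc) (d := d + 1) (by omega) (by omega) (by omega) (by omega) (by omega) (by omega)
    (by omega) O.μ x y z
  have h₂ := O.brace₂_dia (xq := c + 1) (xg := b + 1) (xqg := bc + 1) (xgf := ab) (qg := bc)
    (qf := ac) (qgf := d) (d := d + 1) (by omega) (by omega) (by omega) (by omega) (by omega)
    (by omega) (by omega) (by omega) O.μ z x y
  have h₃ := O.dia_brace₂ (xg := bc) (xq := c + 1) (xfg := d) (xgq := bc + 1) (fq := a + 1)
    (gq := b + 1) (d := d + 1) (by omega) (by omega) (by omega) (by omega) (by omega) (by omega)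
    (by omega) z x y O.μ
  have h₄ := O.brace₂_dia (xq := c + 1) (xg := bc) (xqg := bc + 1) (xgf := d) (qg := b + 1)
    (qf := a + 1) (qgf := ab) (d := d + 1) (by omega) (by omega) (by omega) (by omega) (by omega)
    (by omega) (by omega) (by omega) z O.μ x y
  rw [δ_apply, sub_eq_zero] at hx hy hz
  rw [← hx, ← hy] at h₃
  rw [← hz] at h₄
  have e₁ : koszul ab c = koszul a c * koszul b c * koszul c 2 := by
    rw [koszul_of_add_eq (show a + (b + 1) = ab + 1 by omega),
      koszul_of_add_eq (show b + 2 = b + 1 + 1 by omega), koszul_comm 2, mul_assoc]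
  have e₂ : koszul d 2 = koszul a 2 * koszul b 2 * koszul c 2 := by
    rw [koszul_of_add_eq (show a + bc = d + 1 by omega), koszul_of_add_eq hbc, mul_assoc]
  simp only [brace₃_μ, koszul_comm 2, koszul_comm c b, smul_zero, add_zero, zero_add,
    O.brace₂_smul_left, O.brace₂_smul_right, O.brace₂_smul] at h₁ h₂ h₃ h₄
  simp only [map_neg, cup_apply, δ_apply, O.br_apply, map_intUnits_smul, LinearMap.smul_apply, e₁, e₂,
    negOnePow_mul_sub_one, koszul_of_add_eq hbc, O.brace₂_sub_left, O.brace₂_sub_right,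
    O.brace₂_smul_left, O.brace₂_smul_right, h₁, h₃]
  exact sign_identity _ _ _ _ _ _ _ _ _ _ _ _ _ _ _ _ _ h₂ h₄

end MultiplicativeOperad

/-! ## The operad of equivariant cochains -/

section EquivariantOperad

variable (k : Type w) [Field k] {C : Type u₁} [Category.{v₁} C] [MonoidalCategory C]
  {D : Type u₂} [Category.{v₂} D] [MonoidalCategory D] [Preadditive D] [Linear k D]
  [MonoidalPreadditive D] [MonoidalLinear k D]
  {F : C ⥤ D} [F.Monoidal] (U : CentralCoalgebra F)

/-- The signed partial compositions of equivariant cochains. -/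
def circ {m n : ℤ} (l : ℤ) (i : ℕ) :
    equivCochains k U m →ₗ[k] equivCochains k U n →ₗ[k] equivCochains k U l :=
  if h : m + n = l + 1 then
    LinearMap.mk₂ k
      (fun f g => ((i : ℤ) * (n - 1)).negOnePow •
        ⟨diamondAt l i (f : Family U m) (g : Family U n), diamondAt_mem f.2 g.2 h i⟩)
      (fun f f' g => by
        rw [← smul_add]; exact congrArg _ (Subtype.ext (diamondAt_add_left l i f.1 f'.1 g.1)))
      (fun r f g => by
        rw [smul_comm]; exact congrArg _ (Subtype.ext (diamondAt_smul_left l i r f.1 g.1)))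
      (fun f g g' => by
        rw [← smul_add]; exact congrArg _ (Subtype.ext (diamondAt_add_right l i f.1 g.1 g'.1)))
      (fun r f g => by
        rw [smul_comm]; exact congrArg _ (Subtype.ext (diamondAt_smul_right l i r f.1 g.1)))
  else 0

variable {U} {m n p l l' d : ℤ}

lemma coe_units_smul (u : ℤˣ) (f : equivCochains k U n) :
    ((u • f : equivCochains k U n) : Family U n) = u • (f : Family U n) :=
  map_intUnits_smul (equivCochains k U n).subtype u f

lemma coe_circ (h : m + n = l + 1) (i : ℕ) (f : equivCochains k U m) (g : equivCochains k U n) :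
    (circ k U l i f g : Family U l) =
      ((i : ℤ) * (n - 1)).negOnePow • diamondAt l i (f : Family U m) (g : Family U n) := by
  rw [circ, dif_pos h]
  exact coe_units_smul k _ _

omit [MonoidalPreadditive D] in
lemma diamondAt_units_smul_left (i : ℕ) (u : ℤˣ) (f : Family U m) (g : Family U n) :
    diamondAt l i (u • f) g = u • diamondAt l i f g := by
  rcases Int.units_eq_one_or u with rfl | rfl
  · rw [one_smul, one_smul]
  · rw [Units.neg_smul, one_smul, Units.neg_smul, one_smul, eq_neg_iff_add_eq_zero,
      ← diamondAt_add_left, neg_add_cancel, diamondAt_zero_left]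

lemma diamondAt_units_smul_right (i : ℕ) (u : ℤˣ) (f : Family U m) (g : Family U n) :
    diamondAt l i f (u • g) = u • diamondAt l i f g := by
  rcases Int.units_eq_one_or u with rfl | rfl
  · rw [one_smul, one_smul]
  · rw [Units.neg_smul, one_smul, Units.neg_smul, one_smul, eq_neg_iff_add_eq_zero,
      ← diamondAt_add_right, neg_add_cancel, diamondAt_zero_right]

variable (U)

/-- The operad of equivariant cochains. -/
def equivOperad : MultiplicativeOperad k (fun n => equivCochains k U n) where
  circ l i := circ k U l i
  eq_zero_of_neg h x := Subtype.ext (Family.eq_zero_of_neg h x.1)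
  circ_nest {m n p l l' d} h₁ h₂ h₃ i j hj x f g := by
    ext1
    rw [coe_circ k h₃, coe_circ k h₁, coe_circ k (by omega), coe_circ k h₂,
      diamondAt_units_smul_left, diamondAt_units_smul_right,
      diamondAt_nest x.2 f.2 g.2 h₁ h₂ h₃ i j hj, smul_smul, smul_smul, ← Int.negOnePow_add,
      ← Int.negOnePow_add, show l' - 1 = (n - 1) + (p - 1) by omega]
    -- Both exponents equal `i(n - 1) + (i + j)(p - 1)`.
    congr 2
    push_cast
    ring
  circ_disjoint {m n p l l' d} h₁ h₂ h₃ i r n' hn x f g := by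
    ext1
    rw [coe_circ k h₃, coe_circ k h₁, coe_units_smul, coe_circ k (by omega), coe_circ k h₂,
      diamondAt_units_smul_left, diamondAt_units_smul_left,
      diamondAt_disjoint x.2 f.2 g.2 h₁ h₂ h₃ i r n' hn, smul_smul, smul_smul, smul_smul, koszul,
      ← Int.negOnePow_add, ← Int.negOnePow_add, ← Int.negOnePow_add]
    -- The positions `r + n + i` and `r + 1 + i` differ by `n - 1`, which contributes `(n - 1)(p -
    -- 1)`, the Koszul exponent.
    congr 2
    push_cast
    rw [hn]
    ring
  one := ⟨idCochain U 1, idCochain_mem 1⟩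
  circ_one {n} x := by
    ext1
    rw [coe_circ k (by omega), diamondAt_id_one]
    simp
  μ := ⟨idCochain U 2, idCochain_mem 2⟩
  circ_μ_μ := by
    ext1
    rw [Submodule.coe_add, coe_circ k (by omega), coe_circ k (by omega),
      diamondAt_id_id 0 (by omega) (by omega) (by omega),
      diamondAt_id_id 1 (by omega) (by omega) (by omega)]
    simp
  e := ⟨unitCochain U, unitCochain_eq (U := U) ▸ idCochain_mem 0⟩
  circ_μ_e_zero := by
    ext1
    rw [coe_circ k (by omega)]
    simp only [unitCochain_eq]
    rw [diamondAt_id_id 0 (by omega) (by omega) (by omega)]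
    simp
  circ_μ_e_one := by
    ext1
    rw [coe_circ k (by omega)]
    simp only [unitCochain_eq]
    rw [diamondAt_id_id 1 (by omega) (by omega) (by omega)]
    simp

variable {U}

lemma coe_dia (h : m + n = l + 1) (f : equivCochains k U m) (g : equivCochains k U n) :
    ((equivOperad k U).dia l f g : Family U l) = diamond l (f : Family U m) (g : Family U n) := by
  rw [GradedOperad.dia_apply, Submodule.coe_sum]
  exact Finset.sum_congr rfl fun i _ => coe_circ k h i f g

lemma coe_br (h : m + n = l + 1) (f : equivCochains k U m) (g : equivCochains k U n) :
    ((equivOperad k U).br l f g : Family U l) = bracket l (f : Family U m) (g : Family U n) := by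
  rw [GradedOperad.br_apply, Submodule.coe_sub, coe_units_smul, coe_dia k h,
    coe_dia k (by omega)]
  rfl

/-- The factor `koszul n 2` is `(-1)^(n-1)`. It cancels the sign of inserting `f` into input 1 of
`μ`, the first term, and is the sign of the last term; the sign `(-1)^i` of `μ` in input `i` of `f`
becomes `(-1)^(i+1)`. -/
lemma coe_δ (h : l = n + 1) (f : equivCochains k U n) :
    ((equivOperad k U).δ l f : Family U l) = differential k n l (f : Family U n) := by
  rw [differential_eq f.2 h, MultiplicativeOperad.δ_apply, Submodule.coe_sub, coe_units_smul,
    coe_dia k (by omega), coe_dia k (by omega), koszul_two_right, diamond, diamond,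
    show (2 : ℤ).toNat = 2 from rfl, Finset.sum_range_succ, Finset.sum_range_one]
  change _ • (_ • diamondAt l _ (idCochain U 2) (f : Family U n) +
    _ • diamondAt l _ (idCochain U 2) (f : Family U n)) -
      ∑ i ∈ _, _ • diamondAt l i (f : Family U n) (idCochain U 2) = _
  have e : (n + 1).negOnePow = (n - 1).negOnePow := by
    rw [Int.negOnePow_add, Int.negOnePow_sub]
  simp only [Int.negOnePow_succ, e, Units.neg_smul, Finset.sum_neg_distrib, smul_add, smul_smul,
    show (2 : ℤ) - 1 = 1 from rfl, mul_one, Nat.cast_zero, Nat.cast_one, zero_mul, one_mul,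
    Int.negOnePow_zero, Int.units_mul_self, one_smul]
  abel

/-- Exchanging the two insertions gives `koszul m n`, which with `koszul n 2` cancels the sign
`(-1)^(m(n-1))` of inserting `g` at position `m`. -/
lemma coe_cup (h : m + n = l) (f : equivCochains k U m) (g : equivCochains k U n) :
    ((equivOperad k U).cup l f g : Family U l) = cup l (f : Family U m) (g : Family U n) := by
  rcases lt_or_ge m 0 with hm | hm
  · rw [(equivOperad k U).eq_zero_of_neg hm f]
    simp [cup_zero_left]
  have H := (equivOperad k U).circ_disjoint (l := m + 1) (l' := n + 1) (d := l) (by omega)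
    (by omega) (by omega) 0 0 m.toNat (by omega) (equivOperad k U).μ f g
  have H' : ((equivOperad k U).circ l 0 ((equivOperad k U).circ (n + 1) 1 (equivOperad k U).μ g) f :
      Family U l) = koszul m n • ((equivOperad k U).circ l m.toNat
        ((equivOperad k U).circ (m + 1) 0 (equivOperad k U).μ f) g : Family U l) := by
    simp only [zero_add, add_zero] at H
    rw [← coe_units_smul, H, smul_smul, koszul, Int.units_mul_self, one_smul]
  rw [cup_eq f.2 _ h, MultiplicativeOperad.cup_apply, MultiplicativeOperad.brace₂_μ,
    coe_units_smul, H']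
  change _ • _ • (circ k U l _ (circ k U (m + 1) _ _ _) _ : Family U l) = _
  rw [coe_circ k (by omega), coe_circ k (by omega), Int.toNat_of_nonneg hm,
    negOnePow_mul_sub_one, smul_smul, smul_smul, mul_comm (koszul n 2), Int.units_mul_self,
    one_smul, Nat.cast_zero, zero_mul, Int.negOnePow_zero, one_smul]
  rfl

end EquivariantOperad

/-! ## Cohomology -/

/-- A bilinear map descends to quotients of its source that it respects. -/
def liftQ₂ {k M N P : Type*} [CommRing k] [AddCommGroup M] [Module k M] [AddCommGroup N]
    [Module k N] [AddCommGroup P] [Module k P] (S : Submodule k M) (T : Submodule k N)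
    (φ : M →ₗ[k] N →ₗ[k] P) (hS : ∀ x ∈ S, ∀ y, φ x y = 0) (hT : ∀ x, ∀ y ∈ T, φ x y = 0) :
    M ⧸ S →ₗ[k] N ⧸ T →ₗ[k] P :=
  S.liftQ (T.liftQ φ.flip fun y hy => LinearMap.ext fun x => hT x y hy).flip fun x hx =>
    LinearMap.ext fun y => Submodule.Quotient.induction_on _ y fun y => hS x hx y

section Cohomology

variable (k : Type w) [Field k] {C : Type u₁} [Category.{v₁} C] [MonoidalCategory C]
  {D : Type u₂} [Category.{v₂} D] [MonoidalCategory D] [Preadditive D] [Linear k D]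
  [MonoidalPreadditive D] [MonoidalLinear k D]
  {F : C ⥤ D} [F.Monoidal] {U : CentralCoalgebra F} {a b c m n l : ℤ}

lemma coe_mem_cocycles_iff (f : equivCochains k U n) :
    (f : Family U n) ∈ cocycles k U n ↔ (equivOperad k U).δ (n + 1) f = 0 := by
  rw [← Submodule.coe_eq_zero, coe_δ k rfl]
  exact ⟨fun h => h.2, fun h => ⟨f.2, h⟩⟩

lemma coe_mem_coboundaries_iff (h : m + 1 = n) (f : equivCochains k U n) :
    (f : Family U n) ∈ coboundaries k U n ↔
      ∃ z, f = (equivOperad k U).δ n (z : equivCochains k U m) := by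
  obtain rfl : m = n - 1 := by omega
  refine ⟨fun ⟨z, hz, e⟩ => ⟨⟨z, hz⟩, Subtype.ext ?_⟩, ?_⟩
  · rw [coe_δ k (by omega)]; exact e.symm
  · rintro ⟨z, rfl⟩
    exact ⟨z, z.2, (coe_δ k (by omega) z).symm⟩

variable {k} in
/-- The cohomology class of an equivariant cocycle. -/
def equivCls (f : equivCochains k U n) (hf : (equivOperad k U).δ (n + 1) f = 0) :
    Cohomology k U n :=
  cls k f ((coe_mem_cocycles_iff k f).2 hf)

lemma exists_equivCls (x : Cohomology k U n) : ∃ f hf, equivCls (k := k) (U := U) f hf = x := by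
  obtain ⟨⟨f, hf⟩, rfl⟩ := Submodule.Quotient.mk_surjective _ x
  exact ⟨⟨f, hf.1⟩, (coe_mem_cocycles_iff k ⟨f, hf.1⟩).1 hf, rfl⟩

variable {k}

lemma equivCls_eq (h : m + 1 = n) {f g : equivCochains k U n}
    {hf : (equivOperad k U).δ (n + 1) f = 0} {hg : (equivOperad k U).δ (n + 1) g = 0}
    {z : equivCochains k U m} (e : f = g + (equivOperad k U).δ n z) :
    equivCls f hf = equivCls g hg :=
  (Submodule.Quotient.eq _).2 ((coe_mem_coboundaries_iff k h (f - g)).2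
    ⟨z, sub_eq_of_eq_add' e⟩)

lemma equivCls_congr {f g : equivCochains k U n}
    {hf : (equivOperad k U).δ (n + 1) f = 0} {hg : (equivOperad k U).δ (n + 1) g = 0}
    (e : f = g) : equivCls f hf = equivCls g hg := by
  subst e; rfl

lemma equivCls_add {f g : equivCochains k U n}
    (hf : (equivOperad k U).δ (n + 1) f = 0) (hg : (equivOperad k U).δ (n + 1) g = 0) :
    equivCls f hf + equivCls g hg = equivCls (f + g) (by rw [map_add, hf, hg, add_zero]) := rfl

lemma equivCls_neg {f : equivCochains k U n} (hf : (equivOperad k U).δ (n + 1) f = 0) :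
    -equivCls f hf = equivCls (-f) (by rw [map_neg, hf, neg_zero]) := rfl

lemma equivCls_smul (u : ℤˣ) {f : equivCochains k U n} (hf : (equivOperad k U).δ (n + 1) f = 0) :
    u • equivCls f hf = equivCls (u • f) (by rw [map_intUnits_smul, hf, smul_zero]) := by
  rcases Int.units_eq_one_or u with rfl | rfl
  · rw [one_smul]; exact equivCls_congr (one_smul _ _).symm
  · rw [Units.neg_smul, one_smul, equivCls_neg]
    exact equivCls_congr (by rw [Units.neg_smul, one_smul])

lemma equivCls_zero : equivCls (0 : equivCochains k U n) (map_zero _) = 0 := rfl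

/-! ### Descent of bilinear operations and the algebra laws on cohomology. -/

/-- An operation on equivariant cochains that descends to cohomology. -/
structure Descends (Φ : equivCochains k U a →ₗ[k] equivCochains k U b →ₗ[k] equivCochains k U c) :
    Prop where
  cocycle : ∀ f g, (equivOperad k U).δ (a + 1) f = 0 → (equivOperad k U).δ (b + 1) g = 0 →
    (equivOperad k U).δ (c + 1) (Φ f g) = 0
  left : ∀ (f : equivCochains k U (a - 1)) (g), (equivOperad k U).δ (b + 1) g = 0 →
    ∃ z : equivCochains k U (c - 1), Φ ((equivOperad k U).δ a f) g = (equivOperad k U).δ c z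
  right : ∀ (f) (g : equivCochains k U (b - 1)), (equivOperad k U).δ (a + 1) f = 0 →
    ∃ z : equivCochains k U (c - 1), Φ f ((equivOperad k U).δ b g) = (equivOperad k U).δ c z

variable {Φ : equivCochains k U a →ₗ[k] equivCochains k U b →ₗ[k] equivCochains k U c}

/-- The inclusion of the cocycles into the cochains. -/
def cocycleIncl (n : ℤ) : cocycles k U n →ₗ[k] equivCochains k U n :=
  Submodule.inclusion inf_le_left

lemma δ_cocycleIncl (f : cocycles k U n) :
    (equivOperad k U).δ (n + 1) (cocycleIncl n f) = 0 :=
  (coe_mem_cocycles_iff k (cocycleIncl n f)).1 f.2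

/-- The operation on cocycles induced by an operation that descends to cohomology. -/
def Descends.cocycleMap (h : Descends Φ) :
    cocycles k U a →ₗ[k] cocycles k U b →ₗ[k] cocycles k U c :=
  LinearMap.mk₂ k
    (fun f g => ⟨(Φ (cocycleIncl a f) (cocycleIncl b g)).1, (coe_mem_cocycles_iff k _).2
      (h.cocycle _ _ (δ_cocycleIncl f) (δ_cocycleIncl g))⟩)
    (fun f f' g => Subtype.ext (by simp only [map_add, LinearMap.add_apply, Submodule.coe_add]))
    (fun r f g => Subtype.ext (by simp only [map_smul, LinearMap.smul_apply, Submodule.coe_smul]))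
    (fun f g g' => Subtype.ext (by simp only [map_add, Submodule.coe_add]))
    (fun r f g => Subtype.ext (by simp only [map_smul, Submodule.coe_smul]))

lemma Descends.cocycleMap_left (h : Descends Φ) (f : cocycles k U a) (hf : f.1 ∈ coboundaries k U a)
    (g : cocycles k U b) : (h.cocycleMap f g).1 ∈ coboundaries k U c := by
  obtain ⟨z, hz⟩ := (coe_mem_coboundaries_iff k (sub_add_cancel a 1) (cocycleIncl a f)).1 hf
  obtain ⟨y, hy⟩ := h.left z _ (δ_cocycleIncl g)
  exact (coe_mem_coboundaries_iff k (sub_add_cancel c 1)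
    (Φ (cocycleIncl a f) (cocycleIncl b g))).2 ⟨y, by rw [hz, hy]⟩

lemma Descends.cocycleMap_right (h : Descends Φ) (f : cocycles k U a) (g : cocycles k U b)
    (hg : g.1 ∈ coboundaries k U b) : (h.cocycleMap f g).1 ∈ coboundaries k U c := by
  obtain ⟨z, hz⟩ := (coe_mem_coboundaries_iff k (sub_add_cancel b 1) (cocycleIncl b g)).1 hg
  obtain ⟨y, hy⟩ := h.right _ z (δ_cocycleIncl f)
  exact (coe_mem_coboundaries_iff k (sub_add_cancel c 1)
    (Φ (cocycleIncl a f) (cocycleIncl b g))).2 ⟨y, by rw [hz, hy]⟩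

/-- The operation induced on cohomology. -/
def Descends.map (h : Descends Φ) :
    Cohomology k U a →ₗ[k] Cohomology k U b →ₗ[k] Cohomology k U c :=
  liftQ₂ _ _ (h.cocycleMap.compr₂ (Submodule.mkQ _))
    (fun f hf g => (Submodule.Quotient.mk_eq_zero _).2 (h.cocycleMap_left f hf g))
    (fun f g hg => (Submodule.Quotient.mk_eq_zero _).2 (h.cocycleMap_right f g hg))

lemma Descends.map_equivCls (h : Descends Φ) {f : equivCochains k U a} {g : equivCochains k U b}
    (hf : (equivOperad k U).δ (a + 1) f = 0) (hg : (equivOperad k U).δ (b + 1) g = 0) :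
    h.map (equivCls f hf) (equivCls g hg) = equivCls (Φ f g) (h.cocycle f g hf hg) := rfl

variable (k U)

/-- All three parts are the Leibniz rule `δ_cup` with one or both of its terms zero; the sign in the
last witness undoes the one in the rule. -/
lemma descends_cup (h : a + b = c) :
    Descends ((equivOperad k U).cup c : equivCochains k U a →ₗ[k] equivCochains k U b →ₗ[k] _) where
  cocycle f g hf hg := by
    rw [(equivOperad k U).δ_cup h rfl rfl rfl, hf, hg]
    simp
  left f g hg := by
    refine ⟨(equivOperad k U).cup (c - 1) f g, ?_⟩
    rw [(equivOperad k U).δ_cup (m' := a) (n' := b + 1) (by omega) (by omega) rfl (by omega), hg]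
    simp
  right f g hf := by
    refine ⟨a.negOnePow • (equivOperad k U).cup (c - 1) f g, ?_⟩
    rw [map_intUnits_smul, (equivOperad k U).δ_cup (m' := a + 1) (n' := b) (by omega) rfl
      (by omega) (by omega), hf, smul_add, smul_smul, Int.units_mul_self]
    simp

lemma descends_br (h : a + b = c + 1) :
    Descends ((equivOperad k U).br c : equivCochains k U a →ₗ[k] equivCochains k U b →ₗ[k] _) where
  cocycle f g hf hg := by
    rw [(equivOperad k U).δ_br h rfl rfl rfl, hf, hg]
    simp
  left f g hg := by
    refine ⟨koszul b 2 • (equivOperad k U).br (c - 1) f g, ?_⟩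
    rw [map_intUnits_smul, (equivOperad k U).δ_br (m' := a) (n' := b + 1) (by omega) (by omega)
      rfl (by omega), hg, smul_add, smul_smul, Int.units_mul_self]
    simp
  right f g hf := by
    refine ⟨(equivOperad k U).br (c - 1) f g, ?_⟩
    rw [(equivOperad k U).δ_br (m' := a + 1) (n' := b) (by omega) rfl (by omega) (by omega), hf]
    simp

lemma isGradedLieAlgebra_cohomology :
    IsGradedLieAlgebra k (Cohomology k U) (fun _ _ _ h => (descends_br k U h).map) where
  antisymm a b c h h' x y := by
    obtain ⟨x, hx, rfl⟩ := exists_equivCls k x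
    obtain ⟨y, hy, rfl⟩ := exists_equivCls k y
    rw [Descends.map_equivCls, Descends.map_equivCls, equivCls_smul, equivCls_neg]
    exact equivCls_congr ((equivOperad k U).br_antisymm x y)
  jacobi a b c ab bc ac d hab hbc hac h₁ h₂ h₃ x y z := by
    obtain ⟨x, hx, rfl⟩ := exists_equivCls k x
    obtain ⟨y, hy, rfl⟩ := exists_equivCls k y
    obtain ⟨z, hz, rfl⟩ := exists_equivCls k z
    simp only [Descends.map_equivCls]
    rw [equivCls_smul, equivCls_add]
    exact equivCls_congr ((equivOperad k U).br_br hab hbc hac h₁ x y z)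
  lie_self a c h x ha := by
    obtain ⟨x, hx, rfl⟩ := exists_equivCls k x
    rw [Descends.map_equivCls, ← equivCls_zero]
    exact equivCls_congr ((equivOperad k U).br_self ha x)
  lie_lie_self a c d h h' x ha := by
    obtain ⟨x, hx, rfl⟩ := exists_equivCls k x
    rw [Descends.map_equivCls, Descends.map_equivCls, ← equivCls_zero]
    exact equivCls_congr ((equivOperad k U).br_br_self h h' ha x)

lemma isGerstenhaberAlgebra_cohomology :
    IsGerstenhaberAlgebra k (Cohomology k U)
      (equivCls (equivOperad k U).e (equivOperad k U).δ_e)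
      (fun _ _ _ h => (descends_cup k U h).map) (fun _ _ _ h => (descends_br k U h).map) where
  one_mul a h x := by
    obtain ⟨x, hx, rfl⟩ := exists_equivCls k x
    exact (Descends.map_equivCls _ _ _).trans (equivCls_congr ((equivOperad k U).e_cup x))
  mul_one a h x := by
    obtain ⟨x, hx, rfl⟩ := exists_equivCls k x
    exact (Descends.map_equivCls _ _ _).trans (equivCls_congr ((equivOperad k U).cup_e x))
  mul_assoc a b c ab bc d hab hbc h₁ h₂ x y z := by
    obtain ⟨x, hx, rfl⟩ := exists_equivCls k x
    obtain ⟨y, hy, rfl⟩ := exists_equivCls k y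
    obtain ⟨z, hz, rfl⟩ := exists_equivCls k z
    simp only [Descends.map_equivCls]
    exact equivCls_congr ((equivOperad k U).cup_assoc hab hbc h₁ x y z)
  mul_comm a b c h h' x y := by
    obtain ⟨x, hx, rfl⟩ := exists_equivCls k x
    obtain ⟨y, hy, rfl⟩ := exists_equivCls k y
    -- The homotopy lives in degree `c - 1`, which always exists since degrees are integers.
    obtain ⟨l, rfl⟩ : ∃ l, c = l + 1 := ⟨c - 1, by omega⟩
    obtain ⟨z, hz⟩ := (equivOperad k U).exists_cup_comm h hx hy
    rw [Descends.map_equivCls, Descends.map_equivCls, equivCls_smul]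
    exact equivCls_eq rfl hz
  isGradedLieAlgebra := isGradedLieAlgebra_cohomology k U
  leibniz a b c ab ac bc d hab hac hbc h₁ h₂ h₃ x y z := by
    obtain ⟨x, hx, rfl⟩ := exists_equivCls k x
    obtain ⟨y, hy, rfl⟩ := exists_equivCls k y
    obtain ⟨z, hz, rfl⟩ := exists_equivCls k z
    obtain ⟨l, rfl⟩ : ∃ l, d = l + 1 := ⟨d - 1, by omega⟩
    obtain ⟨w, hw⟩ := (equivOperad k U).exists_br_cup (d := l) hab hac hbc
      (by omega) hx hy hz
    simp only [Descends.map_equivCls]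
    rw [equivCls_smul, equivCls_add]
    exact equivCls_eq rfl hw

end Cohomology

end DavydovYetter

end

/-! ### The theorem, read off from the operad of equivariant cochains. -/

open DavydovYetter in
theorem proposition3p10
    {k : Type w} [Field k]
    {C : Type u₁} [Category.{v₁} C] [Preadditive C] [Linear k C] [MonoidalCategory C]
    [MonoidalPreadditive C] [MonoidalLinear k C]
    {D : Type u₂} [Category.{v₂} D] [Preadditive D] [Linear k D] [MonoidalCategory D]
    [MonoidalPreadditive D] [MonoidalLinear k D]
    (F : C ⥤ D) [F.Additive] [F.Linear k] [F.Monoidal] (U : CentralCoalgebra F) :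
    -- the equivariant cochains form a complex, closed under the `◇ᵢ` and under `∪`
    (∀ n : ℤ, ∀ f ∈ equivCochains k U n,
      differential k n (n + 1) f ∈ equivCochains k U (n + 1) ∧
      differential k (n + 1) (n + 1 + 1) (differential k n (n + 1) f) = 0) ∧
    (∀ (m n l : ℤ) (i : ℕ), m + n = l + 1 →
      ∀ f ∈ equivCochains k U m, ∀ g ∈ equivCochains k U n,
        diamondAt l i f g ∈ equivCochains k U l) ∧
    (∀ m n l : ℤ, m + n = l →
      ∀ f ∈ equivCochains k U m, ∀ g ∈ equivCochains k U n, cup l f g ∈ equivCochains k U l) ∧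
    -- `[-, -]` is a graded Lie bracket on them
    (∃ br : ∀ a b c : ℤ, a + b = c + 1 →
        (equivCochains k U a →ₗ[k] equivCochains k U b →ₗ[k] equivCochains k U c),
      (∀ (a b c : ℤ) (h : a + b = c + 1) (f : equivCochains k U a) (g : equivCochains k U b),
        (br a b c h f g : Family U c) = bracket c (f : Family U a) (g : Family U b)) ∧
      IsGradedLieAlgebra k (fun n => equivCochains k U n) br) ∧
    -- the cup product and `[-, -]` descend to cohomology, which is a Gerstenhaber algebra
    (∃ (h₀ : unitCochain U ∈ cocycles k U 0)
      (mul : ∀ a b c : ℤ, a + b = c →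
        (Cohomology k U a →ₗ[k] Cohomology k U b →ₗ[k] Cohomology k U c))
      (br : ∀ a b c : ℤ, a + b = c + 1 →
        (Cohomology k U a →ₗ[k] Cohomology k U b →ₗ[k] Cohomology k U c)),
      (∀ (a b c : ℤ) (h : a + b = c) (f : Family U a) (g : Family U b)
        (hf : f ∈ cocycles k U a) (hg : g ∈ cocycles k U b),
        ∃ hfg : cup c f g ∈ cocycles k U c,
          mul a b c h (cls k f hf) (cls k g hg) = cls k (cup c f g) hfg) ∧
      (∀ (a b c : ℤ) (h : a + b = c + 1) (f : Family U a) (g : Family U b)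
        (hf : f ∈ cocycles k U a) (hg : g ∈ cocycles k U b),
        ∃ hfg : bracket c f g ∈ cocycles k U c,
          br a b c h (cls k f hf) (cls k g hg) = cls k (bracket c f g) hfg) ∧
      IsGerstenhaberAlgebra k (Cohomology k U) (cls k (unitCochain U) h₀) mul br) := by
  have hcup (m n l : ℤ) (h : m + n = l) (f : Family U m) (hf : f ∈ equivCochains k U m)
      (g : Family U n) (hg : g ∈ equivCochains k U n) : cup l f g ∈ equivCochains k U l :=
    coe_cup k h ⟨f, hf⟩ ⟨g, hg⟩ ▸ Subtype.property _
  have hbr (m n l : ℤ) (h : m + n = l + 1) (f : Family U m) (hf : f ∈ equivCochains k U m)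
      (g : Family U n) (hg : g ∈ equivCochains k U n) : bracket l f g ∈ equivCochains k U l :=
    coe_br k h ⟨f, hf⟩ ⟨g, hg⟩ ▸ Subtype.property _
  refine ⟨fun n f hf => ⟨?_, ?_⟩, fun m n l i h f hf g hg => diamondAt_mem hf hg h i,
    fun m n l h f hf g hg => hcup m n l h f hf g hg,
    ⟨fun _ _ c _ => (equivOperad k U).br c, fun _ _ _ h f g => coe_br k h f g,
      (equivOperad k U).isGradedLieAlgebra⟩,
    (coe_mem_cocycles_iff k (equivOperad k U).e).2 (equivOperad k U).δ_e,
    fun _ _ _ h => (descends_cup k U h).map, fun _ _ _ h => (descends_br k U h).map,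
    fun a b c h f g hf hg => ?_, fun a b c h f g hf hg => ?_, isGerstenhaberAlgebra_cohomology k U⟩
  · exact coe_δ k rfl ⟨f, hf⟩ ▸ Subtype.property _
  · rw [← coe_δ k rfl ⟨f, hf⟩, ← coe_δ k rfl, (equivOperad k U).δ_δ rfl rfl]
    rfl
  · have hf' := (coe_mem_cocycles_iff k ⟨f, hf.1⟩).1 hf
    have hg' := (coe_mem_cocycles_iff k ⟨g, hg.1⟩).1 hg
    have e := coe_cup k h ⟨f, hf.1⟩ ⟨g, hg.1⟩
    refine ⟨e ▸ (coe_mem_cocycles_iff k _).2 ((descends_cup k U h).cocycle _ _ hf' hg'), ?_⟩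
    exact congrArg Submodule.Quotient.mk (Subtype.ext e)
  · have hf' := (coe_mem_cocycles_iff k ⟨f, hf.1⟩).1 hf
    have hg' := (coe_mem_cocycles_iff k ⟨g, hg.1⟩).1 hg
    have e := coe_br k h ⟨f, hf.1⟩ ⟨g, hg.1⟩
    refine ⟨e ▸ (coe_mem_cocycles_iff k _).2 ((descends_br k U h).cocycle _ _ hf' hg'), ?_⟩
    exact congrArg Submodule.Quotient.mk (Subtype.ext e)
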